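/- Let $\Phi$ be a reduced, simply-laced root system with Weyl group $W$, simple roots $\alpha_1,\dots,\alpha_r$, simple reflections $\sigma_1,\dots,\sigma_r$, positive roots $\Phi^+$ and root lattice $\Lambda$. Let $\varpi_1,\dots,\varpi_r$ be the fundamental weights and $\rho=\sum_k\varpi_k$. For $\lambda=\sum_i k_i\alpha_i\in\Lambda$ put $d(\lambda)=\sum_i k_i$ and $\mathbf x^\lambda=\prod_i x_i^{k_i}$. Write $i\sim j$ if $i$ and $j$ are adjacent in the Dynkin diagram. Let $q$ be a prime power, $\ell=(l_1,\dots,l_r)$ a tuple of nonnegative integers, and $F=\mathbb C(x_1,\dots,x_r)$. Define $\sigma_i\mathbf x=\mathbf x'$ by $x'_i=1/(qx_i)$, $x'_j=x_ix_j\sqrt q$ if $j\sim i$, and $x'_j=x_j$ otherwise. Define $\epsilon_i\mathbf x=\mathbf x'$ by $x'_j=-x_j$ if $j\sim i$ and $x'_j=x_j$ otherwise. For $f\in F$ let $f^{\pm}_{i,\ell}(\mathbf x)=\tfrac12\bigl(f(\mathbf x)\pm(-1)^{l_i}f(\epsilon_i\mathbf x)\bigr)$ and $$(f|_\ell\sigma_i)(\mathbf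 x)=-\frac{1-qx_i}{qx_i(1-x_i)}(x_i\sqrt q)^{l_i}f^+_{i,\ell}(\sigma_i\mathbf x)+\frac{1}{x_i\sqrt q}(x_i\sqrt q)^{l_i}f^-_{i,\ell}(\sigma_i\mathbf x).$$ The substitutions $f(\mathbf x)\mapsto f(\sigma_i\mathbf x)$ and the maps $f\mapsto f|_\ell\sigma_i$ extend (necessarily uniquely) to right actions $f(\mathbf x)\mapsto f(w\mathbf x)$ and $f\mapsto f|_\ell w$ of $W$ on $F$. Put $$\Delta(\mathbf x)=\prod_{\alpha\in\Phi^+}\bigl(1-q^{d(\alpha)}\mathbf x^{2\alpha}\bigr),\qquad D(\mathbf x)=\prod_{\alpha\in\Phi^+}\bigl(1-q^{d(\alpha)-1}\mathbf x^{2\alpha}\bigr),\qquad j(w,\mathbf x)=\Delta(\mathbf x)/\Delta(w\mathbf x),$$ $$f(\mathbf x;\ell)=\Delta(\mathbf x)^{-1}\sum_{w\in W}j(w,\mathbf x)\,(1|_\ell w)(\mathbf x).$$ Then $f(\mathbf x;\ell)=N(\mathbf x;\ell)/D(\mathbf x)$ for a polynomial $N(\mathbf x;\ell)=\sum_\lambda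 a_\lambda\mathbf x^\lambda\in\mathbb C[x_1,\dots,x_r]$, and the support $\{\lambda\in\Lambda: a_\lambda\neq0\}$ is contained in the polytope $$\Pi_\theta=\operatorname{conv}\{\theta-w\theta: w\in W\}\subset\Lambda\otimes\mathbb R,\qquad \theta=\rho+\sum_{k=1}^r l_k\varpi_k.$$ -/

import Mathlib

open Module

noncomputable section

namespace WeylSeries

/-! ### Rational functions and changes of variables -/

/-- The field `ℂ(x)` of rational functions in variables `x j` indexed by `τ`. -/
abbrev RatFun (τ : Type*) : Type _ := FractionRing (MvPolynomial τ ℂ)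

/-- The variable `x j`, as a rational function. -/
def x {τ : Type*} (j : τ) : RatFun τ := algebraMap (MvPolynomial τ ℂ) (RatFun τ) (MvPolynomial.X j)

/-- The constant `√q`, as a rational function. -/
def sqrtConst (τ : Type*) (q : ℕ) : RatFun τ := algebraMap ℂ (RatFun τ) ((Real.sqrt q : ℝ) : ℂ)

lemma x_ne_zero {τ : Type*} (j : τ) : (x j : RatFun τ) ≠ 0 := by
  unfold x
  rw [Ne, FaithfulSMul.algebraMap_eq_zero_iff]
  exact MvPolynomial.X_ne_zero j

lemma sqrtConst_ne_zero {τ : Type*} {q : ℕ} (hq : IsPrimePow q) : sqrtConst τ q ≠ 0 := by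
  unfold sqrtConst
  rw [Ne, FaithfulSMul.algebraMap_eq_zero_iff, Complex.ofReal_eq_zero]
  exact (Real.sqrt_pos.2 (by exact_mod_cast hq.pos)).ne'

lemma natCast_ne_zero {τ : Type*} {q : ℕ} (hq : IsPrimePow q) : (q : RatFun τ) ≠ 0 := by
  have h := (algebraMap ℂ (RatFun τ)).injective.ne
    (show (q : ℂ) ≠ 0 by exact_mod_cast hq.ne_zero)
  simpa using h

/-- Finitely many rational functions that generate `ℂ(x)`, as many as there are variables, are
algebraically independent. -/
lemma aeval_injective {τ : Type*} [Finite τ] (y : τ → RatFun τ)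
    (hy : ∀ j, x j ∈ IntermediateField.adjoin ℂ (Set.range y)) :
    Function.Injective (MvPolynomial.aeval (R := ℂ) y) := by
  have hpoly : ∀ p : MvPolynomial τ ℂ,
      algebraMap _ (RatFun τ) p ∈ IntermediateField.adjoin ℂ (Set.range y) := by
    intro p
    induction p using MvPolynomial.induction_on with
    | C a =>
      have h : algebraMap _ (RatFun τ) (MvPolynomial.C (σ := τ) a) = algebraMap ℂ (RatFun τ) a := by
        rw [← MvPolynomial.algebraMap_eq, ← IsScalarTower.algebraMap_apply]
      rw [h]
      exact IntermediateField.algebraMap_mem _ a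
    | add p r hp hr => rw [map_add]; exact add_mem hp hr
    | mul_X p j hp => rw [map_mul]; exact mul_mem hp (hy j)
  have halg : Algebra.IsAlgebraic (Algebra.adjoin ℂ (Set.range y)) (RatFun τ) := by
    refine ⟨fun f => ?_⟩
    have hf : f ∈ IntermediateField.adjoin ℂ (Set.range y) := by
      obtain ⟨a, c, -, rfl⟩ := IsFractionRing.div_surjective (MvPolynomial τ ℂ) f
      exact div_mem (hpoly a) (hpoly c)
    obtain ⟨a, ha, c, hc, rfl⟩ := IntermediateField.mem_adjoin_iff_div.1 hf
    have ha' : IsAlgebraic (Algebra.adjoin ℂ (Set.range y)) a :=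
      isAlgebraic_algebraMap (⟨a, ha⟩ : Algebra.adjoin ℂ (Set.range y))
    have hc' : IsAlgebraic (Algebra.adjoin ℂ (Set.range y)) c :=
      isAlgebraic_algebraMap (⟨c, hc⟩ : Algebra.adjoin ℂ (Set.range y))
    rw [div_eq_mul_inv]
    exact ha'.mul hc'.inv
  have hX : AlgebraicIndependent ℂ (fun j : τ => (x j : RatFun τ)) := by
    have h : Function.Injective (MvPolynomial.aeval (R := ℂ) (fun j : τ => (x j : RatFun τ))) := by
      have h2 : MvPolynomial.aeval (R := ℂ) (fun j : τ => (x j : RatFun τ)) =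
          IsScalarTower.toAlgHom ℂ (MvPolynomial τ ℂ) (RatFun τ) := by
        ext j
        simp [x]
      rw [h2]
      exact IsFractionRing.injective (MvPolynomial τ ℂ) (RatFun τ)
    exact h
  exact (Algebra.IsAlgebraic.isTranscendenceBasis_of_lift_le_trdeg_of_finite (x := y) ℂ
    hX.lift_cardinalMk_le_trdeg).1

/-- The point `σ_i x` of the reflection in the node `i` of the graph `G`. -/
def sigmaPt {τ : Type*} (G : SimpleGraph τ) (q : ℕ) (i j : τ) : RatFun τ :=
  open scoped Classical in
  if j = i then 1 / (q * x i) else if G.Adj i j then x i * x j * sqrtConst τ q else x j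

/-- The point `ε_i x` obtained by changing the sign of the variables adjacent to `i`. -/
def epsPt {τ : Type*} (G : SimpleGraph τ) (i j : τ) : RatFun τ :=
  open scoped Classical in
  if G.Adj i j then -x j else x j

lemma sigmaPt_injective {τ : Type*} [Finite τ] (G : SimpleGraph τ) {q : ℕ} (hq : IsPrimePow q)
    (i : τ) : Function.Injective (MvPolynomial.aeval (R := ℂ) (sigmaPt G q i)) := by
  apply aeval_injective
  have hmem : ∀ j, sigmaPt G q i j ∈ IntermediateField.adjoin ℂ (Set.range (sigmaPt G q i)) :=
    fun j => IntermediateField.subset_adjoin _ _ ⟨j, rfl⟩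
  have hq0 : (q : RatFun τ) ≠ 0 := natCast_ne_zero hq
  have hs0 : sqrtConst τ q ≠ 0 := sqrtConst_ne_zero hq
  have hi : x i ∈ IntermediateField.adjoin ℂ (Set.range (sigmaPt G q i)) := by
    have h : x i = (q * sigmaPt G q i i)⁻¹ := by
      have := x_ne_zero i
      simp only [sigmaPt, if_true]
      field_simp
    rw [h]
    exact inv_mem (mul_mem (natCast_mem _ q) (hmem i))
  intro j
  by_cases hji : j = i
  · exact hji ▸ hi
  by_cases hadj : G.Adj i j
  · have h : x j = sigmaPt G q i j / (x i * sqrtConst τ q) := by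
      have := x_ne_zero i
      simp only [sigmaPt, if_neg hji, if_pos hadj]
      field_simp
    rw [h]
    exact div_mem (hmem j) (mul_mem hi (IntermediateField.algebraMap_mem _ _))
  · simpa only [sigmaPt, if_neg hji, if_neg hadj] using hmem j

lemma epsPt_injective {τ : Type*} [Finite τ] (G : SimpleGraph τ) (i : τ) :
    Function.Injective (MvPolynomial.aeval (R := ℂ) (epsPt G i)) := by
  apply aeval_injective
  intro j
  have hmem : epsPt G i j ∈ IntermediateField.adjoin ℂ (Set.range (epsPt G i)) :=
    IntermediateField.subset_adjoin _ _ ⟨j, rfl⟩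
  by_cases hadj : G.Adj i j
  · have h := neg_mem hmem
    simpa only [epsPt, if_pos hadj, neg_neg] using h
  · simpa only [epsPt, if_neg hadj] using hmem

/-- The change of variables `f(x) ↦ f(σ_i x)` of `ℂ(x)`. -/
def sigma {τ : Type*} [Finite τ] (G : SimpleGraph τ) {q : ℕ} (hq : IsPrimePow q) (i : τ) :
    RatFun τ →ₐ[ℂ] RatFun τ :=
  IsFractionRing.liftAlgHom (sigmaPt_injective G hq i)

/-- The change of variables `f(x) ↦ f(ε_i x)` of `ℂ(x)`. -/
def eps {τ : Type*} [Finite τ] (G : SimpleGraph τ) (i : τ) : RatFun τ →ₐ[ℂ] RatFun τ :=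
  IsFractionRing.liftAlgHom (epsPt_injective G i)

lemma sigma_x {τ : Type*} [Finite τ] (G : SimpleGraph τ) {q : ℕ} (hq : IsPrimePow q) (i j : τ) :
    sigma G hq i (x j) = sigmaPt G q i j := by
  simp [sigma, x]

lemma eps_x {τ : Type*} [Finite τ] (G : SimpleGraph τ) (i j : τ) :
    eps G i (x j) = epsPt G i j := by
  simp [eps, x]

/-- `f⁺_{i,ℓ}(x) = (f(x) + (-1)^{l_i} f(ε_i x)) / 2`. -/
def plusPart {τ : Type*} [Finite τ] (G : SimpleGraph τ) (l : τ → ℕ) (i : τ) (f : RatFun τ) :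
    RatFun τ :=
  (f + (-1) ^ l i * eps G i f) / 2

/-- `f⁻_{i,ℓ}(x) = (f(x) - (-1)^{l_i} f(ε_i x)) / 2`. -/
def minusPart {τ : Type*} [Finite τ] (G : SimpleGraph τ) (l : τ → ℕ) (i : τ) (f : RatFun τ) :
    RatFun τ :=
  (f - (-1) ^ l i * eps G i f) / 2

/-- The `ℓ`-twisted action `f ↦ f|_ℓ σ_i` of a simple reflection on rational functions. -/
def slash {τ : Type*} [Finite τ] (G : SimpleGraph τ) {q : ℕ} (hq : IsPrimePow q) (l : τ → ℕ)
    (i : τ) (f : RatFun τ) : RatFun τ :=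
  -((1 - q * x i) / (q * x i * (1 - x i))) * (x i * sqrtConst τ q) ^ l i *
      sigma G hq i (plusPart G l i f) +
    1 / (x i * sqrtConst τ q) * (x i * sqrtConst τ q) ^ l i * sigma G hq i (minusPart G l i f)

/-! ### Root systems -/

section RootSystems

variable {ι V V' : Type*} [AddCommGroup V] [Module ℝ V] [AddCommGroup V'] [Module ℝ V']
  {P : RootPairing ι ℝ V V'}

/-- The Weyl group of a finite root system is finite. -/
instance weylGroup_finite [Finite ι] (P : RootPairing ι ℝ V V') [P.IsRootSystem] :
    Finite P.weylGroup := by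
  refine Finite.of_injective (fun w => (P.weylGroupToPerm w : ι → ι)) fun g h hgh => ?_
  apply Subtype.ext
  apply RootPairing.Equiv.weightHom_injective P
  apply LinearEquiv.toLinearMap_injective
  have hspan : (⊤ : Submodule ℝ V) ≤ Submodule.span ℝ (Set.range P.root) := by
    rw [RootPairing.IsRootSystem.span_root_eq_top]
  refine LinearMap.ext_on_range (v := P.root) (top_le_iff.1 hspan) fun i => ?_
  have hg := P.weylGroup_apply_root g i
  have hh := P.weylGroup_apply_root h i
  have : g • P.root i = h • P.root i := by
    rw [hg, hh, show P.weylGroupToPerm g i = P.weylGroupToPerm h i from congrFun hgh i]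
  exact this

/-- The Dynkin diagram without its edge labels: distinct simple roots are adjacent when they are
not orthogonal. -/
def dynkinGraph [P.IsCrystallographic] (b : P.Base) : SimpleGraph b.support :=
  SimpleGraph.fromRel fun i j => b.cartanMatrix i j ≠ 0

/-- The simple reflection in the simple root indexed by `i`, in the Weyl group. -/
def simpleRefl (b : P.Base) (i : b.support) : P.weylGroup :=
  RootPairing.weylGroup.ofIdx P i

/-- `A w f = f|w` is the right action of the Weyl group on rational functions in which the simple
reflections act by `S`.  Since they generate the Weyl group, there is at most one such `A`. -/
structure IsWeylAction (b : P.Base) (S : b.support → RatFun b.support → RatFun b.support)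
    (A : P.weylGroup → RatFun b.support → RatFun b.support) : Prop where
  one_apply : ∀ f, A 1 f = f
  mul_apply : ∀ v w f, A (v * w) f = A w (A v f)
  simple_apply : ∀ i f, A (simpleRefl b i) f = S i f

/-- The (index set of the) positive roots. -/
def posRoots [Finite ι] (b : P.Base) : Finset ι :=
  (Set.toFinite {i | b.IsPos i}).toFinset

/-- The monomial `x^λ = ∏ x_j ^ k_j` of `λ = ∑ k_j α_j` in the root lattice. -/
def mono (b : P.Base) (lam : P.rootSpan ℤ) : RatFun b.support :=
  ∏ j, x j ^ (b.toWeightBasisInt.repr lam j)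

/-- `Δ(x) = ∏_{α > 0} (1 - q^{d(α)} x^{2α})`, where `d` is the height. -/
def Delta [Finite ι] (b : P.Base) (q : ℕ) : RatFun b.support :=
  ∏ a ∈ posRoots b, (1 - (q : RatFun b.support) ^ b.height a *
    mono b ((2 : ℤ) • P.rootSpanMem ℤ a))

/-- `D(x) = ∏_{α > 0} (1 - q^{d(α)-1} x^{2α})`. -/
def denom [Finite ι] (b : P.Base) (q : ℕ) : RatFun b.support :=
  ∏ a ∈ posRoots b, (1 - (q : RatFun b.support) ^ (b.height a - 1) *
    mono b ((2 : ℤ) • P.rootSpanMem ℤ a))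

/-- `j(w,x) = Δ(x) / Δ(wx)`, where `subst w g` stands for `g(wx)`. -/
def jFactor [Finite ι] (b : P.Base) (q : ℕ)
    (subst : P.weylGroup → RatFun b.support → RatFun b.support) (w : P.weylGroup) :
    RatFun b.support :=
  Delta b q / subst w (Delta b q)

/-- `f(x;ℓ) = Δ(x)⁻¹ ∑_w j(w,x) (1|_ℓ w)(x)`, where `subst w g` stands for `g(wx)` and `act w g`
for `g|_ℓ w`. -/
def average [Finite ι] [P.IsRootSystem] (b : P.Base) (q : ℕ)
    (subst act : P.weylGroup → RatFun b.support → RatFun b.support) : RatFun b.support :=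
  letI := Fintype.ofFinite P.weylGroup
  (Delta b q)⁻¹ * ∑ w : P.weylGroup, jFactor b q subst w * act w 1

/-- The fundamental weights: the basis of `V` dual to the simple coroots. -/
def fundWeight [P.IsRootSystem] (b : P.Base) (k : b.support) : V :=
  P.toLinearMap.toPerfPair.symm (b.toCoweightBasis.coord k)

lemma fundWeight_coroot [P.IsRootSystem] (b : P.Base) (k j : b.support) :
    P.toLinearMap (fundWeight b k) (P.coroot j) = Finsupp.single j (1 : ℝ) k := by
  unfold fundWeight
  rw [LinearMap.apply_symm_toPerfPair_self, Basis.coord_apply,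
    RootPairing.Base.toCoweightBasis_repr_coroot]

/-- `θ = ρ + ∑ l_k ϖ_k`, where `ρ` is the sum of the fundamental weights `ϖ_k`. -/
def theta [P.IsRootSystem] (b : P.Base) (l : b.support → ℕ) : V :=
  ∑ k, fundWeight b k + ∑ k, (l k : ℝ) • fundWeight b k

/-- The permutahedron `Π_θ`: the convex hull of the points `θ - wθ`. -/
def permutahedron [P.IsRootSystem] (b : P.Base) (l : b.support → ℕ) : Set V :=
  convexHull ℝ (Set.range fun w : P.weylGroup => theta b l - w • theta b l)

end RootSystems

end WeylSeries

end

/-! Put a = √q and y_j = a x_j. Then σ_i acts on monomials in y through the simple reflection on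
exponents, q^{d(α)} x^{2α} = y^{2α}, and Δ = ∏ (1 - y^{2α}), D = ∏ (1 - a⁻² y^{2α}). The proof works
throughout with the y_j.

Both actions exist because W is the Coxeter group of its diagram (`coxeterToWeyl_bijective`), so
only the quadratic, commutation and braid relations of the generators have to be checked
(`twist_twist`, `twist_comm`, `twist_braid`).

Since Δ(σ_i x) = -y_i⁻² Δ(x), the summands K(w) = j(w,x) (1|w)(x) satisfy K(w σ_i) = T_i K(w) with
T_i f = -y_i² f|σ_i (`sop`, `kernel_mul`). Hence h = ∑ K(w) is fixed by every T_i, and f = h / Δ is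
invariant under the twisted action.

Denominator. Each T_i creates a pole along y_i = a, which is cleared by the factor of D for α_i.
Along a reduced word these poles are carried to distinct positive roots, so D K(w) is a Laurent
polynomial (`denomY_mul_kernel_mem_laurent`), and so is D h = (D f) Δ. It remains to cancel Δ. On
y_i = ±1 the equation T_i h = h degenerates to h = -h, so h vanishes there (`van_of_sop_eq`) and f
has no pole along y_i = ±1 for simple α_i. Invariance carries this regularity to all transforms of
these divisors (`good_of_twist_eq`), which include every divisor y^{2α} = 1. The condition a² ≠ 1
keeps them apart from the poles of the T_i. So the factors of Δ cancel one at a time and D f is a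
Laurent polynomial (`denomY_mul_mem_laurent`).

Support. For real weights n let `val` be the lowest weight of a term. Applying T_i reflects n and
adds (l_i + 1) n_i, which is exactly the recursion for θ - w⁻¹θ, because θ pairs to l_i + 1 with the
i-th simple coroot. Thus `val` of K(w) is at least n(θ - w⁻¹θ) (`le_val_kernel`). As D and Δ have
the same value, D f is bounded below by the minimum of n on the vertices of Π_θ. Since n is
arbitrary, separation by hyperplanes puts the support in Π_θ. For coordinate forms n the bound is
nonnegative, so D f has no negative exponents. -/

open Module

noncomputable section

set_option linter.unusedSectionVars false

namespace WeylSeries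

/-! ### The Weyl group as a Coxeter group -/

section Coxeter

variable {ι V V' : Type*} [AddCommGroup V] [Module ℝ V] [AddCommGroup V'] [Module ℝ V']
  {P : RootPairing ι ℝ V V'} [P.IsRootSystem]

lemma weylGroup_ext_root {g h : P.weylGroup} (H : ∀ i, g • P.root i = h • P.root i) : g = h := by
  apply Subtype.ext
  apply RootPairing.Equiv.weightHom_injective P
  apply LinearEquiv.toLinearMap_injective
  have hspan : (⊤ : Submodule ℝ V) ≤ Submodule.span ℝ (Set.range P.root) := by
    rw [RootPairing.IsRootSystem.span_root_eq_top]
  exact LinearMap.ext_on_range (v := P.root) (top_le_iff.1 hspan) fun i => H i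

lemma ofIdx_smul_vec (i : ι) (v : V) :
    RootPairing.weylGroup.ofIdx P i • v = P.reflection i v := by
  rw [RootPairing.weylGroup.ofIdx_smul]
  rfl

lemma ofIdx_reflectionPerm (i j : ι) :
    RootPairing.weylGroup.ofIdx P (P.reflectionPerm i j) =
      RootPairing.weylGroup.ofIdx P i * RootPairing.weylGroup.ofIdx P j *
        RootPairing.weylGroup.ofIdx P i :=
  weylGroup_ext_root fun k => by
    rw [mul_smul, mul_smul]
    simp only [ofIdx_smul_vec, RootPairing.reflection_reflectionPerm]
    rfl

lemma ofIdx_mul_self (i : ι) :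
    RootPairing.weylGroup.ofIdx P i * RootPairing.weylGroup.ofIdx P i = 1 :=
  weylGroup_ext_root fun k => by
    rw [mul_smul]
    simp

lemma weylGroupToPerm_ofIdx (i : ι) :
    P.weylGroupToPerm (RootPairing.weylGroup.ofIdx P i) = P.reflectionPerm i := by
  ext k
  apply P.root.injective
  rw [← P.weylGroup_apply_root, ofIdx_smul_vec, P.root_reflectionPerm]

variable [Finite ι] [P.IsCrystallographic] [P.IsReduced] (b : P.Base)

/-- Every root is reached from a simple root by simple reflections and negation, and reflecting a
root conjugates the reflection attached to it. -/
lemma closure_simpleRefl : Subgroup.closure (Set.range (simpleRefl b)) = ⊤ := by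
  have key : ∀ i, RootPairing.weylGroup.ofIdx P i ∈
      Subgroup.closure (Set.range (simpleRefl b)) := by
    intro i
    induction i using b.induction_reflect with
    | h₀ i hi =>
      rwa [ofIdx_reflectionPerm, ofIdx_mul_self, one_mul]
    | h₁ i hi => exact Subgroup.subset_closure ⟨⟨i, hi⟩, rfl⟩
    | h₂ i j hi hj =>
      rw [ofIdx_reflectionPerm]
      have hj' : RootPairing.weylGroup.ofIdx P j ∈ Subgroup.closure (Set.range (simpleRefl b)) :=
        Subgroup.subset_closure ⟨⟨j, hj⟩, rfl⟩
      exact mul_mem (mul_mem hj' hi) hj'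
  rw [eq_top_iff]
  rintro ⟨w, hw⟩ -
  induction hw using RootPairing.weylGroup.induction with
  | mem i => exact key i
  | one => exact one_mem _
  | mul x y hx hy h₁ h₂ => exact mul_mem h₁ h₂

open scoped Classical in
/-- The Coxeter matrix of a simply-laced Dynkin diagram. -/
def coxeterMat : CoxeterMatrix b.support where
  M := .of fun i j => if i = j then 1 else if (dynkinGraph b).Adj i j then 3 else 2
  isSymm := by
    ext i j
    simp [eq_comm, SimpleGraph.adj_comm]
  diagonal i := by simp
  off_diagonal i j h := by
    simp only [Matrix.of_apply, if_neg h]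
    split_ifs <;> simp

variable {b} (hsl : b.cartanMatrix.IsSimplyLaced)
include hsl

lemma pairing_of_adj {i j : b.support} (h : (dynkinGraph b).Adj i j) :
    P.pairingIn ℤ i j = -1 := by
  obtain ⟨hne, h⟩ := h
  have h0 : b.cartanMatrix i j ≠ 0 := by
    rcases h with h | h
    · exact h
    · rwa [Ne, RootPairing.Base.cartanMatrix_apply_eq_zero_iff_symm]
  exact (hsl hne).resolve_left h0

omit hsl in
lemma pairing_of_not_adj {i j : b.support} (hne : i ≠ j) (h : ¬ (dynkinGraph b).Adj i j) :
    P.pairingIn ℤ i j = 0 := by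
  simp only [dynkinGraph, SimpleGraph.fromRel_adj, not_and, not_or, not_not] at h
  exact (h hne).1

lemma root_reflectionPerm_of_adj {i j : b.support} (h : (dynkinGraph b).Adj i j) :
    P.root (P.reflectionPerm i j) = P.root i + P.root j := by
  rw [P.root_reflectionPerm, P.reflection_apply_root' ℤ, pairing_of_adj hsl h.symm]
  module

omit hsl in
lemma reflectionPerm_of_not_adj {i j : b.support} (hne : i ≠ j)
    (h : ¬ (dynkinGraph b).Adj i j) : P.reflectionPerm i j = j := by
  apply P.root.injective
  rw [P.root_reflectionPerm, P.reflection_apply_root' ℤ,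
    pairing_of_not_adj hne.symm fun h' => h h'.symm]
  module

omit hsl in
lemma simpleRefl_comm {i j : b.support} (hne : i ≠ j) (h : ¬ (dynkinGraph b).Adj i j) :
    simpleRefl b i * simpleRefl b j = simpleRefl b j * simpleRefl b i := by
  have h1 := ofIdx_reflectionPerm (P := P) i j
  rw [reflectionPerm_of_not_adj hne h] at h1
  unfold simpleRefl
  nth_rewrite 2 [h1]
  rw [mul_assoc _ _ (RootPairing.weylGroup.ofIdx P i), ofIdx_mul_self, mul_one]

lemma simpleRefl_braid {i j : b.support} (h : (dynkinGraph b).Adj i j) :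
    simpleRefl b i * simpleRefl b j * simpleRefl b i =
      simpleRefl b j * simpleRefl b i * simpleRefl b j := by
  unfold simpleRefl
  rw [← ofIdx_reflectionPerm, ← ofIdx_reflectionPerm]
  congr 1
  apply P.root.injective
  rw [root_reflectionPerm_of_adj hsl h, root_reflectionPerm_of_adj hsl h.symm, add_comm]

omit hsl in
lemma isLiftable_coxeterMat {G : Type*} [Monoid G] (f : b.support → G)
    (h2 : ∀ i, f i * f i = 1)
    (hc : ∀ i j, i ≠ j → ¬ (dynkinGraph b).Adj i j → f i * f j = f j * f i)
    (hb : ∀ i j, (dynkinGraph b).Adj i j → f i * f j * f i = f j * f i * f j) :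
    (coxeterMat b).IsLiftable f := by
  intro i j
  simp only [coxeterMat, Matrix.of_apply]
  split_ifs with hij hadj
  · rw [hij, pow_one, h2]
  · calc (f i * f j) ^ 3 = (f i * f j * f i) * (f j * f i * f j) := by
          simp only [pow_succ, pow_zero, one_mul, mul_assoc]
      _ = (f i * f j * f i) * (f i * f j * f i) := by rw [hb i j hadj]
      _ = f i * (f j * (f i * f i) * f j) * f i := by simp only [mul_assoc]
      _ = 1 := by rw [h2, mul_one, h2, mul_one, h2]
  · calc (f i * f j) ^ 2 = (f i * f j) * (f i * f j) := pow_two _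
      _ = (f i * f j) * (f j * f i) := by rw [hc i j hij hadj]
      _ = f i * (f j * f j) * f i := by simp only [mul_assoc]
      _ = 1 := by rw [h2, mul_one, h2]

/-- The canonical map from the abstract Coxeter group to the Weyl group. -/
def coxeterToWeyl : (coxeterMat b).Group →* P.weylGroup :=
  (coxeterMat b).toCoxeterSystem.lift ⟨simpleRefl b, isLiftable_coxeterMat _
    (fun _ => ofIdx_mul_self _) (fun _ _ => simpleRefl_comm) (fun _ _ => simpleRefl_braid hsl)⟩

lemma coxeterToWeyl_simple (i : b.support) :
    coxeterToWeyl hsl ((coxeterMat b).toCoxeterSystem.simple i) = simpleRefl b i :=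
  CoxeterSystem.lift_apply_simple _ _ i

/-- Induction on length, reducing to the rank two subgroup of s and a right descent t of w. Write w
= v t. If s and t commute, then wα_s = vα_s. Otherwise wα_s = vα_s + vα_t is a sum of positive
roots, unless s is a descent of v = u s, and then wα_s = uα_t. -/
lemma isPos_coxeterToWeyl (w : (coxeterMat b).Group) (s : b.support)
    (hs : ¬ (coxeterMat b).toCoxeterSystem.IsRightDescent w s) :
    b.IsPos (P.weylGroupToPerm (coxeterToWeyl hsl w) s) := by
  set cs := (coxeterMat b).toCoxeterSystem with hcs
  have hperm : ∀ (v : (coxeterMat b).Group) (t : b.support) (a : ι),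
      P.weylGroupToPerm (coxeterToWeyl hsl (v * cs.simple t)) a =
        P.weylGroupToPerm (coxeterToWeyl hsl v) (P.reflectionPerm t a) := by
    intro v t a
    rw [map_mul, map_mul, coxeterToWeyl_simple, Equiv.Perm.mul_apply]
    unfold simpleRefl
    rw [weylGroupToPerm_ofIdx]
  have hadd : ∀ (v : (coxeterMat b).Group) (s t : b.support), (dynkinGraph b).Adj t s →
      P.root (P.weylGroupToPerm (coxeterToWeyl hsl v) (P.reflectionPerm t s)) =
        P.root (P.weylGroupToPerm (coxeterToWeyl hsl v) s) +
        P.root (P.weylGroupToPerm (coxeterToWeyl hsl v) t) := by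
    intro v s t h
    simp only [← P.weylGroup_apply_root]
    rw [root_reflectionPerm_of_adj hsl h, smul_add, add_comm]
  induction hn : cs.length w using Nat.strong_induction_on generalizing w s with
  | _ n ih =>
    by_cases hw : w = 1
    · subst hw
      simpa using b.isPos_of_mem_support s.2
    obtain ⟨t, ht⟩ := cs.exists_rightDescent_of_ne_one hw
    have hts : t ≠ s := by rintro rfl; exact hs ht
    obtain ⟨v, rfl⟩ : ∃ v, w = v * cs.simple t := ⟨w * cs.simple t, by simp⟩
    rw [cs.isRightDescent_iff, cs.simple_mul_simple_cancel_right] at ht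
    rw [cs.not_isRightDescent_iff] at hs
    have hvt : ¬ cs.IsRightDescent v t := by
      rw [cs.not_isRightDescent_iff]; omega
    rw [hperm]
    by_cases hadj : (dynkinGraph b).Adj t s
    · by_cases hvs : cs.IsRightDescent v s
      · obtain ⟨u, rfl⟩ : ∃ u, v = u * cs.simple s := ⟨v * cs.simple s, by simp⟩
        rw [cs.isRightDescent_iff, cs.simple_mul_simple_cancel_right] at hvs
        rw [hperm]
        have hb : P.reflectionPerm s (P.reflectionPerm t s) = t := by
          apply P.root.injective
          rw [P.root_reflectionPerm, root_reflectionPerm_of_adj hsl hadj, map_add,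
            ← P.root_reflectionPerm, ← P.root_reflectionPerm,
            root_reflectionPerm_of_adj hsl hadj.symm, P.root_reflectionPerm,
            P.reflection_apply_self]
          module
        rw [hb]
        refine ih (cs.length u) (by omega) u t ?_ rfl
        -- If t were a descent of u, the braid relation would give w s = u s t s = u t s t, of
        -- length at most ℓ(u) + 1, whereas `hs` makes its length ℓ(u) + 3.
        intro hut
        rw [cs.isRightDescent_iff] at hut
        have hbr : u * cs.simple s * cs.simple t * cs.simple s =
            u * cs.simple t * cs.simple s * cs.simple t := by
          have h3 := cs.simple_mul_simple_pow s t
          have hM : coxeterMat b s t = 3 := by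
            simp [coxeterMat, hts.symm, hadj.symm]
          rw [hM] at h3
          have : cs.simple s * cs.simple t * cs.simple s =
              cs.simple t * cs.simple s * cs.simple t := by
            have h4 : (cs.simple s * cs.simple t * cs.simple s) *
                (cs.simple t * cs.simple s * cs.simple t) = 1 := by
              rw [← h3]; simp only [pow_succ, pow_zero, one_mul, mul_assoc]
            rw [mul_eq_one_iff_eq_inv] at h4
            rw [h4]
            simp [mul_assoc]
          simp only [mul_assoc] at this ⊢
          rw [this]
        rw [hbr] at hs
        have h5 := cs.length_mul_le (u * cs.simple t * cs.simple s) (cs.simple t)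
        have h6 := cs.length_mul_le (u * cs.simple t) (cs.simple s)
        simp only [cs.length_simple] at h5 h6
        omega
      · exact (ih (cs.length v) (by omega) v s hvs rfl).add
          (ih (cs.length v) (by omega) v t hvt rfl) (hadd v s t hadj)
    · rw [reflectionPerm_of_not_adj hts hadj]
      refine ih (cs.length v) (by omega) v s ?_ rfl
      -- If s were a descent of v, then w s = v s t would have length at most ℓ(v), whereas `hs`
      -- makes it ℓ(v) + 2.
      intro hvs
      rw [cs.isRightDescent_iff] at hvs
      have hcm : v * cs.simple t * cs.simple s = v * cs.simple s * cs.simple t := by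
        have h3 := cs.simple_mul_simple_pow s t
        have hM : coxeterMat b s t = 2 := by
          simp [coxeterMat, hts.symm, mt (fun h => SimpleGraph.Adj.symm h) hadj]
        rw [hM, pow_two, mul_eq_one_iff_eq_inv, mul_inv_rev, cs.inv_simple, cs.inv_simple] at h3
        rw [mul_assoc, ← h3, mul_assoc]
      rw [hcm] at hs
      have h5 := cs.length_mul_le (v * cs.simple s) (cs.simple t)
      simp only [cs.length_simple] at h5
      omega

omit hsl in
lemma weylGroupToPerm_simpleRefl (i : b.support) :
    P.weylGroupToPerm (simpleRefl b i) = P.reflectionPerm i :=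
  weylGroupToPerm_ofIdx _

omit hsl in
lemma not_isPos_of_root_eq_neg {i j : ι} (h : P.root j = -P.root i) (hi : b.IsPos i) :
    ¬ b.IsPos j := by
  let _ := P.indexNeg
  have : j = -i := P.root.injective (by simpa using h)
  rw [this, RootPairing.Base.IsPos.neg_iff_not, not_not]
  exact hi

/-- If w ≠ 1 maps to 1, choose a right descent t of w. Then t is not a descent of w t, so w t sends
α_t to a positive root; but w t acts as the reflection in α_t and sends it to -α_t. -/
lemma coxeterToWeyl_bijective : Function.Bijective (coxeterToWeyl hsl) := by
  set cs := (coxeterMat b).toCoxeterSystem with hcs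
  constructor
  · rw [injective_iff_map_eq_one]
    intro w hw
    by_contra hne
    obtain ⟨t, ht⟩ := cs.exists_rightDescent_of_ne_one hne
    have h1 := isPos_coxeterToWeyl hsl (w * cs.simple t) t
      ((cs.isRightDescent_iff_not_isRightDescent_mul).1 ht)
    rw [map_mul, hw, one_mul, coxeterToWeyl_simple, weylGroupToPerm_simpleRefl] at h1
    exact not_isPos_of_root_eq_neg (by rw [P.root_reflectionPerm, P.reflection_apply_self])
      (b.isPos_of_mem_support t.2) h1
  · rw [← MonoidHom.range_eq_top, eq_top_iff, ← closure_simpleRefl b, Subgroup.closure_le]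
    rintro _ ⟨i, rfl⟩
    exact ⟨cs.simple i, coxeterToWeyl_simple hsl i⟩

/-- The Weyl group of a simply-laced root system as a Coxeter group. -/
def weylCoxeter : CoxeterSystem (coxeterMat b) P.weylGroup :=
  (coxeterMat b).toCoxeterSystem.map
    (MulEquiv.ofBijective (coxeterToWeyl hsl) (coxeterToWeyl_bijective hsl))

lemma weylCoxeter_simple (i : b.support) : (weylCoxeter hsl).simple i = simpleRefl b i := by
  rw [weylCoxeter, CoxeterSystem.map_simple]
  exact coxeterToWeyl_simple hsl i

/-- Maps out of the Weyl group are given by the braid relations. -/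
lemma exists_weylGroup_lift {G : Type*} [Monoid G] (f : b.support → G)
    (h2 : ∀ i, f i * f i = 1)
    (hc : ∀ i j, i ≠ j → ¬ (dynkinGraph b).Adj i j → f i * f j = f j * f i)
    (hb : ∀ i j, (dynkinGraph b).Adj i j → f i * f j * f i = f j * f i * f j) :
    ∃ φ : P.weylGroup →* G, ∀ i, φ (simpleRefl b i) = f i :=
  ⟨(weylCoxeter hsl).lift ⟨f, isLiftable_coxeterMat f h2 hc hb⟩, fun i => by
    rw [← weylCoxeter_simple hsl, CoxeterSystem.lift_apply_simple]⟩

/-- Induction on the length of an element of the Weyl group. -/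
lemma weylGroup_induction {p : P.weylGroup → Prop} (one : p 1)
    (mul : ∀ w (i : b.support), b.IsPos (P.weylGroupToPerm w i) → p w → p (w * simpleRefl b i))
    (w : P.weylGroup) : p w := by
  obtain ⟨w, rfl⟩ := (coxeterToWeyl_bijective hsl).2 w
  set cs := (coxeterMat b).toCoxeterSystem with hcs
  induction hn : cs.length w using Nat.strong_induction_on generalizing w with
  | _ n ih =>
    by_cases hw : w = 1
    · rwa [hw, map_one]
    obtain ⟨t, ht⟩ := cs.exists_rightDescent_of_ne_one hw
    have h1 := isPos_coxeterToWeyl hsl (w * cs.simple t) t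
      ((cs.isRightDescent_iff_not_isRightDescent_mul).1 ht)
    have h2 := mul _ t h1 (ih _ (by rw [← hn]; exact ht) _ rfl)
    rwa [map_mul, coxeterToWeyl_simple, mul_assoc, simpleRefl, ofIdx_mul_self, mul_one] at h2

end Coxeter

/-! ### Weights of terms of rational functions, through Hahn series -/

section Laurent

variable {τ : Type*} {F : Type*} [Field F] [Algebra ℂ F] [Algebra (MvPolynomial τ ℂ) F]
  [IsScalarTower ℂ (MvPolynomial τ ℂ) F] [IsFractionRing (MvPolynomial τ ℂ) F]

/-- The variable `x_j` in a field of rational functions. -/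
def var (F : Type*) [Field F] [Algebra (MvPolynomial τ ℂ) F] (j : τ) : F :=
  algebraMap (MvPolynomial τ ℂ) F (MvPolynomial.X j)

/-- A complex number, as a constant rational function. -/
abbrev cst (F : Type*) [Field F] [Algebra ℂ F] (z : ℂ) : F := algebraMap ℂ F z

lemma algebraMap_C (z : ℂ) :
    algebraMap (MvPolynomial τ ℂ) F (MvPolynomial.C z) = cst F z := by
  rw [← MvPolynomial.algebraMap_eq, ← IsScalarTower.algebraMap_apply]

lemma var_ne_zero (j : τ) : var F j ≠ 0 := by
  rw [var, Ne, FaithfulSMul.algebraMap_eq_zero_iff]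
  exact MvPolynomial.X_ne_zero j

lemma ringHom_ext_var {K : Type*} [Field K] {f g : F →+* K}
    (hc : ∀ z, f (cst F z) = g (cst F z))
    (h : ∀ j : τ, f (var F j) = g (var F j)) : f = g := by
  apply IsFractionRing.ringHom_ext (A := MvPolynomial τ ℂ)
  intro p
  have h1 : f.comp (algebraMap (MvPolynomial τ ℂ) F) =
      g.comp (algebraMap (MvPolynomial τ ℂ) F) := by
    apply MvPolynomial.ringHom_ext
    · intro z
      rw [RingHom.comp_apply, RingHom.comp_apply, algebraMap_C, hc]
    · exact h
  exact DFunLike.congr_fun h1 p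

lemma algHom_ext_var {f g : F →ₐ[ℂ] F} (h : ∀ j : τ, f (var F j) = g (var F j)) : f = g := by
  apply AlgHom.coe_ringHom_injective
  apply ringHom_ext_var (τ := τ)
  · intro z
    simp
  · exact h

section Weight

variable [Fintype τ] (n : τ → ℝ)

/-- The weight `∑ n_j k_j` of an exponent. -/
def wt (k : τ → ℤ) : ℝ := ∑ j, n j * k j

lemma wt_add (k m : τ → ℤ) : wt n (k + m) = wt n k + wt n m := by
  simp [wt, mul_add, Finset.sum_add_distrib]

lemma wt_smul (c : ℤ) (k : τ → ℤ) : wt n (c • k) = c * wt n k := by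
  simp only [wt, Finset.mul_sum, Pi.smul_apply, smul_eq_mul, Int.cast_mul]
  exact Finset.sum_congr rfl fun _ _ => by ring

variable (F) in
/-- The substitution `x_j ↦ x_j t ^ n_j` on polynomials. -/
def hahnPoly : MvPolynomial τ ℂ →+* HahnSeries ℝ F :=
  MvPolynomial.eval₂Hom (HahnSeries.C.comp (algebraMap ℂ F))
    fun j => HahnSeries.single (n j) (var F j)

lemma hahnPoly_monomial (k : τ →₀ ℕ) (c : ℂ) :
    hahnPoly F n (MvPolynomial.monomial k c) =
      HahnSeries.single (wt n fun j => k j)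
        (algebraMap _ F (MvPolynomial.monomial k c)) := by
  have h1 : ∀ s : Finset τ, ∏ j ∈ s, HahnSeries.single (n j) (var F j) ^ k j =
      HahnSeries.single (∑ j ∈ s, n j * k j) (∏ j ∈ s, (var F j) ^ k j) := by
    classical
    intro s
    induction s using Finset.induction_on with
    | empty => simp
    | insert a s ha ih =>
      rw [Finset.prod_insert ha, Finset.sum_insert ha, Finset.prod_insert ha, ih,
        HahnSeries.single_pow, HahnSeries.single_mul_single, nsmul_eq_mul, mul_comm (k a : ℝ)]
  have h2 : (HahnSeries.C.comp (algebraMap ℂ F)) c = HahnSeries.single (0 : ℝ) (cst F c) := rfl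
  have h3 : algebraMap (MvPolynomial τ ℂ) F (MvPolynomial.monomial k c) =
      cst F c * ∏ j, var F j ^ k j := by
    rw [MvPolynomial.monomial_eq, Finsupp.prod_fintype _ _ (by simp),
      map_mul (algebraMap (MvPolynomial τ ℂ) F), algebraMap_C]
    simp [var]
  rw [h3, hahnPoly, MvPolynomial.coe_eval₂Hom, MvPolynomial.eval₂_monomial,
    Finsupp.prod_fintype _ _ (by simp), h1, h2, HahnSeries.single_mul_single, zero_add]
  simp [wt]

/-- The variables are kept in the coefficients next to the powers of t, so distinct monomials of
equal weight land in one coefficient without cancelling. -/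
lemma coeff_hahnPoly_ne_zero {p : MvPolynomial τ ℂ} {k : τ →₀ ℕ} (hk : k ∈ p.support) :
    (hahnPoly F n p).coeff (wt n fun j => k j) ≠ 0 := by
  classical
  have h1 : (hahnPoly F n p).coeff (wt n fun j => k j) = algebraMap _ F
      (∑ m ∈ p.support with wt n (fun j => m j) = wt n fun j => k j,
        MvPolynomial.monomial m (p.coeff m)) := by
    conv_lhs => rw [p.as_sum]
    rw [map_sum, HahnSeries.coeff_sum, map_sum, Finset.sum_filter]
    refine Finset.sum_congr rfl fun m _ => ?_
    rw [hahnPoly_monomial, HahnSeries.coeff_single]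
    simp only [eq_comm]
  rw [h1, Ne, FaithfulSMul.algebraMap_eq_zero_iff]
  intro h0
  have h2 := congrArg (MvPolynomial.coeff k) h0
  rw [MvPolynomial.coeff_sum, Finset.sum_eq_single_of_mem k
    (by simp [MvPolynomial.mem_support_iff.1 hk])
    (fun m _ hm => by rw [MvPolynomial.coeff_monomial, if_neg hm]),
    MvPolynomial.coeff_monomial, if_pos rfl, MvPolynomial.coeff_zero] at h2
  exact MvPolynomial.mem_support_iff.1 hk h2

lemma hahnPoly_injective : Function.Injective (hahnPoly F n) := by
  rw [injective_iff_map_eq_zero]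
  intro p hp
  by_contra hne
  obtain ⟨k, hk⟩ := MvPolynomial.support_nonempty.2 hne
  exact coeff_hahnPoly_ne_zero n hk (by rw [hp, HahnSeries.coeff_zero])

variable (F) in
/-- The substitution `x_j ↦ x_j t ^ n_j` on rational functions. -/
def hahn : F →+* HahnSeries ℝ F :=
  IsFractionRing.lift (hahnPoly_injective (F := F) n)

lemma hahn_algebraMap (p : MvPolynomial τ ℂ) :
    hahn F n (algebraMap _ F p) = hahnPoly F n p := by
  simp [hahn]

lemma hahn_var (j : τ) : hahn F n (var F j) = HahnSeries.single (n j) (var F j) := by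
  rw [var, hahn_algebraMap, hahnPoly, MvPolynomial.eval₂Hom_X']
  rfl

lemma hahn_cst (z : ℂ) : hahn F n (cst F z) = HahnSeries.single 0 (cst F z) := by
  rw [← algebraMap_C (τ := τ), hahn_algebraMap, ← MvPolynomial.monomial_zero', hahnPoly_monomial]
  simp [wt]

variable (F) in
/-- The lowest weight of a term of a rational function. -/
def val : AddValuation F (WithTop ℝ) :=
  (HahnSeries.addVal ℝ F).comap (hahn F n)

lemma val_apply (f : F) : val F n f = (hahn F n f).orderTop := rfl

lemma val_algebraMap_le {p : MvPolynomial τ ℂ} {k : τ →₀ ℕ} (hk : k ∈ p.support) :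
    val F n (algebraMap _ F p) ≤ wt n fun j => k j := by
  rw [val_apply, hahn_algebraMap]
  exact HahnSeries.orderTop_le_of_coeff_ne_zero (coeff_hahnPoly_ne_zero n hk)

lemma val_of_hahn_eq_single {f g : F} {r : ℝ} (hg : g ≠ 0)
    (h : hahn F n f = HahnSeries.single r g) : val F n f = r := by
  rw [val_apply, h, HahnSeries.orderTop_single hg]

/-- The action of a change of variables on the coefficients of a series. -/
def coeffMap (θ : F →+* F) : HahnSeries ℝ F →+* HahnSeries ℝ F where
  toFun s := s.map θ
  map_one' := HahnSeries.map_one θ.toMonoidWithZeroHom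
  map_mul' _ _ := HahnSeries.map_mul θ.toNonUnitalRingHom
  map_zero' := HahnSeries.map_zero θ.toMonoidWithZeroHom.toZeroHom
  map_add' _ _ := HahnSeries.map_add θ.toAddMonoidHom

lemma coeffMap_single (θ : F →+* F) (r : ℝ) (f : F) :
    coeffMap θ (HahnSeries.single r f) = HahnSeries.single r (θ f) :=
  HahnSeries.map_single θ.toMonoidWithZeroHom.toZeroHom

/-- How the lowest weight behaves under changes of variables. -/
lemma val_le_val_map {m : τ → ℝ} (θ : F →ₐ[ℂ] F)
    (hθ : ∀ j, hahn F n (θ (var F j)) = HahnSeries.single (m j) (θ (var F j))) (f : F) :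
    val F m f ≤ val F n (θ f) := by
  -- As θ x_j is homogeneous of weight m_j, expanding after θ is the same as applying θ to the
  -- coefficients of the expansion with weights m.
  have h1 : (hahn F n).comp θ.toRingHom = (coeffMap θ.toRingHom).comp (hahn F m) := by
    apply ringHom_ext_var (τ := τ)
    · intro z
      rw [RingHom.comp_apply, RingHom.comp_apply, hahn_cst, coeffMap_single]
      simp only [AlgHom.toRingHom_eq_coe, RingHom.coe_coe, AlgHom.commutes]
      exact hahn_cst n z
    · intro j
      rw [RingHom.comp_apply, RingHom.comp_apply, hahn_var, coeffMap_single]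
      exact hθ j
  have h2 : hahn F n (θ f) = coeffMap θ.toRingHom (hahn F m f) := DFunLike.congr_fun h1 f
  rw [val_apply, val_apply, h2]
  refine HahnSeries.le_orderTop_iff_forall.2 fun g hg => ?_
  change θ ((hahn F m f).coeff g) = 0
  rw [HahnSeries.coeff_eq_zero_of_lt_orderTop hg, map_zero]

end Weight

end Laurent

/-! ### Monomials in y = √q x and the relations between the σ_i and ε_i -/

section Reflections

variable {τ : Type*} {F : Type*} [Field F] [Algebra ℂ F] [Algebra (MvPolynomial τ ℂ) F]
  [IsScalarTower ℂ (MvPolynomial τ ℂ) F] [IsFractionRing (MvPolynomial τ ℂ) F]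

/-- The rescaled variable `y_j = a x_j`. -/
def yvar (F : Type*) [Field F] [Algebra ℂ F] [Algebra (MvPolynomial τ ℂ) F] (a : ℂ) (j : τ) : F :=
  cst F a * var F j

variable {a : ℂ} (ha : a ≠ 0)

lemma cst_ne_zero {z : ℂ} (hz : z ≠ 0) : cst F z ≠ 0 := by
  rwa [Ne, FaithfulSMul.algebraMap_eq_zero_iff]

lemma cst_one : cst F 1 = 1 := map_one _

lemma cst_neg (z : ℂ) : cst F (-z) = -cst F z := map_neg _ _

include ha in
lemma yvar_ne_zero (j : τ) : yvar F a j ≠ 0 := mul_ne_zero (cst_ne_zero ha) (var_ne_zero j)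

include ha in
lemma var_eq (j : τ) : var F j = cst F a⁻¹ * yvar F a j := by
  rw [yvar, ← mul_assoc, ← map_mul, inv_mul_cancel₀ ha, map_one, one_mul]

include ha in
lemma algHom_ext_yvar {f g : F →ₐ[ℂ] F} (h : ∀ j : τ, f (yvar F a j) = g (yvar F a j)) :
    f = g := by
  apply algHom_ext_var (τ := τ)
  intro j
  rw [var_eq ha, map_mul, map_mul, h, AlgHom.commutes, AlgHom.commutes]

variable [Fintype τ]

variable (F a) in
/-- The Laurent monomial `∏ y_j ^ k_j`. -/
def ymon (k : τ → ℤ) : F := ∏ j, yvar F a j ^ k j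

include ha in
lemma ymon_ne_zero (k : τ → ℤ) : ymon F a k ≠ 0 :=
  Finset.prod_ne_zero_iff.2 fun j _ => zpow_ne_zero _ (yvar_ne_zero ha j)

include ha in
lemma ymon_add (k m : τ → ℤ) : ymon F a (k + m) = ymon F a k * ymon F a m := by
  simp only [ymon, ← Finset.prod_mul_distrib]
  exact Finset.prod_congr rfl fun j _ => zpow_add₀ (yvar_ne_zero ha j) _ _

lemma ymon_smul (c : ℤ) (k : τ → ℤ) : ymon F a (c • k) = ymon F a k ^ c := by
  simp only [ymon, Pi.smul_apply, smul_eq_mul, mul_comm c, zpow_mul, Finset.prod_zpow]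

open scoped Classical in
lemma ymon_single (i : τ) : ymon F a (Pi.single i 1) = yvar F a i := by
  rw [ymon, Finset.prod_eq_single i]
  · simp
  · intro j _ hj; simp [hj]
  · simp

section Values

variable (n : τ → ℝ)

lemma hahn_yvar (j : τ) :
    hahn F n (yvar F a j) = HahnSeries.single (n j) (yvar F a j) := by
  rw [yvar, map_mul, hahn_cst, hahn_var, HahnSeries.single_mul_single, zero_add]

lemma hahn_single_zpow (r : ℝ) (f : F) (k : ℤ) :
    HahnSeries.single r f ^ k = HahnSeries.single (r * k) (f ^ k) := by
  cases k with
  | ofNat k => simp [HahnSeries.single_pow, mul_comm]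
  | negSucc k =>
    simp only [zpow_negSucc, HahnSeries.single_pow, HahnSeries.inv_single, nsmul_eq_mul]
    congr 2
    push_cast
    ring

lemma hahn_ymon (k : τ → ℤ) :
    hahn F n (ymon F a k) = HahnSeries.single (wt n k) (ymon F a k) := by
  have h1 : ∀ s : Finset τ, hahn F n (∏ j ∈ s, yvar F a j ^ k j) =
      HahnSeries.single (∑ j ∈ s, n j * k j) (∏ j ∈ s, yvar F a j ^ k j) := by
    classical
    intro s
    induction s using Finset.induction_on with
    | empty => simp
    | insert i s hi ih =>
      rw [Finset.prod_insert hi, Finset.sum_insert hi, map_mul, ih,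
        map_zpow₀, hahn_yvar, hahn_single_zpow, HahnSeries.single_mul_single]
  exact h1 _

lemma val_cst {z : ℂ} (hz : z ≠ 0) : val F n (cst F z) = 0 :=
  val_of_hahn_eq_single n (cst_ne_zero hz) (hahn_cst n z)

lemma val_cst_nonneg (z : ℂ) : 0 ≤ val F n (cst F z) := by
  by_cases hz : z = 0
  · simp [hz]
  · rw [val_cst n hz]

include ha in
lemma val_ymon (k : τ → ℤ) : val F n (ymon F a k) = wt n k :=
  val_of_hahn_eq_single n (ymon_ne_zero ha k) (hahn_ymon n k)

include ha in
-- With weights n = k the monomial has weight ∑ k_j² > 0, so the two terms lie in different degrees.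
lemma cst_sub_ne_zero {z u : ℂ} (hzu : z ≠ 0 ∨ u ≠ 0) {k : τ → ℤ} (hk : k ≠ 0) :
    cst F z - cst F u * ymon F a k ≠ 0 := by
  intro h0
  rw [sub_eq_zero] at h0
  have hw : wt (fun j => (k j : ℝ)) k ≠ 0 := by
    intro h
    apply hk
    funext j
    have := (Finset.sum_eq_zero_iff_of_nonneg
      (fun j _ => mul_self_nonneg (k j : ℝ))).1 h j (Finset.mem_univ j)
    simpa using this
  have h1 := congrArg (fun f => (hahn F (fun j => (k j : ℝ)) f).coeff 0) h0
  simp only [map_mul, hahn_cst, hahn_ymon, HahnSeries.single_mul_single, zero_add,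
    HahnSeries.coeff_single, if_true, if_neg hw.symm] at h1
  have hz : z = 0 := by
    by_contra hz
    exact cst_ne_zero hz h1
  have hu := hzu.resolve_left (not_not.2 hz)
  rw [hz, cst, map_zero] at h0
  exact mul_ne_zero (cst_ne_zero hu) (ymon_ne_zero ha k) h0.symm

include ha in
-- The two terms have weights 0 and `wt n k`. If these coincide, the difference is still homogeneous
-- of weight 0, and it is not zero.
lemma val_cst_sub {z u : ℂ} (hz : z ≠ 0) (hu : u ≠ 0) {k : τ → ℤ} (hk : k ≠ 0) :
    val F n (cst F z - cst F u * ymon F a k) = min 0 (wt n k : WithTop ℝ) := by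
  by_cases hw : wt n k = 0
  · rw [hw]
    have h1 : hahn F n (cst F z - cst F u * ymon F a k) =
        HahnSeries.single 0 (cst F z - cst F u * ymon F a k) := by
      rw [map_sub, map_mul, hahn_cst, hahn_cst, hahn_ymon, HahnSeries.single_mul_single, hw,
        zero_add, ← HahnSeries.single_sub]
    rw [val_of_hahn_eq_single n (cst_sub_ne_zero ha (Or.inl hz) hk) h1]
    simp
  · have h1 : val F n (cst F u * ymon F a k) = wt n k := by
      rw [AddValuation.map_mul, val_cst n hu, val_ymon ha, zero_add]
    have h2 : val F n (cst F z) ≠ val F n (-(cst F u * ymon F a k)) := by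
      rw [AddValuation.map_neg, h1, val_cst n hz]
      exact fun h => hw (by exact_mod_cast h.symm)
    rw [sub_eq_add_neg, AddValuation.map_add_of_distinct_val _ h2, AddValuation.map_neg, h1,
      val_cst n hz]

end Values

variable (F) in
/-- Families of changes of variables `σ_i`, `ε_i` with the values prescribed by a graph. -/
structure IsReflData (G : SimpleGraph τ) (a : ℂ) (σ ε : τ → F →ₐ[ℂ] F) : Prop where
  ne_zero : a ≠ 0
  sigma_self i : σ i (yvar F a i) = (yvar F a i)⁻¹
  sigma_adj {i j} : G.Adj i j → σ i (yvar F a j) = yvar F a i * yvar F a j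
  sigma_other {i j} : i ≠ j → ¬ G.Adj i j → σ i (yvar F a j) = yvar F a j
  eps_adj {i j} : G.Adj i j → ε i (yvar F a j) = -yvar F a j
  eps_other {i j} : ¬ G.Adj i j → ε i (yvar F a j) = yvar F a j

open scoped Classical in
/-- The pairing of an exponent with the `i`-th simple coroot. -/
def pair (G : SimpleGraph τ) (i : τ) (k : τ → ℤ) : ℤ :=
  2 * k i - ∑ j, if G.Adj i j then k j else 0

open scoped Classical in
/-- The action of the `i`-th simple reflection on exponents. -/
def refl (G : SimpleGraph τ) (i : τ) (k : τ → ℤ) : τ → ℤ :=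
  k + (-pair G i k) • Pi.single i 1

namespace IsReflData

variable {G : SimpleGraph τ} {σ ε : τ → F →ₐ[ℂ] F} (H : IsReflData F G a σ ε)
include H

lemma eps_self (i : τ) : ε i (yvar F a i) = yvar F a i := H.eps_other (G.loopless.irrefl i)

lemma y_ne_zero (j : τ) : yvar F a j ≠ 0 := yvar_ne_zero H.ne_zero j

lemma ext {f g : F →ₐ[ℂ] F} (h : ∀ j : τ, f (yvar F a j) = g (yvar F a j)) (p : F) :
    f p = g p := by
  rw [algHom_ext_yvar H.ne_zero h]

lemma sigma_sigma (i : τ) (f : F) : σ i (σ i f) = f := by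
  refine H.ext (f := (σ i).comp (σ i)) (g := AlgHom.id ℂ F) (fun j => ?_) f
  simp only [AlgHom.comp_apply, AlgHom.id_apply]
  have hi := H.y_ne_zero i
  by_cases hij : i = j
  · subst hij
    rw [H.sigma_self, map_inv₀, H.sigma_self, inv_inv]
  by_cases hadj : G.Adj i j
  · rw [H.sigma_adj hadj, map_mul, H.sigma_adj hadj, H.sigma_self]
    field_simp
  · rw [H.sigma_other hij hadj, H.sigma_other hij hadj]

lemma eps_eps (i : τ) (f : F) : ε i (ε i f) = f := by
  refine H.ext (f := (ε i).comp (ε i)) (g := AlgHom.id ℂ F) (fun j => ?_) f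
  simp only [AlgHom.comp_apply, AlgHom.id_apply]
  by_cases hadj : G.Adj i j
  · rw [H.eps_adj hadj, map_neg, H.eps_adj hadj, neg_neg]
  · rw [H.eps_other hadj, H.eps_other hadj]

lemma eps_comm (i j : τ) (f : F) : ε i (ε j f) = ε j (ε i f) := by
  refine H.ext (f := (ε i).comp (ε j)) (g := (ε j).comp (ε i)) (fun k => ?_) f
  simp only [AlgHom.comp_apply]
  by_cases hi : G.Adj i k <;> by_cases hj : G.Adj j k <;>
    simp [H.eps_adj, H.eps_other, hi, hj]

lemma eps_sigma_self (i : τ) (f : F) : ε i (σ i f) = σ i (ε i f) := by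
  refine H.ext (f := (ε i).comp (σ i)) (g := (σ i).comp (ε i)) (fun j => ?_) f
  simp only [AlgHom.comp_apply]
  by_cases hij : i = j
  · subst hij
    rw [H.sigma_self, map_inv₀, H.eps_self, H.sigma_self]
  by_cases hadj : G.Adj i j
  · rw [H.sigma_adj hadj, map_mul, H.eps_adj hadj, map_neg, H.sigma_adj hadj, H.eps_self,
      mul_neg]
  · rw [H.sigma_other hij hadj, H.eps_other hadj, H.sigma_other hij hadj]

/-- Here ε_j also flips y_i, so each y_i y_k with k adjacent to i picks up an extra sign, which is
the effect of ε_i. -/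
lemma eps_sigma_adj {i j : τ} (h : G.Adj i j) (f : F) : ε j (σ i f) = σ i (ε i (ε j f)) := by
  refine H.ext (f := (ε j).comp (σ i)) (g := (σ i).comp ((ε i).comp (ε j))) (fun k => ?_) f
  simp only [AlgHom.comp_apply]
  by_cases hik : i = k
  · subst hik
    rw [H.sigma_self, map_inv₀, H.eps_adj h.symm, map_neg, map_neg, H.eps_self, H.sigma_self,
      inv_neg]
  by_cases hi : G.Adj i k <;> by_cases hj : G.Adj j k <;>
    simp [H.eps_adj, H.eps_other, H.sigma_adj, H.sigma_other, hik, hi, hj, h.symm]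

lemma eps_sigma_not_adj {i j : τ} (h : ¬ G.Adj i j) (f : F) : ε j (σ i f) = σ i (ε j f) := by
  refine H.ext (f := (ε j).comp (σ i)) (g := (σ i).comp (ε j)) (fun k => ?_) f
  simp only [AlgHom.comp_apply]
  have h' : ¬ G.Adj j i := fun h' => h h'.symm
  by_cases hik : i = k
  · subst hik
    rw [H.sigma_self, map_inv₀, H.eps_other h', H.sigma_self]
  by_cases hi : G.Adj i k <;> by_cases hj : G.Adj j k <;>
    simp [H.eps_adj, H.eps_other, H.sigma_adj, H.sigma_other, hik, hi, hj, h']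

lemma sigma_comm {i j : τ} (hij : i ≠ j) (h : ¬ G.Adj i j) (f : F) :
    σ i (σ j f) = σ j (σ i f) := by
  refine H.ext (f := (σ i).comp (σ j)) (g := (σ j).comp (σ i)) (fun k => ?_) f
  simp only [AlgHom.comp_apply]
  have h' : ¬ G.Adj j i := fun h' => h h'.symm
  by_cases hik : i = k
  · subst hik
    rw [H.sigma_other hij.symm h', H.sigma_self, map_inv₀, H.sigma_other hij.symm h']
  by_cases hjk : j = k
  · subst hjk
    rw [H.sigma_self, map_inv₀, H.sigma_other hij h, H.sigma_self]
  by_cases hi : G.Adj i k <;> by_cases hj : G.Adj j k <;>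
    simp [H.sigma_adj, H.sigma_other, hik, hjk, hi, hj, h, h', hij, hij.symm, mul_left_comm]

lemma sigma_braid {i j : τ} (h : G.Adj i j) (f : F) :
    σ i (σ j (σ i f)) = σ j (σ i (σ j f)) := by
  refine H.ext (f := (σ i).comp ((σ j).comp (σ i))) (g := (σ j).comp ((σ i).comp (σ j)))
    (fun k => ?_) f
  simp only [AlgHom.comp_apply]
  have hi0 := H.y_ne_zero i
  have hj0 := H.y_ne_zero j
  by_cases hik : i = k
  · subst hik
    simp only [H.sigma_self, map_inv₀, H.sigma_adj h.symm, map_mul, H.sigma_adj h]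
    field_simp
  by_cases hjk : j = k
  · subst hjk
    simp only [H.sigma_self, map_inv₀, H.sigma_adj h.symm, map_mul, H.sigma_adj h]
    field_simp
  by_cases hi : G.Adj i k <;> by_cases hj : G.Adj j k <;>
    simp [H.sigma_adj, H.sigma_other, H.sigma_self, hik, hjk, hi, hj, h, h.symm] <;>
    field_simp

lemma sigma_ymon (i : τ) (k : τ → ℤ) : σ i (ymon F a k) = ymon F a (refl G i k) := by
  classical
  have hi := H.y_ne_zero i
  rw [refl, ymon_add H.ne_zero, ymon_smul, ymon_single]
  have h1 : ∀ j, σ i (yvar F a j) ^ k j = yvar F a j ^ k j *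
      yvar F a i ^ ((if G.Adj i j then k j else 0) - if j = i then 2 * k j else 0) := by
    intro j
    by_cases hij : i = j
    · subst hij
      simp only [SimpleGraph.irrefl, if_false, if_true]
      rw [H.sigma_self, ← zpow_add₀ hi, inv_zpow', zero_sub]
      congr 1; omega
    by_cases hadj : G.Adj i j
    · rw [H.sigma_adj hadj, mul_zpow, if_pos hadj, if_neg (Ne.symm hij), sub_zero, mul_comm]
    · rw [H.sigma_other hij hadj, if_neg hadj, if_neg (Ne.symm hij), sub_zero, zpow_zero, mul_one]
  have h2 : ∀ (s : Finset τ) (e : τ → ℤ),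
      ∏ j ∈ s, yvar F a i ^ e j = yvar F a i ^ ∑ j ∈ s, e j := by
    intro s e
    induction s using Finset.induction_on with
    | empty => simp
    | insert m s hm ih => rw [Finset.prod_insert hm, Finset.sum_insert hm, zpow_add₀ hi, ih]
  rw [ymon, map_prod]
  simp only [map_zpow₀, h1, Finset.prod_mul_distrib, h2]
  rw [Finset.sum_sub_distrib, Finset.sum_ite_eq' Finset.univ i, if_pos (Finset.mem_univ i), pair,
    neg_sub]

/-- Even exponents absorb the signs; for this reason Δ and D, products in the y^{2α}, are blind to
all ε_i. -/
lemma eps_ymon_two (i : τ) (k : τ → ℤ) :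
    ε i (ymon F a ((2 : ℤ) • k)) = ymon F a ((2 : ℤ) • k) := by
  rw [ymon_smul, ymon, map_zpow₀, map_prod]
  simp only [← Finset.prod_zpow, map_zpow₀, ← zpow_mul]
  refine Finset.prod_congr rfl fun j _ => ?_
  by_cases hadj : G.Adj i j
  · rw [H.eps_adj hadj, Even.neg_zpow (by simp)]
  · rw [H.eps_other hadj]

end IsReflData

end Reflections

/-! ### Rational function identities behind the quadratic and braid relations -/

section TwistedAction

variable {F : Type*} [Field F]

/-- The coefficient of `f(σ_i x)` in the twisted action, for `l_i = 0`. -/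
def coefP (a y : F) : F := -((1 - a) * (1 + y)) / (2 * y * (a - y))

/-- The coefficient of `f(ε_i σ_i x)` in the twisted action, for `l_i = 0`. -/
def coefQ (a y : F) : F := -((1 + a) * (1 - y)) / (2 * y * (a - y))

section Identities

variable {a u v : F} (hu : u ≠ 0) (hv : v ≠ 0) (h1 : a - u ≠ 0) (h1' : a + u ≠ 0)
  (h2 : a - v ≠ 0) (h2' : a + v ≠ 0) (h3 : a - u * v ≠ 0) (h3' : a + u * v ≠ 0)
  (hc : (2 : F) ≠ 0)

include hu h1 hc in
-- With u = y_i and u⁻¹ = σ_i y_i, this is the coefficient of f in f|σ_i|σ_i, up to the powers of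
-- y_i; `inverse_identity_eps` is that of f(ε_i x).
lemma inverse_identity_one (h4 : 1 - a * u ≠ 0) :
    coefP a u * coefP a u⁻¹ + coefQ a u * coefQ a u⁻¹ = 1 := by
  have h5 : a - u⁻¹ = -((1 - a * u) / u) := by
    field_simp
    ring
  simp only [coefP, coefQ, h5]
  field_simp
  ring

include hu h1 hc in
lemma inverse_identity_eps (h4 : 1 - a * u ≠ 0) :
    coefP a u * coefQ a u⁻¹ + coefQ a u * coefP a u⁻¹ = 0 := by
  have h5 : a - u⁻¹ = -((1 - a * u) / u) := by
    field_simp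
    ring
  simp only [coefP, coefQ, h5]
  field_simp
  ring

/-- In this and the next two identities u = y_i, v = y_j and uv is the image of either under the
other reflection. They compare the coefficients of f, of one sign change of f, and of both. -/
lemma braid_identity_one :
    coefP a u * coefP a (u * v) * coefP a v + coefQ a u * coefQ a (-(u * v)) * coefQ a v =
      coefP a v * coefP a (u * v) * coefP a u + coefQ a v * coefQ a (-(u * v)) * coefQ a u := by
  ring

include hu hv h1 h1' h2 h2' h3 h3' hc in
lemma braid_identity_eps :
    coefP a u * coefP a (u * v) * coefQ a v + coefQ a u * coefQ a (-(u * v)) * coefP a v =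
      coefQ a v * coefP a (-(u * v)) * coefP a (-u) +
        coefP a v * coefQ a (u * v) * coefQ a (-u) := by
  simp only [coefP, coefQ, sub_neg_eq_add]
  field_simp
  ring

include hu hv h1 h1' h2 h2' h3 h3' hc in
lemma braid_identity_eps_eps :
    coefQ a u * coefP a (-(u * v)) * coefQ a (-v) + coefP a u * coefQ a (u * v) * coefP a (-v) =
      coefQ a v * coefP a (-(u * v)) * coefQ a (-u) +
        coefP a v * coefQ a (u * v) * coefP a (-u) := by
  simp only [coefP, coefQ, sub_neg_eq_add]
  field_simp
  ring

end Identities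

end TwistedAction

/-! ### The relations for the twisted action -/

section Operators

variable {τ : Type*} {F : Type*} [Field F] [Algebra ℂ F] [Algebra (MvPolynomial τ ℂ) F]
  [IsScalarTower ℂ (MvPolynomial τ ℂ) F] [IsFractionRing (MvPolynomial τ ℂ) F]

lemma map_coefP (θ : F →ₐ[ℂ] F) (a : ℂ) (y : F) :
    θ (coefP (cst F a) y) = coefP (cst F a) (θ y) := by
  simp [coefP, map_ofNat]

lemma map_coefQ (θ : F →ₐ[ℂ] F) (a : ℂ) (y : F) :
    θ (coefQ (cst F a) y) = coefQ (cst F a) (θ y) := by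
  simp [coefQ, map_ofNat]

/-- The twisted action of a simple reflection. -/
def twist (a : ℂ) (σ ε : τ → F →ₐ[ℂ] F) (l : τ → ℕ) (i : τ) (f : F) : F :=
  yvar F a i ^ l i * (coefP (cst F a) (yvar F a i) * σ i f +
    (-1) ^ l i * coefQ (cst F a) (yvar F a i) * σ i (ε i f))

variable {a : ℂ} [Fintype τ] {G : SimpleGraph τ} {σ ε : τ → F →ₐ[ℂ] F}
  (H : IsReflData F G a σ ε)

section Nonvanishing

variable (ha : a ≠ 0)
include ha

lemma a_sub_ne_zero (i : τ) : cst F a - yvar F a i ≠ 0 := by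
  classical
  have := cst_sub_ne_zero (F := F) ha (z := a) (u := 1) (Or.inl ha)
    (k := Pi.single i 1) (by simp)
  rwa [ymon_single, cst_one, one_mul] at this

lemma a_add_ne_zero (i : τ) : cst F a + yvar F a i ≠ 0 := by
  classical
  have := cst_sub_ne_zero (F := F) ha (z := a) (u := -1) (Or.inl ha)
    (k := Pi.single i 1) (by simp)
  rwa [ymon_single, cst_neg, cst_one, neg_one_mul, sub_neg_eq_add] at this

lemma one_sub_ne_zero (i : τ) : 1 - cst F a * yvar F a i ≠ 0 := by
  classical
  have := cst_sub_ne_zero (F := F) ha (z := 1) (u := a) (Or.inr ha)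
    (k := Pi.single i 1) (by simp)
  rwa [ymon_single, cst_one] at this

lemma single_add_single_ne_zero [DecidableEq τ] (i j : τ) :
    (Pi.single i 1 + Pi.single j 1 : τ → ℤ) ≠ 0 := by
  intro h
  have h1 := congrFun h i
  simp only [Pi.add_apply, Pi.single_eq_same, Pi.zero_apply, Pi.single_apply] at h1
  split_ifs at h1 <;> omega

lemma a_sub_mul_ne_zero (i j : τ) : cst F a - yvar F a i * yvar F a j ≠ 0 := by
  classical
  have := cst_sub_ne_zero (F := F) ha (z := a) (u := 1) (Or.inl ha)
    (k := Pi.single i 1 + Pi.single j 1) (single_add_single_ne_zero ha i j)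
  rwa [ymon_add ha, ymon_single, ymon_single, cst_one, one_mul] at this

lemma a_add_mul_ne_zero (i j : τ) : cst F a + yvar F a i * yvar F a j ≠ 0 := by
  classical
  have := cst_sub_ne_zero (F := F) ha (z := a) (u := -1) (Or.inl ha)
    (k := Pi.single i 1 + Pi.single j 1) (single_add_single_ne_zero ha i j)
  rwa [ymon_add ha, ymon_single, ymon_single, cst_neg, cst_one, neg_one_mul,
    sub_neg_eq_add] at this

end Nonvanishing

include H in
lemma twist_twist (l : τ → ℕ) (i : τ) (f : F) : twist a σ ε l i (twist a σ ε l i f) = f := by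
  have hy := H.y_ne_zero i
  have h2 : (2 : F) ≠ 0 := by
    have := cst_ne_zero (F := F) (z := 2) two_ne_zero
    rwa [cst, map_ofNat] at this
  have e1 := inverse_identity_one hy (a_sub_ne_zero H.ne_zero i) h2 (one_sub_ne_zero H.ne_zero i)
  have e2 := inverse_identity_eps hy (a_sub_ne_zero H.ne_zero i) h2 (one_sub_ne_zero H.ne_zero i)
  have hpow : yvar F a i ^ l i * (yvar F a i)⁻¹ ^ l i = 1 := by
    rw [← mul_pow, mul_inv_cancel₀ hy, one_pow]
  simp only [twist, map_mul, map_add, map_pow, map_neg, map_one, map_coefP, map_coefQ,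
    H.eps_sigma_self, H.eps_eps, H.eps_self, H.sigma_sigma, H.sigma_self]
  generalize (yvar F a i)⁻¹ ^ l i = B at *
  generalize yvar F a i ^ l i = A at *
  rcases neg_one_pow_eq_or F (l i) with hs | hs <;> rw [hs]
  · linear_combination A * B * (f * e1 + ε i f * e2) + f * hpow
  · linear_combination A * B * (f * e1 - ε i f * e2) + f * hpow

include H in
lemma twist_comm (l : τ → ℕ) {i j : τ} (hij : i ≠ j) (h : ¬ G.Adj i j) (f : F) :
    twist a σ ε l i (twist a σ ε l j f) = twist a σ ε l j (twist a σ ε l i f) := by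
  have h' : ¬ G.Adj j i := fun h' => h h'.symm
  simp only [twist, map_mul, map_add, map_pow, map_neg, map_one, map_coefP, map_coefQ,
    H.eps_sigma_not_adj h, H.eps_sigma_not_adj h', H.eps_other h, H.eps_other h',
    H.sigma_other hij h, H.sigma_other hij.symm h', H.sigma_comm hij h, H.eps_comm i j]
  ring

include H in
-- By the commutation rules both sides are combinations of σ_j σ_i σ_j applied to f, ε_i f, ε_j f
-- and ε_i ε_j f. Up to sign the powers of y_i and y_j contribute the same factor on both sides,
-- which leaves one identity for each of the four terms.
lemma twist_braid (l : τ → ℕ) {i j : τ} (h : G.Adj i j) (f : F) :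
    twist a σ ε l i (twist a σ ε l j (twist a σ ε l i f)) =
      twist a σ ε l j (twist a σ ε l i (twist a σ ε l j f)) := by
  have hi := H.y_ne_zero i
  have hj := H.y_ne_zero j
  have h2 : (2 : F) ≠ 0 := by
    have := cst_ne_zero (F := F) (z := 2) two_ne_zero
    rwa [cst, map_ofNat] at this
  have ha := H.ne_zero
  have c1 : (yvar F a i)⁻¹ * (yvar F a i * yvar F a j) = yvar F a j := by field_simp
  have c2 : yvar F a i * yvar F a j * (yvar F a j)⁻¹ = yvar F a i := by field_simp
  have c3 : yvar F a j * yvar F a i = yvar F a i * yvar F a j := mul_comm _ _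
  -- These are the coefficients of f, ε_i f, ε_j f and ε_i ε_j f; the third is the second with i and
  -- j exchanged.
  have e0 := braid_identity_one (a := cst F a) (u := yvar F a i) (v := yvar F a j)
  have e1 := braid_identity_eps hi hj (a_sub_ne_zero ha i) (a_add_ne_zero ha i)
    (a_sub_ne_zero ha j) (a_add_ne_zero ha j) (a_sub_mul_ne_zero ha i j)
    (a_add_mul_ne_zero ha i j) h2
  have e2 := braid_identity_eps hj hi (a_sub_ne_zero ha j) (a_add_ne_zero ha j)
    (a_sub_ne_zero ha i) (a_add_ne_zero ha i) (a_sub_mul_ne_zero ha j i)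
    (a_add_mul_ne_zero ha j i) h2
  have e3 := braid_identity_eps_eps hi hj (a_sub_ne_zero ha i) (a_add_ne_zero ha i)
    (a_sub_ne_zero ha j) (a_add_ne_zero ha j) (a_sub_mul_ne_zero ha i j)
    (a_add_mul_ne_zero ha i j) h2
  rw [c3] at e2
  simp only [twist, map_mul, map_add, map_pow, map_neg, map_one, map_coefP, map_coefQ,
    H.eps_sigma_self, H.eps_eps, H.eps_self, H.eps_sigma_adj h, H.eps_sigma_adj h.symm,
    H.sigma_self, H.sigma_adj h, H.sigma_adj h.symm, H.eps_adj h, H.eps_adj h.symm,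
    H.eps_comm j i, H.sigma_braid h, neg_neg, neg_mul, mul_neg, c1, c2, c3]
  simp only [neg_pow (yvar F a i * yvar F a j), neg_pow (yvar F a i) (l j),
    neg_pow (yvar F a j) (l i), mul_pow]
  generalize yvar F a i ^ l i = A
  generalize yvar F a i ^ l j = B
  generalize yvar F a j ^ l i = C
  generalize yvar F a j ^ l j = D
  generalize σ j (σ i (σ j f)) = f0 at *
  generalize σ j (σ i (σ j (ε i f))) = f1 at *
  generalize σ j (σ i (σ j (ε j f))) = f2 at *
  generalize σ j (σ i (σ j (ε i (ε j f)))) = f3 at *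
  -- Only the parities of l_i and l_j remain, and they decide the signs with which the four
  -- identities enter.
  rcases neg_one_pow_eq_or F (l i) with hs | hs <;>
    rcases neg_one_pow_eq_or F (l j) with ht | ht <;> rw [hs, ht]
  · linear_combination A * B * C * D * (f0 * e0 + f1 * e1 - f2 * e2 + f3 * e3)
  · linear_combination A * B * C * D * (f0 * e0 + f1 * e1 + f2 * e2 - f3 * e3)
  · linear_combination A * B * C * D * (f0 * e0 - f1 * e1 - f2 * e2 - f3 * e3)
  · linear_combination A * B * C * D * (f0 * e0 - f1 * e1 + f2 * e2 + f3 * e3)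

end Operators

/-! ### Regularity and vanishing along a divisor x_i = c -/

section Regular

variable {τ : Type*} {F : Type*} [Field F] [Algebra ℂ F] [Algebra (MvPolynomial τ ℂ) F]
  [IsScalarTower ℂ (MvPolynomial τ ℂ) F] [IsFractionRing (MvPolynomial τ ℂ) F]

open scoped Classical in
/-- The evaluation of polynomials at `x_i = c`. -/
def evalAt (i : τ) (c : ℂ) : MvPolynomial τ ℂ →ₐ[ℂ] MvPolynomial τ ℂ :=
  MvPolynomial.aeval fun j => if j = i then MvPolynomial.C c else MvPolynomial.X j

lemma evalAt_X_self (i : τ) (c : ℂ) : evalAt i c (MvPolynomial.X i) = MvPolynomial.C c := by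
  simp [evalAt]

lemma evalAt_X_of_ne {i j : τ} (h : j ≠ i) (c : ℂ) :
    evalAt i c (MvPolynomial.X j) = MvPolynomial.X j := by
  simp [evalAt, h]

lemma evalAt_C (i : τ) (c z : ℂ) : evalAt i c (MvPolynomial.C z) = MvPolynomial.C z := by
  simp [evalAt]

/-- Modulo X_i - c, evaluation at x_i = c is the identity. -/
lemma dvd_of_evalAt_eq_zero {i : τ} {c : ℂ} {p : MvPolynomial τ ℂ} (h : evalAt i c p = 0) :
    MvPolynomial.X i - MvPolynomial.C c ∣ p := by
  let I := Ideal.span {(MvPolynomial.X i - MvPolynomial.C c : MvPolynomial τ ℂ)}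
  have h1 : (Ideal.Quotient.mkₐ ℂ I).comp (evalAt i c) = Ideal.Quotient.mkₐ ℂ I := by
    apply MvPolynomial.algHom_ext
    intro j
    rw [AlgHom.comp_apply]
    by_cases hj : j = i
    · subst hj
      rw [evalAt_X_self]
      refine (Ideal.Quotient.eq.2 ?_).symm
      exact Ideal.subset_span rfl
    · rw [evalAt_X_of_ne hj]
  have h2 := DFunLike.congr_fun h1 p
  rw [AlgHom.comp_apply, h, map_zero] at h2
  exact Ideal.mem_span_singleton.1 (Ideal.Quotient.eq_zero_iff_mem.1 h2.symm)

/-- `g` has no pole along the divisor `x_i = c`. -/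
def Reg (i : τ) (c : ℂ) (g : F) : Prop :=
  ∃ p s : MvPolynomial τ ℂ, evalAt i c s ≠ 0 ∧ g * algebraMap _ F s = algebraMap _ F p

/-- `g` vanishes along the divisor `x_i = c`. -/
def Van (i : τ) (c : ℂ) (g : F) : Prop :=
  ∃ p s : MvPolynomial τ ℂ, evalAt i c s ≠ 0 ∧ evalAt i c p = 0 ∧
    g * algebraMap _ F s = algebraMap _ F p

variable {i : τ} {c : ℂ} {f g : F}

lemma Van.reg (h : Van i c g) : Reg i c g := by
  obtain ⟨p, s, hs, -, h⟩ := h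
  exact ⟨p, s, hs, h⟩

/-- Vanishing does not depend on the chosen fraction: cross-multiply and evaluate in a domain. -/
lemma van_iff {p s : MvPolynomial τ ℂ} (hs : evalAt i c s ≠ 0)
    (h : g * algebraMap _ F s = algebraMap _ F p) : Van i c g ↔ evalAt i c p = 0 := by
  refine ⟨?_, fun hp => ⟨p, s, hs, hp, h⟩⟩
  rintro ⟨p', s', hs', hp', h'⟩
  have h1 : p * s' = p' * s := by
    apply IsFractionRing.injective (MvPolynomial τ ℂ) F
    rw [map_mul, map_mul, ← h, ← h']
    ring
  have h2 := congrArg (evalAt i c) h1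
  rw [map_mul, map_mul, hp', zero_mul] at h2
  exact (mul_eq_zero.1 h2).resolve_right hs'

lemma reg_algebraMap (p : MvPolynomial τ ℂ) : Reg i c (algebraMap _ F p) :=
  ⟨p, 1, by simp, by simp⟩

lemma van_algebraMap {p : MvPolynomial τ ℂ} (hp : evalAt i c p = 0) :
    Van i c (algebraMap _ F p) :=
  ⟨p, 1, by simp, hp, by simp⟩

lemma reg_cst (z : ℂ) : Reg i c (cst F z) := by
  rw [← algebraMap_C (τ := τ)]
  exact reg_algebraMap _

lemma reg_one : Reg i c (1 : F) := by
  rw [← cst_one]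
  exact reg_cst _

lemma Reg.add (hf : Reg i c f) (hg : Reg i c g) : Reg i c (f + g) := by
  obtain ⟨p, s, hs, h⟩ := hf
  obtain ⟨p', s', hs', h'⟩ := hg
  refine ⟨p * s' + p' * s, s * s', by rw [map_mul]; exact mul_ne_zero hs hs', ?_⟩
  rw [map_add, map_mul, map_mul, map_mul, ← h, ← h']
  ring

lemma Reg.mul (hf : Reg i c f) (hg : Reg i c g) : Reg i c (f * g) := by
  obtain ⟨p, s, hs, h⟩ := hf
  obtain ⟨p', s', hs', h'⟩ := hg
  refine ⟨p * p', s * s', by rw [map_mul]; exact mul_ne_zero hs hs', ?_⟩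
  rw [map_mul, map_mul, ← h, ← h']
  ring

lemma Van.add (hf : Van i c f) (hg : Van i c g) : Van i c (f + g) := by
  obtain ⟨p, s, hs, hp, h⟩ := hf
  obtain ⟨p', s', hs', hp', h'⟩ := hg
  refine ⟨p * s' + p' * s, s * s', by rw [map_mul]; exact mul_ne_zero hs hs', ?_, ?_⟩
  · rw [map_add, map_mul, map_mul, hp, hp']; ring
  rw [map_add, map_mul, map_mul, map_mul, ← h, ← h']
  ring

lemma Van.mul (hf : Van i c f) (hg : Reg i c g) : Van i c (f * g) := by
  obtain ⟨p, s, hs, hp, h⟩ := hf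
  obtain ⟨p', s', hs', h'⟩ := hg
  refine ⟨p * p', s * s', by rw [map_mul]; exact mul_ne_zero hs hs', ?_, ?_⟩
  · rw [map_mul, hp, zero_mul]
  rw [map_mul, map_mul, ← h, ← h']
  ring

lemma Reg.neg (hf : Reg i c f) : Reg i c (-f) := by
  have := (reg_cst (F := F) (i := i) (c := c) (-1)).mul hf
  rwa [cst_neg, cst_one, neg_one_mul] at this

lemma Van.neg (hf : Van i c f) : Van i c (-f) := by
  have := hf.mul (reg_cst (F := F) (i := i) (c := c) (-1))
  rwa [cst_neg, cst_one, mul_neg_one] at this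

lemma Van.sub (hf : Van i c f) (hg : Van i c g) : Van i c (f - g) := by
  rw [sub_eq_add_neg]; exact hf.add hg.neg

lemma Reg.inv (hg : Reg i c g) (hv : ¬ Van i c g) : Reg i c g⁻¹ := by
  obtain ⟨p, s, hs, h⟩ := hg
  rw [van_iff hs h] at hv
  refine ⟨s, p, hv, ?_⟩
  have hg0 : g ≠ 0 := by
    rintro rfl
    rw [zero_mul, eq_comm, FaithfulSMul.algebraMap_eq_zero_iff] at h
    rw [h, map_zero] at hv
    exact hv rfl
  rw [← h]
  field_simp

lemma not_van_mul (hf : Reg i c f) (hg : Reg i c g) (hf' : ¬ Van i c f) (hg' : ¬ Van i c g) :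
    ¬ Van i c (f * g) := by
  obtain ⟨p, s, hs, h⟩ := hf
  obtain ⟨p', s', hs', h'⟩ := hg
  have h1 : f * g * algebraMap _ F (s * s') = algebraMap _ F (p * p') := by
    rw [map_mul, map_mul, ← h, ← h']
    ring
  rw [van_iff (by rw [map_mul]; exact mul_ne_zero hs hs') h1, map_mul]
  rw [van_iff hs h] at hf'
  rw [van_iff hs' h'] at hg'
  exact mul_ne_zero hf' hg'

lemma not_van_cst {z : ℂ} (hz : z ≠ 0) : ¬ Van i c (cst F z) := by
  have h : cst F z * algebraMap (MvPolynomial τ ℂ) F 1 =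
      algebraMap (MvPolynomial τ ℂ) F (MvPolynomial.C z) := by
    rw [map_one, mul_one, algebraMap_C]
  rw [van_iff (by simp) h, evalAt_C]
  simpa using hz

lemma van_var_sub : Van i c (var F i - cst F c) := by
  have := van_algebraMap (F := F) (i := i) (c := c)
    (p := MvPolynomial.X i - MvPolynomial.C c) (by rw [map_sub, evalAt_X_self, evalAt_C, sub_self])
  rwa [map_sub, algebraMap_C] at this

lemma reg_var (j : τ) : Reg i c (var F j) := reg_algebraMap _

lemma var_sub_ne_zero : var F i - cst F c ≠ 0 := by
  intro h
  have h1 : algebraMap _ F (MvPolynomial.X i - MvPolynomial.C c) = 0 := by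
    rw [map_sub, algebraMap_C]; exact h
  rw [FaithfulSMul.algebraMap_eq_zero_iff, sub_eq_zero] at h1
  have h2 := congrArg (evalAt i (c + 1)) h1
  rw [evalAt_X_self, evalAt_C] at h2
  have := MvPolynomial.C_injective _ _ h2
  simp at this

lemma Van.reg_div (h : Van i c g) : Reg i c (g / (var F i - cst F c)) := by
  obtain ⟨p, s, hs, hp, h⟩ := h
  obtain ⟨p', rfl⟩ := dvd_of_evalAt_eq_zero hp
  refine ⟨p', s, hs, ?_⟩
  rw [map_mul, map_sub, algebraMap_C] at h
  have h0 : var F i - cst F c ≠ 0 := var_sub_ne_zero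
  rw [div_mul_eq_mul_div, h]
  exact mul_div_cancel_left₀ _ h0

/-- The hypothesis says that θ fixes the divisor pointwise. This passes from variables to
polynomials by the product rule for differences, and to fractions since the denominator stays
nonzero on the divisor under θ. -/
lemma van_map_sub (θ : F →ₐ[ℂ] F) (hθ : ∀ j : τ, Van i c (θ (var F j) - var F j)) (hg : Reg i c g) :
    Van i c (θ g - g) := by
  have hpoly : ∀ p : MvPolynomial τ ℂ,
      Van i c (θ (algebraMap _ F p) - algebraMap _ F p) := by
    intro p
    induction p using MvPolynomial.induction_on with
    | C z =>
      rw [algebraMap_C, AlgHom.commutes, sub_self, ← map_zero (algebraMap (MvPolynomial τ ℂ) F)]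
      exact van_algebraMap (map_zero _)
    | add p r hp hr =>
      have := hp.add hr
      rw [map_add (algebraMap (MvPolynomial τ ℂ) F), map_add]
      convert! this using 1
      ring
    | mul_X p j hp =>
      have h1 : Reg i c (θ (var F j)) := by
        have := (hθ j).reg.add (reg_var j)
        rwa [sub_add_cancel] at this
      have := (hp.mul h1).add ((hθ j).mul (reg_algebraMap p))
      rw [map_mul (algebraMap (MvPolynomial τ ℂ) F), map_mul]
      convert! this using 1
      change θ (algebraMap _ F p) * θ (var F j) - algebraMap _ F p * var F j = _
      ring
  obtain ⟨p, s, hs, h⟩ := hg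
  have hsv : ¬ Van i c (algebraMap _ F s) := by
    rwa [van_iff (p := s) (s := 1) (by simp) (by simp)]
  have hθs : ¬ Van i c (θ (algebraMap _ F s)) := by
    intro h1
    apply hsv
    have := h1.sub (hpoly s)
    rwa [sub_sub_cancel] at this
  have hθr : Reg i c (θ (algebraMap _ F s)) := by
    have := (hpoly s).reg.add (reg_algebraMap s)
    rwa [sub_add_cancel] at this
  have hs0 : algebraMap _ F s ≠ 0 := by
    intro h0
    exact hsv (h0 ▸ (by
      rw [← map_zero (algebraMap (MvPolynomial τ ℂ) F)]
      exact van_algebraMap (map_zero _)))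
  have hθ0 : θ (algebraMap _ F s) ≠ 0 := fun h0 => hs0 (by
    rwa [map_eq_zero_iff θ θ.toRingHom.injective] at h0)
  have hθp : θ (algebraMap _ F p) = θ g * θ (algebraMap _ F s) := by rw [← h, map_mul]
  have key := (((hpoly p).mul (reg_algebraMap s)).sub ((hpoly s).mul (reg_algebraMap p))).mul
    ((hθr.inv hθs).mul ((reg_algebraMap s).inv hsv))
  convert! key using 1
  rw [hθp, ← h]
  field_simp
  ring

end Regular

/-! ### Laurent polynomials and their divisibility by x_i - c -/

section LaurentRing

variable {τ : Type*} {F : Type*} [Field F] [Algebra ℂ F] [Algebra (MvPolynomial τ ℂ) F]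
  [IsScalarTower ℂ (MvPolynomial τ ℂ) F] [IsFractionRing (MvPolynomial τ ℂ) F] [Fintype τ]
  {a : ℂ} (ha : a ≠ 0) {i : τ} {c : ℂ} {f g : F}

/-- A monomial that clears the denominator of `∏ y_j ^ k_j`. -/
def monDen (k : τ → ℤ) : MvPolynomial τ ℂ := ∏ j, MvPolynomial.X j ^ (-k j).toNat

/-- The numerator of `∏ y_j ^ k_j`. -/
def monNum (a : ℂ) (k : τ → ℤ) : MvPolynomial τ ℂ :=
  ∏ j, (MvPolynomial.C (a ^ k j) * MvPolynomial.X j ^ (k j).toNat)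

lemma ymon_mul_monDen (k : τ → ℤ) :
    ymon F a k * algebraMap _ F (monDen k) = algebraMap _ F (monNum a k) := by
  rw [ymon, monDen, monNum, map_prod, map_prod, ← Finset.prod_mul_distrib]
  refine Finset.prod_congr rfl fun j _ => ?_
  have hx : var F j ≠ 0 := var_ne_zero j
  rw [map_pow, map_mul, map_pow, algebraMap_C, yvar, mul_zpow, mul_assoc, cst, cst, map_zpow₀]
  congr 1
  change var F j ^ k j * var F j ^ (-k j).toNat = var F j ^ (k j).toNat
  rw [← zpow_natCast, ← zpow_natCast, ← zpow_add₀ hx]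
  congr 1
  omega

lemma evalAt_monDen_ne_zero (hc : c ≠ 0) (k : τ → ℤ) : evalAt i c (monDen k) ≠ 0 := by
  rw [monDen, map_prod, Finset.prod_ne_zero_iff]
  intro j _
  rw [map_pow]
  apply pow_ne_zero
  by_cases hj : j = i
  · subst hj
    rw [evalAt_X_self]
    simpa using hc
  · rw [evalAt_X_of_ne hj]
    exact MvPolynomial.X_ne_zero j

lemma evalAt_monDen {k : τ → ℤ} (hk : k i = 0) : evalAt i c (monDen k) = monDen k := by
  rw [monDen, map_prod]
  refine Finset.prod_congr rfl fun j _ => ?_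
  by_cases hj : j = i
  · subst hj; simp [hk]
  · rw [map_pow, evalAt_X_of_ne hj]

lemma evalAt_monNum {k : τ → ℤ} (hk : k i = 0) : evalAt i c (monNum a k) = monNum a k := by
  rw [monNum, map_prod]
  refine Finset.prod_congr rfl fun j _ => ?_
  by_cases hj : j = i
  · subst hj; simp [hk]
  · rw [map_mul, map_pow, evalAt_X_of_ne hj, evalAt_C]

lemma reg_ymon (hc : c ≠ 0) (k : τ → ℤ) : Reg i c (ymon F a k) :=
  ⟨monNum a k, monDen k, evalAt_monDen_ne_zero hc k, ymon_mul_monDen k⟩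

lemma reg_yvar (j : τ) : Reg i c (yvar F a j) := (reg_cst a).mul (reg_var j)

include ha in
lemma reg_yvar_inv (hc : c ≠ 0) (j : τ) : Reg i c (yvar F a j)⁻¹ := by
  classical
  have := reg_ymon (F := F) (i := i) (a := a) hc ((-1 : ℤ) • Pi.single j 1)
  rwa [ymon_smul, ymon_single, zpow_neg_one] at this

lemma van_yvar_sub : Van i c (yvar F a i - cst F (a * c)) := by
  have := (van_var_sub (F := F) (i := i) (c := c)).mul (reg_cst a)
  rwa [sub_mul, mul_comm, ← map_mul (algebraMap ℂ F), mul_comm c] at this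

lemma van_yvar_pow_sub (n : ℕ) : Van i c (yvar F a i ^ n - cst F ((a * c) ^ n)) := by
  induction n with
  | zero =>
    rw [pow_zero, pow_zero, cst_one, sub_self, ← map_zero (algebraMap (MvPolynomial τ ℂ) F)]
    exact van_algebraMap (map_zero _)
  | succ n ih =>
    have h1 : Reg i c (yvar F a i) := reg_yvar i
    have := (ih.mul h1).add ((van_yvar_sub (a := a)).mul (reg_cst (F := F) ((a * c) ^ n)))
    convert! this using 1
    simp only [cst, map_mul, map_pow]
    ring

include ha in
lemma van_yvar_zpow_sub (hc : c ≠ 0) (n : ℤ) :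
    Van i c (yvar F a i ^ n - cst F ((a * c) ^ n)) := by
  obtain ⟨n, rfl | rfl⟩ := n.eq_nat_or_neg
  · simpa using van_yvar_pow_sub (F := F) (a := a) n
  · have hy : yvar F a i ≠ 0 := yvar_ne_zero ha i
    have hw : cst F (a * c) ≠ 0 := cst_ne_zero (mul_ne_zero ha hc)
    have h1 : Reg i c ((yvar F a i)⁻¹ ^ n) := by
      induction n with
      | zero => simpa using reg_one
      | succ n ih => rw [pow_succ]; exact ih.mul (reg_yvar_inv ha hc i)
    have := (van_yvar_pow_sub (F := F) (a := a) (i := i) (c := c) n).mul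
      (h1.mul (reg_cst (-((a * c) ^ (-n : ℤ)))))
    convert! this using 1
    simp only [cst, zpow_neg, zpow_natCast, map_neg, map_inv₀, map_pow, inv_pow] at hw ⊢
    field_simp
    ring

include ha in
lemma not_van_cst_sub_single (hc : c ≠ 0) {z u : ℂ} {n : ℤ} (h : z - u * (a * c) ^ n ≠ 0) :
    ¬ Van i c (cst F z - cst F u * yvar F a i ^ n) := by
  intro h1
  have h2 := h1.add ((van_yvar_zpow_sub (F := F) (i := i) ha hc n).mul (reg_cst u))
  refine not_van_cst (F := F) (i := i) (c := c) h ?_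
  convert! h2 using 1
  simp only [cst, map_sub, map_mul]
  ring

include ha in
-- On the divisor the power of y_i becomes a nonzero constant. What remains is a binomial with a
-- nontrivial monomial in the other variables, on which evaluation at x_i = c has no effect.
lemma not_van_cst_sub (hc : c ≠ 0) {z u : ℂ} (hu : u ≠ 0) {k : τ → ℤ} {j : τ} (hji : j ≠ i)
    (hj : k j ≠ 0) : ¬ Van i c (cst F z - cst F u * ymon F a k) := by
  classical
  intro h1
  set k' : τ → ℤ := k + (-k i) • Pi.single i 1 with hk'
  have hk : k = k' + k i • Pi.single i 1 := by rw [hk']; module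
  have hk'i : k' i = 0 := by simp [hk']
  have hk'0 : k' ≠ 0 := by
    intro h
    have := congrFun h j
    simp [hk', hji] at this
    exact hj this
  have hm : ymon F a k = ymon F a k' * yvar F a i ^ k i := by
    rw [hk, ymon_add ha, ymon_smul, ymon_single, ← hk]
  set w := (a * c) ^ k i with hw
  have hw0 : w ≠ 0 := zpow_ne_zero _ (mul_ne_zero ha hc)
  have h2 := h1.add (((van_yvar_zpow_sub (F := F) (i := i) ha hc (k i)).mul
    (reg_ymon (a := a) hc k')).mul (reg_cst u))
  have h3 : Van i c (cst F z - cst F (u * w) * ymon F a k') := by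
    convert! h2 using 1
    rw [hm, ← hw]
    simp only [cst, map_mul]
    ring
  have h4 : (cst F z - cst F (u * w) * ymon F a k') * algebraMap _ F (monDen k') =
      algebraMap _ F (MvPolynomial.C z * monDen k' - MvPolynomial.C (u * w) * monNum a k') := by
    rw [map_sub, map_mul, map_mul, algebraMap_C, algebraMap_C, ← ymon_mul_monDen]
    ring
  have h5 := (van_iff (evalAt_monDen_ne_zero hc k') h4).1 h3
  rw [map_sub, map_mul, map_mul, evalAt_C, evalAt_C, evalAt_monDen hk'i, evalAt_monNum hk'i] at h5
  rw [h5, map_zero] at h4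
  refine (mul_ne_zero (cst_sub_ne_zero ha (Or.inr (mul_ne_zero hu hw0)) hk'0) ?_) h4
  rw [Ne, FaithfulSMul.algebraMap_eq_zero_iff, monDen, Finset.prod_eq_zero_iff]
  rintro ⟨j, -, h⟩
  exact pow_ne_zero _ (MvPolynomial.X_ne_zero j) h

variable (τ F a) in
/-- The ring of Laurent polynomials. -/
def laurent : Subalgebra ℂ F := Algebra.adjoin ℂ (Set.range (ymon F a : (τ → ℤ) → F))

lemma ymon_mem_laurent (k : τ → ℤ) : ymon F a k ∈ laurent τ F a :=
  Algebra.subset_adjoin ⟨k, rfl⟩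

lemma cst_mem_laurent (z : ℂ) : cst F z ∈ laurent τ F a := Subalgebra.algebraMap_mem _ z

lemma yvar_mem_laurent (j : τ) : yvar F a j ∈ laurent τ F a := by
  classical
  rw [← ymon_single]
  exact ymon_mem_laurent _

lemma yvar_inv_mem_laurent (j : τ) : (yvar F a j)⁻¹ ∈ laurent τ F a := by
  classical
  rw [← ymon_single, ← zpow_neg_one, ← ymon_smul]
  exact ymon_mem_laurent _

include ha in
lemma algebraMap_mem_laurent (p : MvPolynomial τ ℂ) : algebraMap _ F p ∈ laurent τ F a := by
  induction p using MvPolynomial.induction_on with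
  | C z => rw [algebraMap_C]; exact cst_mem_laurent z
  | add p r hp hr => rw [map_add]; exact add_mem hp hr
  | mul_X p j hp =>
    rw [map_mul]
    refine mul_mem hp ?_
    change var F j ∈ _
    rw [var_eq ha]
    exact mul_mem (cst_mem_laurent _) (yvar_mem_laurent j)

include ha in
lemma var_inv_mem_laurent (j : τ) : (var F j)⁻¹ ∈ laurent τ F a := by
  rw [var_eq ha, mul_inv]
  refine mul_mem ?_ (yvar_inv_mem_laurent j)
  rw [cst, ← map_inv₀]
  exact cst_mem_laurent _

lemma exists_den_of_mem_laurent (hg : g ∈ laurent τ F a) : ∃ (m : τ → ℕ) (p : MvPolynomial τ ℂ),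
    g * algebraMap _ F (∏ j, MvPolynomial.X j ^ m j : MvPolynomial τ ℂ) = algebraMap _ F p := by
  induction hg using Algebra.adjoin_induction with
  | mem g hg =>
    obtain ⟨k, rfl⟩ := hg
    exact ⟨_, _, ymon_mul_monDen k⟩
  | algebraMap z => exact ⟨0, MvPolynomial.C z, by simp [algebraMap_C]⟩
  | add f g _ _ hf hg =>
    obtain ⟨m, p, h⟩ := hf
    obtain ⟨m', p', h'⟩ := hg
    refine ⟨m + m', p * (∏ j, MvPolynomial.X j ^ m' j) + p' * (∏ j, MvPolynomial.X j ^ m j), ?_⟩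
    simp only [Pi.add_apply, pow_add, Finset.prod_mul_distrib]
    rw [map_add, map_mul _ p, map_mul _ p', ← h, ← h', map_mul]
    ring
  | mul f g _ _ hf hg =>
    obtain ⟨m, p, h⟩ := hf
    obtain ⟨m', p', h'⟩ := hg
    refine ⟨m + m', p * p', ?_⟩
    simp only [Pi.add_apply, pow_add, Finset.prod_mul_distrib]
    rw [map_mul _ p, ← h, ← h', map_mul]
    ring

lemma evalAt_prod_X_ne_zero (hc : c ≠ 0) (m : τ → ℕ) :
    evalAt i c (∏ j, MvPolynomial.X j ^ m j) ≠ 0 := by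
  have := evalAt_monDen_ne_zero (i := i) hc fun j => -(m j : ℤ)
  simpa [monDen] using this

lemma reg_of_mem_laurent (hc : c ≠ 0) (hg : g ∈ laurent τ F a) : Reg i c g := by
  obtain ⟨m, p, h⟩ := exists_den_of_mem_laurent hg
  exact ⟨p, _, evalAt_prod_X_ne_zero hc m, h⟩

include ha in
-- As c ≠ 0, the monomial clearing the denominator does not vanish on the divisor, so the polynomial
-- numerator does and is divisible by x_i - c.
lemma div_mem_laurent (hc : c ≠ 0) (hg : g ∈ laurent τ F a) (hv : Van i c g) :
    g / (var F i - cst F c) ∈ laurent τ F a := by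
  obtain ⟨m, p, h⟩ := exists_den_of_mem_laurent hg
  obtain ⟨p', rfl⟩ := dvd_of_evalAt_eq_zero ((van_iff (evalAt_prod_X_ne_zero hc m) h).1 hv)
  have h0 : var F i - cst F c ≠ 0 := var_sub_ne_zero
  have hm : algebraMap _ F (∏ j, MvPolynomial.X j ^ m j : MvPolynomial τ ℂ) =
      ∏ j, var F j ^ m j := by
    rw [map_prod]
    simp only [map_pow]
    rfl
  have hm0 : ∏ j, var F j ^ m j ≠ 0 :=
    Finset.prod_ne_zero_iff.2 fun j _ => pow_ne_zero _ (var_ne_zero j)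
  have h1 : g / (var F i - cst F c) = algebraMap _ F p' * ∏ j, (var F j)⁻¹ ^ m j := by
    rw [hm, map_mul, map_sub, algebraMap_C] at h
    simp only [inv_pow, Finset.prod_inv_distrib]
    rw [← div_eq_mul_inv, div_eq_div_iff h0 hm0, h, mul_comm]
    rfl
  rw [h1]
  refine mul_mem (algebraMap_mem_laurent ha _) (prod_mem fun j _ => pow_mem ?_ _)
  exact var_inv_mem_laurent ha j

end LaurentRing

/-! ### Functions all of whose transforms are regular along y_i = ±1 -/

section GoodFunctions

variable {τ : Type*} {F : Type*} [Field F] [Algebra ℂ F] [Algebra (MvPolynomial τ ℂ) F]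
  [IsScalarTower ℂ (MvPolynomial τ ℂ) F] [IsFractionRing (MvPolynomial τ ℂ) F] [Fintype τ]
  {a : ℂ} {G : SimpleGraph τ} {σ ε : τ → F →ₐ[ℂ] F}

/-- The changes of variables generated by the `σ_i` and `ε_i`. -/
def moves (σ ε : τ → F →ₐ[ℂ] F) : Submonoid (F →ₐ[ℂ] F) :=
  Submonoid.closure (Set.range σ ∪ Set.range ε)

lemma sigma_mem_moves (i : τ) : σ i ∈ moves σ ε := Submonoid.subset_closure (Or.inl ⟨i, rfl⟩)

lemma eps_mem_moves (i : τ) : ε i ∈ moves σ ε := Submonoid.subset_closure (Or.inr ⟨i, rfl⟩)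

/-- `g` and all its transforms have no pole along `x_i = ± 1 / a`. -/
def Good (a : ℂ) (σ ε : τ → F →ₐ[ℂ] F) (g : F) : Prop :=
  ∀ θ ∈ moves σ ε, ∀ (i : τ) (s : ℂ), s = 1 ∨ s = -1 → Reg i (s * a⁻¹) (θ g)

namespace Good

variable {f g : F}

lemma reg (hg : Good a σ ε g) (i : τ) {s : ℂ} (hs : s = 1 ∨ s = -1) : Reg i (s * a⁻¹) g :=
  hg 1 (one_mem _) i s hs

lemma map (hg : Good a σ ε g) {θ : F →ₐ[ℂ] F} (hθ : θ ∈ moves σ ε) : Good a σ ε (θ g) :=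
  fun θ' hθ' i s hs => hg (θ' * θ) (mul_mem hθ' hθ) i s hs

lemma add (hf : Good a σ ε f) (hg : Good a σ ε g) : Good a σ ε (f + g) :=
  fun θ hθ i s hs => by rw [map_add]; exact (hf θ hθ i s hs).add (hg θ hθ i s hs)

lemma mul (hf : Good a σ ε f) (hg : Good a σ ε g) : Good a σ ε (f * g) :=
  fun θ hθ i s hs => by rw [map_mul]; exact (hf θ hθ i s hs).mul (hg θ hθ i s hs)

lemma const (z : ℂ) : Good a σ ε (cst F z) :=
  fun θ _ i s _ => by rw [AlgHom.commutes]; exact reg_cst z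

lemma one : Good a σ ε (1 : F) := by
  rw [← cst_one]
  exact const 1

lemma inv (hg : Good a σ ε g) (h : ∀ θ ∈ moves σ ε, ∀ (i : τ) (s : ℂ), s = 1 ∨ s = -1 →
    ¬ Van i (s * a⁻¹) (θ g)) : Good a σ ε g⁻¹ :=
  fun θ hθ i s hs => by rw [map_inv₀]; exact (hg θ hθ i s hs).inv (h θ hθ i s hs)

lemma sum {κ : Type*} (s : Finset κ) {f : κ → F} (h : ∀ k ∈ s, Good a σ ε (f k)) :
    Good a σ ε (∑ k ∈ s, f k) := by
  classical
  induction s using Finset.induction_on with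
  | empty =>
    rw [Finset.sum_empty, ← map_zero (algebraMap ℂ F)]
    exact const 0
  | insert k s hk ih =>
    rw [Finset.sum_insert hk]
    exact (h k (Finset.mem_insert_self k s)).add
      (ih fun m hm => h m (Finset.mem_insert_of_mem hm))

end Good

variable (H : IsReflData F G a σ ε)
include H

lemma sign_mul_inv_ne_zero {s : ℂ} (hs : s = 1 ∨ s = -1) : s * a⁻¹ ≠ 0 := by
  have := H.ne_zero
  rcases hs with rfl | rfl <;> simpa using this

lemma sigma_mem_laurent (i : τ) {g : F} (hg : g ∈ laurent τ F a) : σ i g ∈ laurent τ F a := by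
  induction hg using Algebra.adjoin_induction with
  | mem g hg =>
    obtain ⟨k, rfl⟩ := hg
    simp only [H.sigma_ymon]
    exact ymon_mem_laurent _
  | algebraMap z => rw [AlgHom.commutes]; exact cst_mem_laurent z
  | add f g _ _ hf hg => rw [map_add]; exact add_mem hf hg
  | mul f g _ _ hf hg => rw [map_mul]; exact mul_mem hf hg

lemma eps_mem_laurent (i : τ) {g : F} (hg : g ∈ laurent τ F a) : ε i g ∈ laurent τ F a := by
  induction hg using Algebra.adjoin_induction with
  | mem g hg =>
    obtain ⟨k, rfl⟩ := hg
    have h1 := H.eps_ymon_two i k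
    rw [ymon_smul, map_zpow₀] at h1
    have h2 : ε i (ymon F a k) ^ 2 = ymon F a k ^ 2 := by exact_mod_cast h1
    rcases sq_eq_sq_iff_eq_or_eq_neg.1 h2 with h | h
    · simp only [h]; exact ymon_mem_laurent _
    · simp only [h]; exact neg_mem (ymon_mem_laurent _)
  | algebraMap z => rw [AlgHom.commutes]; exact cst_mem_laurent z
  | add f g _ _ hf hg => rw [map_add]; exact add_mem hf hg
  | mul f g _ _ hf hg => rw [map_mul]; exact mul_mem hf hg

lemma good_of_mem_laurent {g : F} (hg : g ∈ laurent τ F a) : Good a σ ε g := by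
  intro θ hθ i s hs
  refine reg_of_mem_laurent (a := a) (sign_mul_inv_ne_zero H hs) ?_
  induction hθ using Submonoid.closure_induction generalizing g with
  | mem θ hθ =>
    rcases hθ with ⟨j, rfl⟩ | ⟨j, rfl⟩
    · exact sigma_mem_laurent H j hg
    · exact eps_mem_laurent H j hg
  | one => exact hg
  | mul θ θ' _ _ h h' => exact h (h' hg)

/-- A set of exponents with the properties of a reduced root system. -/
structure IsRootSet (G : SimpleGraph τ) (Φ : Set (τ → ℤ)) : Prop where
  refl_mem {k} (i : τ) : k ∈ Φ → refl G i k ∈ Φ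
  single_mem (i : τ) : (open scoped Classical in Pi.single i 1) ∈ Φ
  eq_or {k} (i : τ) : k ∈ Φ → (∃ j, j ≠ i ∧ k j ≠ 0) ∨
    k = (open scoped Classical in Pi.single i 1) ∨
    k = (open scoped Classical in -Pi.single i 1)

variable {Φ : Set (τ → ℤ)} (hΦ : IsRootSet G Φ)
include hΦ

/-- Exponents are doubled because an ε_i may change the sign of y^k itself. -/
lemma exists_move_ymon {θ : F →ₐ[ℂ] F} (hθ : θ ∈ moves σ ε) {k : τ → ℤ} (hk : k ∈ Φ) :
    ∃ k' ∈ Φ, θ (ymon F a ((2 : ℤ) • k)) = ymon F a ((2 : ℤ) • k') := by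
  induction hθ using Submonoid.closure_induction generalizing k with
  | mem θ hθ =>
    rcases hθ with ⟨j, rfl⟩ | ⟨j, rfl⟩
    · exact ⟨_, hΦ.refl_mem j hk, by rw [ymon_smul, map_zpow₀, H.sigma_ymon, ← ymon_smul]⟩
    · exact ⟨k, hk, H.eps_ymon_two j k⟩
  | one => exact ⟨k, hk, rfl⟩
  | mul θ θ' _ _ h h' =>
    obtain ⟨k', hk', e'⟩ := h' hk
    obtain ⟨k'', hk'', e''⟩ := h hk'
    exact ⟨k'', hk'', by rw [AlgHom.mul_apply, e', e'']⟩

variable (ha1 : a ^ 2 ≠ 1)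
include ha1

/-- A transform of a² - y^{2k} is a² - y^{2k'} for another root k'. On y_i = ±1 it is not
identically zero if k' involves a second variable; otherwise k' = ±α_i and its value is a² - 1 ≠ 0.
-/
lemma good_inv_root {k : τ → ℤ} (hk : k ∈ Φ) :
    Good a σ ε (cst F (a ^ 2) - ymon F a ((2 : ℤ) • k))⁻¹ := by
  classical
  have ha := H.ne_zero
  refine Good.inv (good_of_mem_laurent H (sub_mem (cst_mem_laurent _) (ymon_mem_laurent _))) ?_
  intro θ hθ i s hs
  obtain ⟨k', hk', e⟩ := exists_move_ymon H hΦ hθ hk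
  have hs2 : (a * (s * a⁻¹)) ^ (2 : ℤ) = 1 := by
    rcases hs with rfl | rfl <;> field_simp
  rw [map_sub, e, AlgHom.commutes, ← one_mul (ymon F a _), ← cst_one]
  rcases hΦ.eq_or i hk' with ⟨j, hji, hj⟩ | rfl | rfl
  · exact not_van_cst_sub ha (sign_mul_inv_ne_zero H hs) one_ne_zero hji (by simpa using hj)
  · rw [ymon_smul, ymon_single]
    exact not_van_cst_sub_single ha (sign_mul_inv_ne_zero H hs)
      (by rw [hs2, one_mul]; exact sub_ne_zero.2 ha1)
  · rw [smul_neg, ← neg_smul, ymon_smul, ymon_single]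
    refine not_van_cst_sub_single ha (sign_mul_inv_ne_zero H hs) ?_
    rw [zpow_neg, hs2, inv_one, one_mul]
    exact sub_ne_zero.2 ha1

/-- Multiply 1 / (a² - y_i²) by a + y_i. -/
lemma good_inv_a_sub (i : τ) : Good a σ ε (cst F a - yvar F a i)⁻¹ := by
  classical
  have h1 := good_inv_root H hΦ ha1 (hΦ.single_mem i)
  rw [ymon_smul, ymon_single] at h1
  have h2 : Good a σ ε (cst F a + yvar F a i) :=
    good_of_mem_laurent H (add_mem (cst_mem_laurent _) (yvar_mem_laurent i))
  have h3 := h2.mul h1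
  convert! h3 using 1
  have e1 := a_sub_ne_zero (F := F) H.ne_zero i
  have e2 := a_add_ne_zero (F := F) H.ne_zero i
  have e3 : cst F (a ^ 2) - yvar F a i ^ (2 : ℤ) =
      (cst F a - yvar F a i) * (cst F a + yvar F a i) := by
    rw [show cst F (a ^ 2) = cst F a ^ 2 from map_pow _ _ _, zpow_two]
    ring
  rw [e3]
  field_simp

end GoodFunctions

/-! ### The operators -y_i² f|σ_i: denominators and weights -/

section Operators

variable {τ : Type*} {F : Type*} [Field F] [Algebra ℂ F] [Algebra (MvPolynomial τ ℂ) F]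
  [IsScalarTower ℂ (MvPolynomial τ ℂ) F] [IsFractionRing (MvPolynomial τ ℂ) F] [Fintype τ]
  {a : ℂ} {G : SimpleGraph τ} {σ ε : τ → F →ₐ[ℂ] F}

/-- The operator `-y_i² f|σ_i`, which permutes the summands of `Δ(x) f(x;ℓ)`. -/
def sop (a : ℂ) (σ ε : τ → F →ₐ[ℂ] F) (l : τ → ℕ) (i : τ) (f : F) : F :=
  -(yvar F a i ^ 2) * twist a σ ε l i f

/-- The coefficient of `f(σ_i x)` in `-y_i² f|σ_i`. -/
def coefU (F : Type*) [Field F] [Algebra ℂ F] [Algebra (MvPolynomial τ ℂ) F] (a : ℂ) (l : τ → ℕ)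
    (i : τ) : F :=
  yvar F a i ^ (l i + 1) *
    (cst F ((1 - a) / 2) * ((1 + yvar F a i) * (cst F a - yvar F a i)⁻¹))

/-- The coefficient of `f(ε_i σ_i x)` in `-y_i² f|σ_i`. -/
def coefV (F : Type*) [Field F] [Algebra ℂ F] [Algebra (MvPolynomial τ ℂ) F] (a : ℂ) (l : τ → ℕ)
    (i : τ) : F :=
  yvar F a i ^ (l i + 1) *
    (cst F ((-1) ^ l i * (1 + a) / 2) * ((1 - yvar F a i) * (cst F a - yvar F a i)⁻¹))

lemma two_ne_zero_of_cst : (2 : F) ≠ 0 := by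
  have : cst F 2 ≠ 0 := cst_ne_zero two_ne_zero
  rwa [cst, map_ofNat] at this

lemma cst_div_two (z : ℂ) : cst F (z / 2) = cst F z / 2 := by
  rw [cst, map_div₀, map_ofNat]

section Basic

variable (ha : a ≠ 0)
include ha

lemma sop_eq (l : τ → ℕ) (i : τ) (f : F) :
    sop a σ ε l i f = coefU F a l i * σ i f + coefV F a l i * σ i (ε i f) := by
  have h1 := yvar_ne_zero (F := F) ha i
  have h2 := a_sub_ne_zero (F := F) ha i
  have h3 : (2 : F) ≠ 0 := two_ne_zero_of_cst
  simp only [sop, twist, coefU, coefV, coefP, coefQ, cst_div_two, map_sub, map_add, map_mul,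
    map_pow, map_one, map_neg, cst]
  field_simp
  ring

lemma twist_eq (l : τ → ℕ) (i : τ) (f : F) :
    twist a σ ε l i f = -(yvar F a i ^ 2)⁻¹ * sop a σ ε l i f := by
  have h1 := yvar_ne_zero (F := F) ha i
  rw [sop]
  field_simp

end Basic

variable (H : IsReflData F G a σ ε)
include H

lemma sop_mul (l : τ → ℕ) (i : τ) {p : F} (hp : ε i p = p) (f : F) :
    sop a σ ε l i (p * f) = σ i p * sop a σ ε l i f := by
  rw [sop_eq H.ne_zero, sop_eq H.ne_zero, map_mul, map_mul, map_mul, hp]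
  ring

/-- The factor 1 - a⁻² y_i² of D equals a⁻² (a - y_i)(a + y_i), so it clears the only nonmonomial
denominator. -/
lemma mul_coefU (l : τ → ℕ) (i : τ) :
    (1 - cst F (a ^ 2)⁻¹ * yvar F a i ^ 2) * coefU F a l i = yvar F a i ^ (l i + 1) *
      (cst F ((1 - a) / 2) * ((1 + yvar F a i) * (cst F (a ^ 2)⁻¹ * (cst F a + yvar F a i)))) := by
  have h1 := cst_ne_zero (F := F) H.ne_zero
  have h2 := a_sub_ne_zero (F := F) H.ne_zero i
  have e : cst F (a ^ 2)⁻¹ = (cst F a ^ 2)⁻¹ := by rw [cst, map_inv₀, map_pow]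
  rw [coefU, e]
  field_simp
  ring

lemma mul_coefV (l : τ → ℕ) (i : τ) :
    (1 - cst F (a ^ 2)⁻¹ * yvar F a i ^ 2) * coefV F a l i = yvar F a i ^ (l i + 1) *
      (cst F ((-1) ^ l i * (1 + a) / 2) *
        ((1 - yvar F a i) * (cst F (a ^ 2)⁻¹ * (cst F a + yvar F a i)))) := by
  have h1 := cst_ne_zero (F := F) H.ne_zero
  have h2 := a_sub_ne_zero (F := F) H.ne_zero i
  have e : cst F (a ^ 2)⁻¹ = (cst F a ^ 2)⁻¹ := by rw [cst, map_inv₀, map_pow]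
  rw [coefV, e]
  field_simp
  ring

lemma mul_sop_mem_laurent (l : τ → ℕ) (i : τ) {g : F} (hg : g ∈ laurent τ F a) :
    (1 - cst F (a ^ 2)⁻¹ * yvar F a i ^ 2) * sop a σ ε l i g ∈ laurent τ F a := by
  have hy := yvar_mem_laurent (F := F) (a := a) i
  have h1 := sigma_mem_laurent H i hg
  have h2 := sigma_mem_laurent H i (eps_mem_laurent H i hg)
  rw [sop_eq H.ne_zero, mul_add, ← mul_assoc, ← mul_assoc, mul_coefU H, mul_coefV H]
  refine add_mem (mul_mem (mul_mem (pow_mem hy _) (mul_mem (cst_mem_laurent _)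
    (mul_mem (add_mem (one_mem _) hy) (mul_mem (cst_mem_laurent _)
      (add_mem (cst_mem_laurent _) hy))))) h1)
    (mul_mem (mul_mem (pow_mem hy _) (mul_mem (cst_mem_laurent _)
    (mul_mem (sub_mem (one_mem _) hy) (mul_mem (cst_mem_laurent _)
      (add_mem (cst_mem_laurent _) hy))))) h2)

section Valuations

variable (n : τ → ℝ)

/-- The weights after reflection in the node `i`. -/
def reflWt (G : SimpleGraph τ) (n : τ → ℝ) (i : τ) (j : τ) : ℝ :=
  wt n (refl G i (open scoped Classical in Pi.single j 1))

lemma val_le_val_sigma (i : τ) (g : F) : val F (reflWt G n i) g ≤ val F n (σ i g) := by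
  classical
  refine val_le_val_map n (σ i) (fun j => ?_) g
  rw [var_eq H.ne_zero, map_mul, AlgHom.commutes, ← ymon_single, H.sigma_ymon, map_mul, hahn_cst,
    hahn_ymon, HahnSeries.single_mul_single, zero_add, reflWt]

lemma val_le_val_eps (i : τ) (g : F) : val F n g ≤ val F n (ε i g) := by
  classical
  refine val_le_val_map n (ε i) (fun j => ?_) g
  rw [var_eq H.ne_zero, map_mul, AlgHom.commutes]
  by_cases h : G.Adj i j
  · rw [H.eps_adj h, ← neg_one_mul, ← cst_one, ← cst_neg, map_mul, map_mul, hahn_cst, hahn_cst,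
      hahn_yvar, HahnSeries.single_mul_single, HahnSeries.single_mul_single, zero_add, zero_add]
  · rw [H.eps_other h, map_mul, hahn_cst, hahn_yvar, HahnSeries.single_mul_single, zero_add]

/-- Numerator and denominator of the fraction both have value min(0, n_i), so only the constant
contributes; z = 0 is allowed, with value ∞. -/
lemma val_ratio_nonneg (i : τ) {u : ℂ} (z : ℂ) (hu : u ≠ 0) :
    0 ≤ val F n (cst F z * ((1 + cst F u * yvar F a i) * (cst F a - yvar F a i)⁻¹)) := by
  classical
  have hne : (Pi.single i 1 : τ → ℤ) ≠ 0 := by simp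
  have h1 : val F n (cst F a - yvar F a i) = min 0 (wt n (Pi.single i 1) : WithTop ℝ) := by
    rw [← val_cst_sub (F := F) H.ne_zero n H.ne_zero one_ne_zero hne, ymon_single, cst_one, one_mul]
  have h2 : val F n (1 + cst F u * yvar F a i) = min 0 (wt n (Pi.single i 1) : WithTop ℝ) := by
    rw [← val_cst_sub (F := F) H.ne_zero n one_ne_zero (neg_ne_zero.2 hu) hne, ymon_single,
      cst_one, cst_neg, neg_mul, sub_neg_eq_add]
  have h3 : val F n ((1 + cst F u * yvar F a i) * (cst F a - yvar F a i)⁻¹) +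
      val F n (cst F a - yvar F a i) = val F n (1 + cst F u * yvar F a i) := by
    rw [← AddValuation.map_mul, mul_assoc, inv_mul_cancel₀ (a_sub_ne_zero H.ne_zero i), mul_one]
  rw [AddValuation.map_mul]
  refine add_nonneg (val_cst_nonneg n z) ?_
  rw [h1, h2, ← WithTop.coe_zero, ← WithTop.coe_min] at h3
  generalize val F n ((1 + cst F u * yvar F a i) * (cst F a - yvar F a i)⁻¹) = v at h3 ⊢
  cases v with
  | top => exact le_top
  | coe v =>
    norm_cast at h3 ⊢
    linarith

/-- The shift comes from the factor y_i^{l_i+1} of both coefficients, the reflected weights from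
σ_i; the other factors have nonnegative value. -/
lemma le_val_sop (l : τ → ℕ) (i : τ) (g : F) :
    (((l i + 1) * n i : ℝ) : WithTop ℝ) + val F (reflWt G n i) g ≤ val F n (sop a σ ε l i g) := by
  classical
  have hy : val F n (yvar F a i ^ (l i + 1)) = (((l i + 1) * n i : ℝ) : WithTop ℝ) := by
    rw [← ymon_single, ← zpow_natCast, ← ymon_smul, val_ymon H.ne_zero n, wt_smul]
    congr 1
    simp [wt, Pi.single_apply]
  rw [sop_eq H.ne_zero]
  have hσ := val_le_val_sigma H n i
  refine le_trans (le_min ?_ ?_) (AddValuation.map_add _ _ _)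
  · rw [AddValuation.map_mul, coefU, AddValuation.map_mul, hy, add_assoc]
    gcongr
    refine le_trans (hσ g) (le_add_of_nonneg_left ?_)
    have := val_ratio_nonneg H n i ((1 - a) / 2) one_ne_zero
    rwa [cst_one, one_mul] at this
  · rw [AddValuation.map_mul, coefV, AddValuation.map_mul, hy, add_assoc]
    gcongr
    refine le_trans (val_le_val_eps H _ i g) (le_trans (hσ (ε i g)) (le_add_of_nonneg_left ?_))
    have := val_ratio_nonneg H n i ((-1) ^ l i * (1 + a) / 2) (neg_ne_zero.2 one_ne_zero)
    rwa [cst_neg, cst_one, neg_one_mul, ← sub_eq_add_neg] at this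

end Valuations

end Operators

/-! ### Vanishing on y_i = ±1, spreading of regularity, cancellation of Δ -/

section Regularity

variable {τ : Type*} {F : Type*} [Field F] [Algebra ℂ F] [Algebra (MvPolynomial τ ℂ) F]
  [IsScalarTower ℂ (MvPolynomial τ ℂ) F] [IsFractionRing (MvPolynomial τ ℂ) F] [Fintype τ]
  {a : ℂ} {G : SimpleGraph τ} {σ ε : τ → F →ₐ[ℂ] F} (H : IsReflData F G a σ ε)
include H

lemma good_yvar (i : τ) : Good a σ ε (yvar F a i) := good_of_mem_laurent H (yvar_mem_laurent i)

section RootSet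

variable {Φ : Set (τ → ℤ)} (hΦ : IsRootSet G Φ) (ha1 : a ^ 2 ≠ 1)
include hΦ ha1

lemma good_coefU (l : τ → ℕ) (i : τ) : Good a σ ε (coefU F a l i) :=
  (good_of_mem_laurent H (pow_mem (yvar_mem_laurent i) _)).mul ((Good.const _).mul
    ((Good.one.add (good_yvar H i)).mul (good_inv_a_sub H hΦ ha1 i)))

lemma good_coefV (l : τ → ℕ) (i : τ) : Good a σ ε (coefV F a l i) :=
  (good_of_mem_laurent H (pow_mem (yvar_mem_laurent i) _)).mul ((Good.const _).mul
    ((good_of_mem_laurent H (sub_mem (one_mem _) (yvar_mem_laurent i))).mul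
      (good_inv_a_sub H hΦ ha1 i)))

lemma Good.sop (l : τ → ℕ) (i : τ) {g : F} (hg : Good a σ ε g) : Good a σ ε (sop a σ ε l i g) := by
  rw [sop_eq H.ne_zero]
  exact ((good_coefU H hΦ ha1 l i).mul (hg.map (sigma_mem_moves i))).add
    ((good_coefV H hΦ ha1 l i).mul ((hg.map (eps_mem_moves i)).map (sigma_mem_moves i)))

end RootSet

omit H in
lemma van_zero {i : τ} {c : ℂ} : Van i c (0 : F) := by
  simpa using van_algebraMap (F := F) (i := i) (c := c) (p := 0) (map_zero _)

/-- On y_i = 1 the substitutions y_i ↦ y_i⁻¹ and y_j ↦ y_i y_j are the identity. -/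
lemma van_sigma_sub (i : τ) {g : F} (hg : Reg i (1 * a⁻¹) g) :
    Van i (1 * a⁻¹) (σ i g - g) := by
  have ha := H.ne_zero
  have hc : (1 : ℂ) * a⁻¹ ≠ 0 := sign_mul_inv_ne_zero H (Or.inl rfl)
  have e1 : a * (1 * a⁻¹) = 1 := by field_simp
  have hy : Van i (1 * a⁻¹) (yvar F a i - 1) := by
    simpa only [e1, cst_one] using van_yvar_sub (F := F) (a := a) (i := i) (c := 1 * a⁻¹)
  refine van_map_sub (σ i) (fun j => ?_) hg
  rw [var_eq ha, map_mul, AlgHom.commutes, ← mul_sub, mul_comm (algebraMap ℂ F a⁻¹)]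
  refine Van.mul ?_ (reg_cst _)
  by_cases hij : i = j
  · subst hij
    rw [H.sigma_self]
    have h := van_yvar_zpow_sub (F := F) ha (i := i) hc (-1)
    simp only [e1, zpow_neg_one] at h
    simpa using h.sub hy
  · by_cases h : G.Adj i j
    · rw [H.sigma_adj h, ← sub_one_mul]
      exact hy.mul (reg_yvar j)
    · rw [H.sigma_other hij h, sub_self]
      exact van_zero

/-- On y_i = -1 the sign in y_j ↦ y_i y_j = -y_j is undone by ε_i. -/
lemma van_sigma_eps_sub (i : τ) {g : F} (hg : Reg i (-1 * a⁻¹) g) :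
    Van i (-1 * a⁻¹) (σ i (ε i g) - g) := by
  have ha := H.ne_zero
  have hc : (-1 : ℂ) * a⁻¹ ≠ 0 := sign_mul_inv_ne_zero H (Or.inr rfl)
  have e1 : a * (-1 * a⁻¹) = -1 := by field_simp
  have hy : Van i (-1 * a⁻¹) (yvar F a i + 1) := by
    simpa only [e1, cst_neg, cst_one, sub_neg_eq_add] using
      van_yvar_sub (F := F) (a := a) (i := i) (c := -1 * a⁻¹)
  refine van_map_sub ((σ i).comp (ε i)) (fun j => ?_) hg
  rw [var_eq ha, map_mul, AlgHom.commutes, ← mul_sub, mul_comm (algebraMap ℂ F a⁻¹)]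
  refine Van.mul ?_ (reg_cst _)
  rw [AlgHom.comp_apply]
  by_cases hij : i = j
  · subst hij
    rw [H.eps_self, H.sigma_self]
    have h := van_yvar_zpow_sub (F := F) ha (i := i) hc (-1)
    simp only [e1, zpow_neg_one, inv_neg, inv_one, cst_neg, cst_one, sub_neg_eq_add] at h
    simpa using h.sub hy
  · by_cases h : G.Adj i j
    · have e : σ i (ε i (yvar F a j)) - yvar F a j = (yvar F a i + 1) * -yvar F a j := by
        rw [H.eps_adj h, map_neg, H.sigma_adj h]
        ring
      rw [e]
      exact hy.mul (reg_yvar j).neg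
    · rw [H.eps_other h, H.sigma_other hij h, sub_self]
      exact van_zero

/-- On y_i = 1 the coefficients U and V of f(σ_i x) and f(ε_i σ_i x) become -1 and 0, and σ_i is the
identity. On y_i = -1 they become 0 and -1, and f ↦ σ_i (ε_i f) is the identity. Either way the
equation reads h = -h. -/
lemma van_of_sop_eq {Φ : Set (τ → ℤ)} (hΦ : IsRootSet G Φ) (ha1 : a ^ 2 ≠ 1) (l : τ → ℕ) (i : τ)
    {h : F} (hg : Good a σ ε h) (hs : sop a σ ε l i h = h) {s : ℂ} (hs1 : s = 1 ∨ s = -1) :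
    Van i (s * a⁻¹) h := by
  have ha := H.ne_zero
  have hc := sign_mul_inv_ne_zero H hs1
  have e1 : a * (s * a⁻¹) = s := by field_simp
  have hne := a_sub_ne_zero (F := F) ha i
  have h2 : (2 : F) ≠ 0 := two_ne_zero_of_cst
  have hp (m : ℕ) := van_yvar_pow_sub (F := F) (a := a) (i := i) (c := s * a⁻¹) m
  have hy := hp 1
  simp only [e1, pow_one] at hp hy
  have hA : Reg i (s * a⁻¹) (cst F a - yvar F a i)⁻¹ :=
    (good_inv_a_sub H hΦ ha1 i).reg i hs1
  have hσ : Reg i (s * a⁻¹) (σ i h) := (hg.map (sigma_mem_moves i)).reg i hs1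
  have hσε : Reg i (s * a⁻¹) (σ i (ε i h)) :=
    ((hg.map (eps_mem_moves i)).map (sigma_mem_moves i)).reg i hs1
  have hpow : Reg i (s * a⁻¹) (yvar F a i ^ (l i + 1)) :=
    ((good_of_mem_laurent H (pow_mem (yvar_mem_laurent i) _))).reg i hs1
  -- Written as h + h = h + U σ_i h + V σ_i ε_i h, the right side is a sum of visibly vanishing
  -- terms.
  suffices Van i (s * a⁻¹) (h + h) by
    have h3 := this.mul (reg_cst (1 / 2))
    convert! h3 using 1
    rw [cst_div_two, cst_one]
    field_simp
    ring
  have key : h + h = h + (coefU F a l i * σ i h + coefV F a l i * σ i (ε i h)) := by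
    rw [← sop_eq ha, hs]
  rcases hs1 with rfl | rfl
  · have hm : Van i (1 * a⁻¹) (yvar F a i - 1) := by simpa [cst_one] using hy
    have hm' : Van i (1 * a⁻¹) (yvar F a i ^ (l i + 1) - 1) := by
      simpa only [one_pow, cst_one] using hp (l i + 1)
    have hU1 : Van i (1 * a⁻¹) (1 + coefU F a l i) := by
      have e : 1 + coefU F a l i = (yvar F a i ^ (l i + 1) - 1) * (cst F ((1 - a) / 2) *
          ((1 + yvar F a i) * (cst F a - yvar F a i)⁻¹)) +
          (yvar F a i - 1) * (cst F (-(1 + a) / 2) * (cst F a - yvar F a i)⁻¹) := by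
        simp only [coefU, cst_div_two, map_sub, map_add, map_neg, map_one, cst]
        field_simp
        ring
      rw [e]
      exact (hm'.mul ((reg_cst _).mul ((reg_one.add (reg_yvar i)).mul hA))).add
        (hm.mul ((reg_cst _).mul hA))
    have hV0 : Van i (1 * a⁻¹) (coefV F a l i) := by
      have e : coefV F a l i = (yvar F a i - 1) * (yvar F a i ^ (l i + 1) *
          (cst F (-((-1) ^ l i * (1 + a) / 2)) * (cst F a - yvar F a i)⁻¹)) := by
        rw [coefV, cst_neg]
        ring
      rw [e]
      exact hm.mul (hpow.mul ((reg_cst _).mul hA))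
    have e : h + h = (1 + coefU F a l i) * σ i h - (σ i h - h) + coefV F a l i * σ i (ε i h) := by
      rw [key]
      ring
    rw [e]
    exact ((hU1.mul hσ).sub (van_sigma_sub H i (hg.reg i (Or.inl rfl)))).add (hV0.mul hσε)
  · have hm : Van i (-1 * a⁻¹) (yvar F a i + 1) := by
      simpa [cst_one, cst_neg] using hy
    have hm' : Van i (-1 * a⁻¹) (cst F ((-1) ^ l i) * yvar F a i ^ (l i + 1) + 1) := by
      have h3 := (hp (l i + 1)).mul (reg_cst ((-1) ^ l i))
      convert! h3 using 1
      have e2 : (-1 : ℂ) ^ (l i + 1) * (-1) ^ l i = -1 := by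
        rw [← pow_add]
        exact Odd.neg_one_pow ⟨l i, by ring⟩
      rw [sub_mul, ← map_mul, e2, map_neg, map_one, mul_comm, sub_neg_eq_add]
    have hU0 : Van i (-1 * a⁻¹) (coefU F a l i) := by
      have e : coefU F a l i = (yvar F a i + 1) * (yvar F a i ^ (l i + 1) *
          (cst F ((1 - a) / 2) * (cst F a - yvar F a i)⁻¹)) := by
        rw [coefU]
        ring
      rw [e]
      exact hm.mul (hpow.mul ((reg_cst _).mul hA))
    have hV1 : Van i (-1 * a⁻¹) (1 + coefV F a l i) := by
      have e : 1 + coefV F a l i = (cst F ((-1) ^ l i) * yvar F a i ^ (l i + 1) + 1) *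
          (cst F ((1 + a) / 2) * ((1 - yvar F a i) * (cst F a - yvar F a i)⁻¹)) +
          (yvar F a i + 1) * (cst F ((a - 1) / 2) * (cst F a - yvar F a i)⁻¹) := by
        simp only [coefV, cst_div_two, map_sub, map_add, map_neg, map_one, map_mul, map_pow,
          cst]
        field_simp
        ring
      rw [e]
      refine (hm'.mul ((reg_cst _).mul (Reg.mul ?_ hA))).add (hm.mul ((reg_cst _).mul hA))
      rw [sub_eq_add_neg]
      exact reg_one.add (reg_yvar i).neg
    have e : h + h = (1 + coefV F a l i) * σ i (ε i h) - (σ i (ε i h) - h) +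
        coefU F a l i * σ i h := by
      rw [key]
      ring
    rw [e]
    exact ((hV1.mul hσε).sub (van_sigma_eps_sub H i (hg.reg i (Or.inr rfl)))).add (hU0.mul hσ)

/-! ### Spreading regularity -/

open scoped Classical in
/-- The polynomial version of `ε_j`. -/
def epsPoly (G : SimpleGraph τ) (j : τ) : MvPolynomial τ ℂ →ₐ[ℂ] MvPolynomial τ ℂ :=
  MvPolynomial.aeval fun k => if G.Adj j k then -MvPolynomial.X k else MvPolynomial.X k

omit H in
lemma epsPoly_injective (j : τ) : Function.Injective (epsPoly G j) := by
  have h : (epsPoly G j).comp (epsPoly G j) = AlgHom.id ℂ _ := by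
    ext k : 1
    by_cases hk : G.Adj j k <;> simp [epsPoly, hk]
  exact Function.LeftInverse.injective (g := epsPoly G j) fun p => DFunLike.congr_fun h p

lemma eps_var (j k : τ) : ε j (var F k) = algebraMap _ F (epsPoly G j (MvPolynomial.X k)) := by
  rw [var_eq H.ne_zero, map_mul, AlgHom.commutes]
  have e : cst F a⁻¹ * yvar F a k = var F k := (var_eq H.ne_zero k).symm
  by_cases hk : G.Adj j k
  · rw [H.eps_adj hk, mul_neg, e]
    simp [epsPoly, hk, var]
  · rw [H.eps_other hk, e]
    simp [epsPoly, hk, var]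

lemma eps_algebraMap (j : τ) (p : MvPolynomial τ ℂ) :
    ε j (algebraMap _ F p) = algebraMap _ F (epsPoly G j p) := by
  have h : ((ε j).comp (IsScalarTower.toAlgHom ℂ (MvPolynomial τ ℂ) F)) =
      (IsScalarTower.toAlgHom ℂ (MvPolynomial τ ℂ) F).comp (epsPoly G j) := by
    ext k
    exact eps_var H j k
  exact DFunLike.congr_fun h p

/-- Sign changes permute the divisors x_i = ±1 / a; this is why both signs are assumed together. -/
lemma reg_eps (j : τ) {g : F} (hg : ∀ (i : τ) (s : ℂ), s = 1 ∨ s = -1 → Reg i (s * a⁻¹) g)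
    (i : τ) (s : ℂ) (hs : s = 1 ∨ s = -1) : Reg i (s * a⁻¹) (ε j g) := by
  have key : ∀ t : ℂ, t = 1 ∨ t = -1 → (∀ p, evalAt i (s * a⁻¹) (epsPoly G j p) =
      epsPoly G j (evalAt i (t * a⁻¹) p)) → Reg i (s * a⁻¹) (ε j g) := by
    intro t ht h
    obtain ⟨p, r, hr, e⟩ := hg i t ht
    refine ⟨epsPoly G j p, epsPoly G j r, ?_, ?_⟩
    · rw [h]
      exact (map_ne_zero_iff _ (epsPoly_injective j)).2 hr
    · rw [← eps_algebraMap H, ← eps_algebraMap H, ← map_mul, e]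
  have ext : ∀ t : ℂ, (∀ k, evalAt i (s * a⁻¹) (epsPoly G j (MvPolynomial.X k)) =
      epsPoly G j (evalAt i (t * a⁻¹) (MvPolynomial.X k))) →
      ∀ p, evalAt i (s * a⁻¹) (epsPoly G j p) = epsPoly G j (evalAt i (t * a⁻¹) p) := by
    intro t h p
    have : (evalAt i (s * a⁻¹)).comp (epsPoly G j) = (epsPoly G j).comp (evalAt i (t * a⁻¹)) := by
      ext k : 1
      exact h k
    exact DFunLike.congr_fun this p
  have hC (z : ℂ) : epsPoly G j (MvPolynomial.C z) = MvPolynomial.C z := by simp [epsPoly]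
  by_cases hij : G.Adj j i
  -- When j is adjacent to i, ε_j interchanges x_i = s / a and x_i = -s / a.
  · refine key (-s) (by rcases hs with rfl | rfl <;> simp) (ext _ fun k => ?_)
    by_cases hk : k = i
    · subst hk
      simp only [epsPoly, MvPolynomial.aeval_X, if_pos hij, map_neg, evalAt_X_self, neg_mul]
      simp
    · by_cases hjk : G.Adj j k <;> simp [epsPoly, hjk, evalAt_X_of_ne hk]
  · refine key s hs (ext _ fun k => ?_)
    by_cases hk : k = i
    · subst hk
      simp only [epsPoly, MvPolynomial.aeval_X, if_neg hij, evalAt_X_self]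
      simp
    · by_cases hjk : G.Adj j k <;> simp [epsPoly, hjk, evalAt_X_of_ne hk]

omit H in
/-- The changes of signs generated by the `ε_i`. -/
def signs (ε : τ → F →ₐ[ℂ] F) : Submonoid (F →ₐ[ℂ] F) := Submonoid.closure (Set.range ε)

lemma sigma_eps (i j : τ) : ∃ e ∈ signs ε, ∀ g, σ i (ε j g) = e (σ i g) := by
  have hm (k : τ) : ε k ∈ signs ε := Submonoid.subset_closure ⟨k, rfl⟩
  by_cases h : G.Adj i j
  · refine ⟨ε j * ε i, mul_mem (hm j) (hm i), fun g => ?_⟩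
    rw [AlgHom.mul_apply, H.eps_sigma_self, H.eps_sigma_adj h, H.eps_comm j i, H.eps_eps]
  · exact ⟨ε j, hm j, fun g => (H.eps_sigma_not_adj h g).symm⟩

lemma sigma_signs (i : τ) {e : F →ₐ[ℂ] F} (he : e ∈ signs ε) :
    ∃ e' ∈ signs ε, ∀ g, σ i (e g) = e' (σ i g) := by
  induction he using Submonoid.closure_induction with
  | mem e he =>
    obtain ⟨j, rfl⟩ := he
    exact sigma_eps H i j
  | one => exact ⟨1, one_mem _, fun g => rfl⟩
  | mul e₁ e₂ _ _ h₁ h₂ =>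
    obtain ⟨e₁', m₁, h₁⟩ := h₁
    obtain ⟨e₂', m₂, h₂⟩ := h₂
    exact ⟨e₁' * e₂', mul_mem m₁ m₂, fun g => by
      rw [AlgHom.mul_apply, AlgHom.mul_apply, h₁, h₂]⟩

omit H in
lemma signs_le_moves : signs ε ≤ moves σ ε :=
  Submonoid.closure_mono Set.subset_union_right

lemma reg_signs {e : F →ₐ[ℂ] F} (he : e ∈ signs ε) {g : F}
    (hg : ∀ (i : τ) (s : ℂ), s = 1 ∨ s = -1 → Reg i (s * a⁻¹) g) :
    ∀ (i : τ) (s : ℂ), s = 1 ∨ s = -1 → Reg i (s * a⁻¹) (e g) := by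
  induction he using Submonoid.closure_induction generalizing g with
  | mem e he =>
    obtain ⟨j, rfl⟩ := he
    exact reg_eps H j hg
  | one => exact hg
  | mul e₁ e₂ _ _ h₁ h₂ => exact h₁ (h₂ hg)

section Spread

variable {Φ : Set (τ → ℤ)} (hΦ : IsRootSet G Φ) (ha1 : a ^ 2 ≠ 1)
include hΦ ha1

/-- A function that is invariant under the twisted action and has no pole along `x_i = ± 1 / a`
for all `i` has no pole along the transforms of these divisors. -/
lemma good_of_twist_eq (l : τ → ℕ) {f : F} (hf : ∀ i, twist a σ ε l i f = f)
    (hr : ∀ (i : τ) (s : ℂ), s = 1 ∨ s = -1 → Reg i (s * a⁻¹) f) : Good a σ ε f := by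
  have ha := H.ne_zero
  -- The sums of terms r · e(f), with r good and e a sign change, are regular along all x_i = ±1 /
  -- a. They are stable under all moves because invariance rewrites σ_i f through f and ε_i f.
  let S : Set F := {g | ∃ r, Good a σ ε r ∧ ∃ e ∈ signs ε, g = r * e f}
  let L : AddSubmonoid F := AddSubmonoid.closure S
  have hgen {r : F} (hr : Good a σ ε r) {e : F →ₐ[ℂ] F} (he : e ∈ signs ε) : r * e f ∈ L :=
    AddSubmonoid.subset_closure ⟨r, hr, e, he, rfl⟩
  have hinv (i : τ) : Good a σ ε (-(yvar F a i ^ 2)⁻¹) :=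
    good_of_mem_laurent H (neg_mem (by
      rw [← inv_pow]
      exact pow_mem (yvar_inv_mem_laurent i) _))
  have hσf (i : τ) : ∃ A B, Good a σ ε A ∧ Good a σ ε B ∧ σ i f = A * f + B * ε i f := by
    refine ⟨σ i (-(yvar F a i ^ 2)⁻¹ * coefU F a l i), σ i (-(yvar F a i ^ 2)⁻¹ * coefV F a l i),
      ((hinv i).mul (good_coefU H hΦ ha1 l i)).map (sigma_mem_moves i),
      ((hinv i).mul (good_coefV H hΦ ha1 l i)).map (sigma_mem_moves i), ?_⟩
    -- Applying σ_i to f|σ_i = f cancels the inner σ_i, leaving f and ε_i f.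
    have h1 := congrArg (σ i) (hf i)
    rw [twist_eq ha, sop_eq ha, mul_add, ← mul_assoc, ← mul_assoc, map_add, map_mul (σ i) _ (σ i f),
      map_mul (σ i) _ (σ i (ε i f)), H.sigma_sigma, H.sigma_sigma] at h1
    exact h1.symm
  have hL : ∀ θ ∈ moves σ ε, ∀ g ∈ L, θ g ∈ L := by
    intro θ hθ
    induction hθ using Submonoid.closure_induction with
    | mem θ hθ =>
      intro g hg
      induction hg using AddSubmonoid.closure_induction with
      | mem g hg =>
        obtain ⟨r, hr, e, he, rfl⟩ := hg
        rcases hθ with ⟨j, rfl⟩ | ⟨j, rfl⟩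
        · obtain ⟨e', he', hc⟩ := sigma_signs H j he
          obtain ⟨A, B, hA, hB, hAB⟩ := hσf j
          have hσr : Good a σ ε (σ j r) := hr.map (sigma_mem_moves j)
          have hm := signs_le_moves (σ := σ) he'
          have hsum := add_mem (hgen (hσr.mul (hA.map hm)) he')
            (hgen (hσr.mul (hB.map hm)) (mul_mem he' (Submonoid.subset_closure ⟨j, rfl⟩)))
          convert! hsum using 1
          rw [map_mul, hc, hAB, map_add, map_mul, map_mul, AlgHom.mul_apply]
          ring
        · rw [map_mul]
          exact hgen (e := ε j * e) (hr.map (eps_mem_moves j))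
            (mul_mem (Submonoid.subset_closure ⟨j, rfl⟩) he)
      | zero => rw [map_zero]; exact zero_mem _
      | add g g' _ _ h h' => rw [map_add]; exact add_mem h h'
    | one => exact fun g hg => hg
    | mul θ θ' _ _ h h' => exact fun g hg => h _ (h' g hg)
  have hfL : f ∈ L := by simpa using hgen Good.one (one_mem (signs ε))
  intro θ hθ i s hs
  have hm := hL θ hθ f hfL
  generalize θ f = g at hm
  induction hm using AddSubmonoid.closure_induction with
  | mem g hg =>
    obtain ⟨r, hg, e, he, rfl⟩ := hg
    exact (hg.reg i hs).mul (reg_signs H he hr i s hs)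
  | zero => rw [← map_zero (algebraMap ℂ F)]; exact reg_cst 0
  | add g g' _ _ h h' => exact h.add h'

end Spread

/-! ### Removing factors of the denominator -/

/-- The factor `1 - y ^ (2k)` can be removed from the denominator of a good function. -/
def Removable (F : Type*) [Field F] [Algebra ℂ F] [Algebra (MvPolynomial τ ℂ) F] (a : ℂ)
    (σ ε : τ → F →ₐ[ℂ] F) (k : τ → ℤ) : Prop :=
  ∀ M : F, Good a σ ε M → M * (1 - ymon F a ((2 : ℤ) • k)) ∈ laurent τ F a → M ∈ laurent τ F a

/-- 1 - y_i² = -a² (x_i - 1/a)(x_i + 1/a), and since M has no pole along either divisor the Laurent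
polynomial vanishes on both; divide twice. -/
lemma removable_single (i : τ) :
    Removable F a σ ε (open scoped Classical in Pi.single i 1) := by
  classical
  intro M hM hmem
  have ha := H.ne_zero
  have hc (s : ℂ) (hs : s = 1 ∨ s = -1) := sign_mul_inv_ne_zero H hs
  have r (s : ℂ) (hs : s = 1 ∨ s = -1) : Reg i (s * a⁻¹) M := hM.reg i hs
  have v (s : ℂ) : Van i (s * a⁻¹) (var F i - cst F (s * a⁻¹)) := van_var_sub
  have ne (s : ℂ) : var F i - cst F (s * a⁻¹) ≠ 0 := var_sub_ne_zero
  have e : M * (1 - ymon F a ((2 : ℤ) • Pi.single i 1)) =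
      (var F i - cst F (1 * a⁻¹)) * (M * ((var F i - cst F (-1 * a⁻¹)) * cst F (-a ^ 2))) := by
    have h1 := cst_ne_zero (F := F) ha
    rw [ymon_smul, ymon_single, zpow_two, yvar, one_mul, neg_one_mul]
    simp only [cst, map_neg, map_inv₀, map_pow]
    field_simp
    ring
  rw [e] at hmem
  have rv (c : ℂ) : Reg i c (var F i - cst F (-1 * a⁻¹)) := by
    rw [sub_eq_add_neg]
    exact (reg_var i).add (reg_cst _).neg
  have m1 := div_mem_laurent ha (hc 1 (Or.inl rfl)) hmem
    ((v 1).mul ((r 1 (Or.inl rfl)).mul ((rv _).mul (reg_cst _))))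
  rw [mul_div_cancel_left₀ _ (ne 1), mul_left_comm] at m1
  have m2 := div_mem_laurent ha (hc (-1) (Or.inr rfl)) m1
    ((v (-1)).mul ((r (-1) (Or.inr rfl)).mul (reg_cst _)))
  rw [mul_div_cancel_left₀ _ (ne (-1))] at m2
  have m3 := mul_mem m2 (cst_mem_laurent (-a ^ 2)⁻¹)
  rwa [mul_assoc, ← map_mul, mul_inv_cancel₀ (by simpa using ha), map_one, mul_one] at m3

/-- Goodness and Laurent polynomials are stable under σ_j, which carries one factor to the other. -/
lemma Removable.refl (j : τ) {k : τ → ℤ} (hk : Removable F a σ ε k) :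
    Removable F a σ ε (refl G j k) := by
  intro M hM hmem
  have h1 := sigma_mem_laurent H j hmem
  rw [map_mul, map_sub, map_one, ymon_smul, ← H.sigma_ymon, ← map_zpow₀, H.sigma_sigma,
    ← ymon_smul] at h1
  have h2 := sigma_mem_laurent H j (hk _ (hM.map (sigma_mem_moves j)) h1)
  rwa [H.sigma_sigma] at h2

end Regularity

/-! ### Roots as exponent vectors, and the weight θ -/

section RootLattice

variable {ι V V' : Type*} [AddCommGroup V] [Module ℝ V] [AddCommGroup V'] [Module ℝ V']
  {P : RootPairing ι ℝ V V'} [P.IsRootSystem] (b : P.Base)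

/-- The vector `∑ k_j α_j`. -/
def latVec (k : b.support → ℤ) : V := ∑ j, (k j : ℝ) • P.root j

/-- The coordinates of a root with respect to the simple roots. -/
def coord (i : ι) (j : b.support) : ℤ := b.toWeightBasisInt.repr (P.rootSpanMem ℤ i) j

lemma latVec_eq (k : b.support → ℤ) :
    latVec b k = b.toWeightBasis.equivFun.symm fun j => (k j : ℝ) := by
  simp [latVec, Basis.equivFun_symm_apply]

lemma latVec_injective : Function.Injective (latVec b) := by
  intro k m h
  rw [latVec_eq, latVec_eq] at h
  funext j
  have := congrFun (b.toWeightBasis.equivFun.symm.injective h) j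
  exact_mod_cast this

lemma latVec_coord (i : ι) : latVec b (coord b i) = P.root i := by
  have h := congrArg (P.rootSpan ℤ).subtype (b.toWeightBasisInt.sum_repr (P.rootSpanMem ℤ i))
  rw [map_sum] at h
  rw [latVec]
  convert! h using 1
  refine Finset.sum_congr rfl fun j _ => ?_
  rw [map_smul, Submodule.subtype_apply, b.coe_toWeightBasisInt_apply, Int.cast_smul_eq_zsmul]
  rfl

lemma latVec_add (k m : b.support → ℤ) : latVec b (k + m) = latVec b k + latVec b m := by
  simp [latVec, add_smul, Finset.sum_add_distrib]

lemma latVec_smul (c : ℤ) (k : b.support → ℤ) : latVec b (c • k) = (c : ℝ) • latVec b k := by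
  simp [latVec, mul_smul, Finset.smul_sum]

lemma latVec_single [DecidableEq b.support] (i : b.support) : latVec b (Pi.single i 1) = P.root i := by
  rw [latVec, Finset.sum_eq_single i]
  · simp
  · intro j _ hj; simp [hj]
  · simp

lemma coord_simple [DecidableEq b.support] (i : b.support) : coord b (i : ι) = Pi.single i 1 :=
  latVec_injective b (by rw [latVec_coord, latVec_single])

lemma coord_ne_zero (i : ι) : coord b i ≠ 0 := by
  intro h
  have h1 := latVec_coord b i
  rw [h] at h1
  exact P.ne_zero i (by rw [← h1]; simp [latVec])

lemma height_eq_sum_coord (i : ι) : b.height i = ∑ j, coord b i j := by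
  classical
  have h : P.root i = ∑ j ∈ b.support,
      (fun j => if h : j ∈ b.support then coord b i ⟨j, h⟩ else 0) j • P.root j := by
    rw [← Finset.sum_coe_sort]
    simp only [Finset.coe_mem, dite_true, Subtype.coe_eta]
    simpa only [latVec, Int.cast_smul_eq_zsmul] using (latVec_coord b i).symm
  rw [b.height_eq_sum h, ← Finset.sum_coe_sort]
  simp

lemma coord_nonneg {i : ι} (hi : b.IsPos i) (j : b.support) : 0 ≤ coord b i j := by
  classical
  obtain ⟨f, -, h | h⟩ := b.exists_root_eq_sum_nat_or_neg i
  · have : coord b i = fun j : b.support => (f j : ℤ) := by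
      apply latVec_injective b
      rw [latVec_coord, h, ← Finset.sum_coe_sort, latVec]
      simp [Nat.cast_smul_eq_nsmul]
    rw [this]
    exact Int.natCast_nonneg _
  · have : coord b i = fun j : b.support => -(f j : ℤ) := by
      apply latVec_injective b
      rw [latVec_coord, h, ← Finset.sum_coe_sort, latVec]
      simp [Nat.cast_smul_eq_nsmul]
    have h1 : 0 < b.height i := hi
    rw [height_eq_sum_coord, this] at h1
    have h2 : ∑ j : b.support, -(f j : ℤ) ≤ 0 := Finset.sum_nonpos fun j _ => by simp
    exact absurd h1 (not_lt.2 h2)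

section Functional

variable (n : b.support → ℝ)

/-- The linear form with prescribed values on the simple roots. -/
def form : V →ₗ[ℝ] ℝ := b.toWeightBasis.constr ℝ n

lemma form_root (j : b.support) : form b n (P.root j) = n j := by
  rw [← b.toWeightBasis_apply, form, Basis.constr_basis]

lemma form_latVec (k : b.support → ℤ) : form b n (latVec b k) = wt n k := by
  simp [latVec, wt, form_root, mul_comm]

end Functional

/-- The pairing l_i + 1 of θ with the simple coroot matches the exponent of y_i in the coefficients
of `sop`. -/
lemma reflection_theta (l : b.support → ℕ) (i : b.support) :
    P.reflection i (theta b l) = theta b l - ((l i + 1 : ℝ)) • P.root i := by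
  rw [P.reflection_apply]
  congr 2
  classical
  change P.toLinearMap (theta b l) (P.coroot i) = _
  simp only [theta, map_add, map_sum, map_smul, LinearMap.add_apply, LinearMap.coe_sum,
    Finset.sum_apply, LinearMap.smul_apply, fundWeight_coroot, Finsupp.single_apply, smul_eq_mul]
  simp [add_comm]

variable [Finite ι] [P.IsCrystallographic] [P.IsReduced]

lemma mem_posRoots {i : ι} : i ∈ posRoots b ↔ b.IsPos i := by
  simp [posRoots]

variable {b} (hsl : b.cartanMatrix.IsSimplyLaced)
include hsl

/-- Being simply laced enters here: off the diagonal the Cartan integers are -1 on edges and 0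
elsewhere. -/
lemma latVec_refl (i : b.support) (k : b.support → ℤ) :
    latVec b (refl (dynkinGraph b) i k) = P.reflection i (latVec b k) := by
  classical
  have h : P.reflection i (latVec b k) =
      latVec b k - (∑ j, (k j : ℝ) * P.pairingIn ℤ j i) • P.root i := by
    rw [latVec, map_sum, Finset.sum_smul, ← Finset.sum_sub_distrib]
    refine Finset.sum_congr rfl fun j _ => ?_
    rw [map_smul, P.reflection_apply_root' ℤ, smul_sub, mul_smul,
      Int.cast_smul_eq_zsmul ℝ (P.pairingIn ℤ j i)]
  have h2 : (pair (dynkinGraph b) i k : ℝ) = ∑ j, (k j : ℝ) * P.pairingIn ℤ j i := by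
    rw [← Finset.add_sum_erase _ _ (Finset.mem_univ i), RootPairing.pairingIn_same, pair,
      ← Finset.add_sum_erase (a := i) Finset.univ (fun j => if (dynkinGraph b).Adj i j then k j else 0)
        (Finset.mem_univ i), if_neg ((dynkinGraph b).loopless.irrefl i), zero_add]
    push_cast
    rw [sub_eq_add_neg, mul_comm, ← Finset.sum_neg_distrib]
    congr 1
    refine Finset.sum_congr rfl fun j hj => ?_
    by_cases hadj : (dynkinGraph b).Adj i j
    · rw [if_pos hadj, pairing_of_adj hsl hadj.symm]
      simp
    · rw [if_neg hadj, pairing_of_not_adj (Finset.ne_of_mem_erase hj) fun h => hadj h.symm]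
      simp
  rw [h, ← h2, refl, latVec_add, latVec_smul, latVec_single, sub_eq_add_neg, ← neg_smul]
  push_cast
  rfl

lemma coord_reflectionPerm (i : b.support) (j : ι) :
    coord b (P.reflectionPerm i j) = refl (dynkinGraph b) i (coord b j) :=
  latVec_injective b (by rw [latVec_coord, latVec_refl hsl, latVec_coord, P.root_reflectionPerm])

omit hsl in
-- In a reduced system the only roots proportional to α_i are ±α_i.
lemma exists_coord_ne_zero {i : b.support} {j : ι} (h1 : P.root j ≠ P.root i)
    (h2 : P.root j ≠ -P.root i) : ∃ k, k ≠ i ∧ coord b j k ≠ 0 := by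
  classical
  by_contra! h
  have hji : j ≠ i := fun h => h1 (by rw [h])
  have h3 : P.root j = (coord b j i : ℝ) • P.root i := by
    rw [← latVec_coord b j, latVec, Finset.sum_eq_single i]
    · intro k _ hk; simp [h k hk]
    · simp
  have h4 := RootPairing.IsReduced.linearIndependent P hji h2
  rw [LinearIndependent.pair_iff] at h4
  have := (h4 (-1) (coord b j i) (by rw [← h3]; module)).1
  norm_num at this

lemma isRootSet_coord : IsRootSet (dynkinGraph b) (Set.range (coord b)) where
  refl_mem := by
    rintro _ i ⟨j, rfl⟩
    exact ⟨P.reflectionPerm i j, coord_reflectionPerm hsl i j⟩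
  single_mem i := by
    classical
    exact ⟨i, by convert coord_simple b i⟩
  eq_or := by
    classical
    rintro _ i ⟨j, rfl⟩
    by_cases h1 : P.root j = P.root i
    · right; left
      rw [P.root.injective h1]
      convert coord_simple b i
    by_cases h2 : P.root j = -P.root i
    · right; right
      apply latVec_injective b
      rw [latVec_coord, ← neg_one_smul ℤ, latVec_smul, latVec_single, h2]
      simp
    · exact Or.inl (exists_coord_ne_zero h1 h2)

lemma form_reflWt (n : b.support → ℝ) (i : b.support) (v : V) :
    form b (reflWt (dynkinGraph b) n i) v = form b n (P.reflection i v) := by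
  classical
  have h : form b (reflWt (dynkinGraph b) n i) = form b n ∘ₗ (P.reflection i).toLinearMap := by
    refine b.toWeightBasis.ext fun j => ?_
    rw [b.toWeightBasis_apply, form_root, reflWt, ← form_latVec, latVec_refl hsl, latVec_single]
    rfl
  exact DFunLike.congr_fun h v

/-- Each step w ↦ w σ_i that lengthens w adds (l_i + 1) wα_i with wα_i positive, so θ - wθ is a
nonnegative combination of simple roots. -/
lemma form_theta_sub_nonneg {n : b.support → ℝ} (hn : ∀ j, 0 ≤ n j) (l : b.support → ℕ)
    (w : P.weylGroup) : 0 ≤ form b n (theta b l - w • theta b l) := by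
  induction w using weylGroup_induction hsl with
  | one => simp
  | mul w i hi ih =>
    have h : theta b l - (w * simpleRefl b i) • theta b l =
        (theta b l - w • theta b l) + (l i + 1 : ℝ) • P.root (P.weylGroupToPerm w i) := by
      rw [mul_smul, simpleRefl, ofIdx_smul_vec, reflection_theta, ← P.weylGroup_apply_root]
      rw [smul_sub, smul_comm]
      abel
    rw [h, map_add, map_smul, ← latVec_coord b (P.weylGroupToPerm w i), form_latVec]
    refine add_nonneg ih (smul_nonneg (by positivity) (Finset.sum_nonneg fun j _ => ?_))
    exact mul_nonneg (hn j) (by exact_mod_cast coord_nonneg b hi j)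

end RootLattice

/-! ### The products Δ and D, and the summands of the average -/

section Kernels

variable {ι V V' : Type*} [AddCommGroup V] [Module ℝ V] [AddCommGroup V'] [Module ℝ V']
  {P : RootPairing ι ℝ V V'} [P.IsRootSystem] [Finite ι] [P.IsCrystallographic] [P.IsReduced]
  {b : P.Base}
  {F : Type*} [Field F] [Algebra ℂ F] [Algebra (MvPolynomial b.support ℂ) F]
  [IsScalarTower ℂ (MvPolynomial b.support ℂ) F] [IsFractionRing (MvPolynomial b.support ℂ) F]
  {a : ℂ} {σ ε : b.support → F →ₐ[ℂ] F}

variable (F b a) in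
/-- The product `Δ` in terms of the variables `y_j`. -/
def deltaY : F := ∏ β ∈ posRoots b, (1 - ymon F a ((2 : ℤ) • coord b β))

variable (F b a) in
/-- The product `D` in terms of the variables `y_j`. -/
def denomY : F := ∏ β ∈ posRoots b, (1 - cst F (a ^ 2)⁻¹ * ymon F a ((2 : ℤ) • coord b β))

variable (F b a) in
/-- The product `Δ` without the factor of a simple root. -/
def deltaErase (i : b.support) : F :=
  open scoped Classical in
  ∏ β ∈ (posRoots b).erase i, (1 - ymon F a ((2 : ℤ) • coord b β))

lemma simple_mem_posRoots (i : b.support) : (i : ι) ∈ posRoots b :=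
  (mem_posRoots b).2 (b.isPos_of_mem_support i.2)

lemma two_smul_coord_ne_zero (β : ι) : (2 : ℤ) • coord b β ≠ 0 :=
  smul_ne_zero two_ne_zero (coord_ne_zero b β)

lemma ymon_two_simple (i : b.support) :
    ymon F a ((2 : ℤ) • coord b (i : ι)) = yvar F a i ^ 2 := by
  classical
  rw [coord_simple, ymon_smul]
  simp only [ymon, zpow_two, pow_two]
  congr 1 <;>
  · rw [Finset.prod_eq_single i]
    · simp
    · intro j _ hj; simp [hj]
    · simp

lemma deltaY_eq (i : b.support) : deltaY b F a = (1 - yvar F a i ^ 2) * deltaErase b F a i := by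
  classical
  rw [deltaY, ← Finset.mul_prod_erase _ _ (simple_mem_posRoots i), ymon_two_simple, deltaErase]

variable (H : IsReflData F (dynkinGraph b) a σ ε)

include H in
lemma one_sub_ymon_ne_zero (β : ι) : (1 - ymon F a ((2 : ℤ) • coord b β)) ≠ 0 := by
  have := cst_sub_ne_zero (F := F) H.ne_zero (z := 1) (u := 1) (Or.inl one_ne_zero)
    (two_smul_coord_ne_zero (b := b) β)
  rwa [cst_one, one_mul] at this

include H in
lemma deltaY_ne_zero : deltaY b F a ≠ 0 :=
  Finset.prod_ne_zero_iff.2 fun β _ => one_sub_ymon_ne_zero H β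

include H in
lemma denomY_ne_zero : denomY b F a ≠ 0 :=
  Finset.prod_ne_zero_iff.2 fun β _ => by
    have := cst_sub_ne_zero (F := F) H.ne_zero (z := 1) (u := (a ^ 2)⁻¹) (Or.inl one_ne_zero)
      (two_smul_coord_ne_zero (b := b) β)
    rwa [cst_one] at this

include H in
-- A nonzero constant in front of y^{2β} does not change the value min(0, ·) of a factor.
lemma val_denomY (n : b.support → ℝ) : val F n (denomY b F a) = val F n (deltaY b F a) := by
  classical
  rw [denomY, deltaY]
  induction posRoots b using Finset.induction_on with
  | empty => rfl
  | insert β s hβ ih =>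
    rw [Finset.prod_insert hβ, Finset.prod_insert hβ, AddValuation.map_mul, AddValuation.map_mul,
      ih]
    have h1 := val_cst_sub (F := F) H.ne_zero n (z := 1) (u := (a ^ 2)⁻¹) one_ne_zero
      (inv_ne_zero (pow_ne_zero _ H.ne_zero)) (two_smul_coord_ne_zero (b := b) β)
    have h2 := val_cst_sub (F := F) H.ne_zero n (z := 1) (u := 1) one_ne_zero
      one_ne_zero (two_smul_coord_ne_zero (b := b) β)
    rw [cst_one] at h1
    rw [cst_one, one_mul] at h2
    rw [h1, h2]

include H in
lemma eps_deltaY (i : b.support) : ε i (deltaY b F a) = deltaY b F a := by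
  rw [deltaY, map_prod]
  exact Finset.prod_congr rfl fun β _ => by rw [map_sub, map_one, H.eps_ymon_two]

lemma reflectionPerm_mem_erase [DecidableEq ι] (i : b.support) {β : ι}
    (hβ : β ∈ (posRoots b).erase i) : P.reflectionPerm i β ∈ (posRoots b).erase i := by
  rw [Finset.mem_erase, mem_posRoots] at hβ ⊢
  have h := hβ.2.reflectionPerm i.2 hβ.1
  refine ⟨fun h' => ?_, h⟩
  refine not_isPos_of_root_eq_neg ?_ (b.isPos_of_mem_support i.2) hβ.2
  have h2 := congrArg (P.reflectionPerm i) h'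
  rw [RootPairing.reflectionPerm_self] at h2
  rw [h2, P.root_reflectionPerm, P.reflection_apply_self]

include H in
-- The reflection permutes the positive roots other than α_i, and 1 - y_i² becomes 1 - y_i⁻² =
-- -y_i⁻² (1 - y_i²).
lemma sigma_deltaY (hsl : b.cartanMatrix.IsSimplyLaced) (i : b.support) :
    -(yvar F a i ^ 2) * σ i (deltaY b F a) = deltaY b F a := by
  classical
  have h1 : σ i (deltaErase b F a i) = deltaErase b F a i := by
    rw [deltaErase, map_prod]
    refine Finset.prod_equiv (P.reflectionPerm i) (fun β => ⟨fun h => ?_, fun h => ?_⟩)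
      fun β _ => ?_
    · convert reflectionPerm_mem_erase i (by convert h)
    · have := reflectionPerm_mem_erase i (by convert h)
      rw [RootPairing.reflectionPerm_self] at this
      convert this
    · rw [map_sub, map_one, ymon_smul, map_zpow₀, H.sigma_ymon, ← ymon_smul,
        coord_reflectionPerm hsl]
  have hy := H.y_ne_zero i
  rw [deltaY_eq i, map_mul, h1, map_sub, map_one, map_pow, H.sigma_self]
  field_simp
  ring

section Construction

variable (hsl : b.cartanMatrix.IsSimplyLaced)
include H hsl

/-- A right action is a homomorphism to the opposite monoid. -/
lemma exists_substitutions : ∃ φ : P.weylGroup →* (F →ₐ[ℂ] F)ᵐᵒᵖ,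
    ∀ i, φ (simpleRefl b i) = MulOpposite.op (σ i) := by
  refine exists_weylGroup_lift hsl (fun i => MulOpposite.op (σ i)) (fun i => ?_)
    (fun i j hij h => ?_) (fun i j h => ?_) <;>
  · simp only [← MulOpposite.op_mul, ← MulOpposite.op_one]
    congr 1
    ext f
    first
    | exact H.sigma_sigma i f
    | exact H.sigma_comm hij.symm (fun h' => h h'.symm) f
    | exact H.sigma_braid h f

lemma exists_twisted_action (l : b.support → ℕ) :
    ∃ ψ : P.weylGroup →* (Function.End F)ᵐᵒᵖ,
      ∀ i, ψ (simpleRefl b i) = MulOpposite.op (twist a σ ε l i) := by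
  refine exists_weylGroup_lift hsl (G := (Function.End F)ᵐᵒᵖ)
    (fun i => MulOpposite.op (twist a σ ε l i)) (fun i => ?_)
    (fun i j hij h => ?_) (fun i j h => ?_)
  · exact congrArg (MulOpposite.op (α := Function.End F)) (funext fun f => twist_twist H l i f)
  · exact congrArg (MulOpposite.op (α := Function.End F))
      (funext fun f => twist_comm H l hij.symm (fun h' => h h'.symm) f)
  · exact congrArg (MulOpposite.op (α := Function.End F)) (funext fun f => twist_braid H l h f)

variable {φ : P.weylGroup →* (F →ₐ[ℂ] F)ᵐᵒᵖ} (hφ : ∀ i, φ (simpleRefl b i) = MulOpposite.op (σ i))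
include hφ

omit H hsl in
lemma substitution_mul (w : P.weylGroup) (i : b.support) (f : F) :
    (φ (w * simpleRefl b i)).unop f = σ i ((φ w).unop f) := by
  rw [map_mul, hφ, MulOpposite.unop_mul, MulOpposite.unop_op, AlgHom.mul_apply]

/-- The induction is over all i at once, since moving ε_i past σ_j can bring in ε_j. -/
lemma eps_substitution (w : P.weylGroup) (i : b.support) :
    ε i ((φ w).unop (deltaY b F a)) = (φ w).unop (deltaY b F a) := by
  induction w using weylGroup_induction hsl generalizing i with
  | one =>
    rw [map_one]
    exact eps_deltaY H i
  | mul w j _ ih =>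
    rw [substitution_mul hφ]
    by_cases h : (dynkinGraph b).Adj j i
    · rw [H.eps_sigma_adj h, ih i, ih j]
    · rw [H.eps_sigma_not_adj h, ih i]

/-- The ratio Δ(x) / Δ(wx) is invariant under ε_i, so it passes through the operator as a scalar
transformed by σ_i; the factor -y_i² is the one picked up by Δ. -/
lemma kernel_mul {l : b.support → ℕ} {ψ : P.weylGroup →* (Function.End F)ᵐᵒᵖ}
    (hψ : ∀ i, ψ (simpleRefl b i) = MulOpposite.op (twist a σ ε l i)) (w : P.weylGroup)
    (i : b.support) :
    deltaY b F a / (φ (w * simpleRefl b i)).unop (deltaY b F a) *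
        (ψ (w * simpleRefl b i)).unop 1 =
      sop a σ ε l i (deltaY b F a / (φ w).unop (deltaY b F a) * (ψ w).unop 1) := by
  have h1 : (ψ (w * simpleRefl b i)).unop 1 = twist a σ ε l i ((ψ w).unop 1) := by
    rw [map_mul, hψ]
    rfl
  rw [h1, substitution_mul hφ, sop_mul H, sop, map_div₀]
  · nth_rewrite 1 [← sigma_deltaY H hsl i]
    ring
  · rw [map_div₀, eps_deltaY H, eps_substitution H hsl hφ]

end Construction

end Kernels

/-! ### The average: cancellation of denominators and support of the numerator -/

section Average

variable {ι V V' : Type*} [AddCommGroup V] [Module ℝ V] [AddCommGroup V'] [Module ℝ V']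
  {P : RootPairing ι ℝ V V'} [P.IsRootSystem] [Finite ι] [P.IsCrystallographic] [P.IsReduced]
  {b : P.Base}

/-- A point is in the permutahedron when every linear form is bounded below on it by a vertex. -/
lemma mem_permutahedron {l : b.support → ℕ} {v : V}
    (h : ∀ n : b.support → ℝ, ∃ w : P.weylGroup,
      form b n (theta b l - w • theta b l) ≤ form b n v) : v ∈ permutahedron b l := by
  classical
  -- V carries no topology, so the separation theorem is applied in coordinates.
  set e := b.toWeightBasis.equivFun
  set S : Set V := Set.range fun w : P.weylGroup => theta b l - w • theta b l
  have hS : (e.toLinearMap '' S).Finite := (Set.finite_range _).image _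
  suffices e v ∈ convexHull ℝ (e.toLinearMap '' S) by
    rw [← LinearMap.image_convexHull] at this
    obtain ⟨u, hu, he⟩ := this
    rwa [← e.injective he]
  by_contra hv
  obtain ⟨f, u, hu, hfu⟩ := geometric_hahn_banach_point_closed (convex_convexHull ℝ _)
    (hS.isCompact_convexHull ℝ).isClosed hv
  have hf (x : V) : f (e x) = form b (fun j => f (Pi.single j 1)) x := by
    have h1 : (f : (b.support → ℝ) →ₗ[ℝ] ℝ) ∘ₗ e.toLinearMap =
        form b (fun j => f (Pi.single j 1)) := by
      refine b.toWeightBasis.ext fun j => ?_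
      rw [b.toWeightBasis_apply, form_root, ← b.toWeightBasis_apply]
      have h2 : e (b.toWeightBasis j) = Pi.single j 1 := by
        funext k
        simp [e, Pi.single_apply, Finsupp.single_apply, eq_comm]
      exact congrArg f h2
    exact DFunLike.congr_fun h1 x
  obtain ⟨w, hw⟩ := h fun j => f (Pi.single j 1)
  rw [← hf, ← hf] at hw
  have := hfu _ (subset_convexHull ℝ _ (Set.mem_image_of_mem _ ⟨w, rfl⟩))
  simp only [LinearEquiv.coe_coe] at this
  linarith

variable {F : Type*} [Field F] [Algebra ℂ F] [Algebra (MvPolynomial b.support ℂ) F]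
  [IsScalarTower ℂ (MvPolynomial b.support ℂ) F] [IsFractionRing (MvPolynomial b.support ℂ) F]
  {a : ℂ} {σ ε : b.support → F →ₐ[ℂ] F} (H : IsReflData F (dynkinGraph b) a σ ε)
  (hsl : b.cartanMatrix.IsSimplyLaced)
include H hsl

/-- Every positive root comes from a simple one by simple reflections, and removability follows
along. -/
lemma removable_coord {β : ι} (hβ : b.IsPos β) : Removable F a σ ε (coord b β) := by
  classical
  refine hβ.induction_on_reflect (p := fun β => Removable F a σ ε (coord b β)) (fun β hβ => ?_)
    fun β γ hβ hγ => ?_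
  · have h := removable_single H (⟨β, hβ⟩ : b.support)
    convert h
    convert coord_simple b ⟨β, hβ⟩
  · have h := Removable.refl H (⟨γ, hγ⟩ : b.support) hβ
    rwa [← coord_reflectionPerm hsl] at h

lemma mem_laurent_of_mul_deltaY {M : F} (hM : Good a σ ε M)
    (h : M * deltaY b F a ∈ laurent b.support F a) : M ∈ laurent b.support F a := by
  classical
  have key : ∀ s : Finset ι, (∀ β ∈ s, b.IsPos β) →
      M * ∏ β ∈ s, (1 - ymon F a ((2 : ℤ) • coord b β)) ∈ laurent b.support F a →
      M ∈ laurent b.support F a := by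
    intro s
    induction s using Finset.induction_on with
    | empty =>
      intro _ h
      simpa using h
    | insert β s hβ ih =>
      intro hs hm
      refine ih (fun γ hγ => hs γ (Finset.mem_insert_of_mem hγ)) ?_
      refine removable_coord H hsl (hs β (Finset.mem_insert_self β s)) _
        (hM.mul (good_of_mem_laurent H (prod_mem fun γ _ =>
          sub_mem (one_mem _) (ymon_mem_laurent _)))) ?_
      rw [Finset.prod_insert hβ] at hm
      convert! hm using 1
      ring
  exact key _ (fun β hβ => (mem_posRoots b).1 hβ) h

variable {l : b.support → ℕ} {K : P.weylGroup → F} (hK1 : K 1 = 1)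
  (hK : ∀ w i, K (w * simpleRefl b i) = sop a σ ε l i (K w))
include hK1 hK

/-- The poles of K(w) are indexed by inversions of w, so each factor of D is needed at most once.
When w is lengthened by σ_i, the old inversions are reflected and α_i is added for the new pole. -/
lemma denomY_mul_kernel_mem_laurent (w : P.weylGroup) :
    denomY b F a * K w ∈ laurent b.support F a := by
  classical
  suffices ∃ s : Finset ι, (∀ β ∈ s, b.IsPos β ∧ ¬ b.IsPos (P.weylGroupToPerm w β)) ∧
      (∏ β ∈ s, (1 - cst F (a ^ 2)⁻¹ * ymon F a ((2 : ℤ) • coord b β))) * K w ∈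
        laurent b.support F a by
    obtain ⟨s, hs, h⟩ := this
    have hsub : s ⊆ posRoots b := fun β hβ => (mem_posRoots b).2 (hs β hβ).1
    rw [denomY, ← Finset.prod_sdiff hsub, mul_assoc]
    exact mul_mem (prod_mem fun β _ => sub_mem (one_mem _)
      (mul_mem (cst_mem_laurent _) (ymon_mem_laurent _))) h
  induction w using weylGroup_induction hsl with
  | one => exact ⟨∅, by simp, by simp [hK1, one_mem]⟩
  | mul w i hi ih =>
    obtain ⟨s, hs, h⟩ := ih
    have hperm (β : ι) : P.weylGroupToPerm (w * simpleRefl b i) β =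
        P.weylGroupToPerm w (P.reflectionPerm i β) := by
      rw [map_mul, Equiv.Perm.mul_apply, weylGroupToPerm_simpleRefl]
    have hroot : P.root (P.weylGroupToPerm w (P.reflectionPerm i i)) =
        -P.root (P.weylGroupToPerm w i) := by
      rw [← P.weylGroup_apply_root, ← P.weylGroup_apply_root, P.root_reflectionPerm,
        P.reflection_apply_self, smul_neg]
    -- The new factor is not yet present: if α_i were a reflected inversion, the inversion would be
    -- -α_i, which is not positive.
    have hnot : (i : ι) ∉ s.map (P.reflectionPerm i).toEmbedding := by
      intro hmem
      obtain ⟨β, hβ, e⟩ := Finset.mem_map.1 hmem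
      have e2 := congrArg (P.reflectionPerm i) (show P.reflectionPerm i β = i from e)
      rw [RootPairing.reflectionPerm_self] at e2
      refine not_isPos_of_root_eq_neg ?_ (b.isPos_of_mem_support i.2) (hs β hβ).1
      rw [e2, P.root_reflectionPerm, P.reflection_apply_self]
    refine ⟨insert (i : ι) (s.map (P.reflectionPerm i).toEmbedding), ?_, ?_⟩
    · intro β hβ
      rcases Finset.mem_insert.1 hβ with rfl | hβ
      · refine ⟨b.isPos_of_mem_support i.2, ?_⟩
        rw [hperm]
        exact not_isPos_of_root_eq_neg hroot hi
      · obtain ⟨γ, hγ, rfl⟩ := Finset.mem_map.1 hβ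
        obtain ⟨h1, h2⟩ := hs γ hγ
        have hne : γ ≠ i := by
          rintro rfl
          exact h2 hi
        refine ⟨h1.reflectionPerm i.2 hne, ?_⟩
        rw [hperm]
        simpa using h2
    · have hε : ε i (∏ β ∈ s, (1 - cst F (a ^ 2)⁻¹ * ymon F a ((2 : ℤ) • coord b β))) =
          ∏ β ∈ s, (1 - cst F (a ^ 2)⁻¹ * ymon F a ((2 : ℤ) • coord b β)) := by
        rw [map_prod]
        exact Finset.prod_congr rfl fun β _ => by
          rw [map_sub, map_one, map_mul, AlgHom.commutes, H.eps_ymon_two]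
      have h1 := mul_sop_mem_laurent H l i h
      rw [sop_mul H l i hε, ← hK, ← mul_assoc, map_prod] at h1
      rw [Finset.prod_insert hnot, Finset.prod_map, ymon_two_simple]
      convert! h1 using 4 with β
      rw [map_sub, map_one, map_mul, AlgHom.commutes, ymon_smul, ymon_smul, map_zpow₀,
        H.sigma_ymon, ← coord_reflectionPerm hsl]
      rfl

/-- The inverse appears because the newest reflection acts outermost: θ - (wσ_i)⁻¹θ = (l_i + 1) α_i
+ σ_i(θ - w⁻¹θ), which is the shift and reflection of `le_val_sop`. -/
lemma le_val_kernel (n : b.support → ℝ) (w : P.weylGroup) :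
    (form b n (theta b l - w⁻¹ • theta b l) : WithTop ℝ) ≤ val F n (K w) := by
  induction w using weylGroup_induction hsl generalizing n with
  | one => simp [hK1]
  | mul w i _ ih =>
    rw [hK]
    refine le_trans ?_ (le_val_sop H n l i (K w))
    refine le_trans (le_of_eq ?_) (add_le_add le_rfl (ih _))
    rw [form_reflWt hsl, ← WithTop.coe_add]
    congr 1
    have h : theta b l - (w * simpleRefl b i)⁻¹ • theta b l = (l i + 1 : ℝ) • P.root i +
        P.reflection i (theta b l - w⁻¹ • theta b l) := by
      have e : (simpleRefl b i)⁻¹ = simpleRefl b i := inv_eq_of_mul_eq_one_left (ofIdx_mul_self _)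
      rw [mul_inv_rev, mul_smul, e, simpleRefl, ofIdx_smul_vec, map_sub, reflection_theta]
      abel
    rw [h, map_add, map_smul, form_root]
    rfl

variable (ha1 : a ^ 2 ≠ 1)
include ha1

lemma good_kernel (w : P.weylGroup) : Good a σ ε (K w) := by
  induction w using weylGroup_induction hsl with
  | one => rw [hK1]; exact Good.one
  | mul w i _ ih =>
    rw [hK]
    exact Good.sop H (isRootSet_coord hsl) ha1 l i ih

omit hK1 ha1 hsl in
-- Right multiplication by σ_i permutes W.
lemma sop_sum_kernel [Fintype P.weylGroup] (i : b.support) :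
    sop a σ ε l i (∑ w, K w) = ∑ w, K w := by
  rw [sop_eq H.ne_zero, map_sum, map_sum, map_sum, Finset.mul_sum, Finset.mul_sum,
    ← Finset.sum_add_distrib]
  simp only [← sop_eq H.ne_zero, ← hK]
  exact Fintype.sum_equiv (Equiv.mulRight (simpleRefl b i)) _ _ fun _ => rfl

/-- The sum vanishes on x_i = s / a, and Δ has only a simple zero there: 1 - y_i² contains x_i - s /
a once, and every other positive root involves another variable. -/
lemma reg_sum_kernel_div [Fintype P.weylGroup] (i : b.support) (s : ℂ) (hs : s = 1 ∨ s = -1) :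
    Reg i (s * a⁻¹) ((∑ w, K w) / deltaY b F a) := by
  classical
  have ha := H.ne_zero
  have hc := sign_mul_inv_ne_zero H hs
  have hgood : Good a σ ε (∑ w, K w) := Good.sum _ fun w _ => good_kernel H hsl hK1 hK ha1 w
  have hv := van_of_sop_eq H (isRootSet_coord hsl) ha1 l i hgood (sop_sum_kernel H hK i) hs
  have hs2 : s * s = 1 := by rcases hs with rfl | rfl <;> norm_num
  have e1 : 1 - yvar F a i ^ 2 = (var F i - cst F (s * a⁻¹)) *
      (cst F (-a ^ 2) * (cst F (s * a⁻¹) - cst F (-a⁻¹) * yvar F a i ^ (1 : ℤ))) := by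
    have h1 := cst_ne_zero (F := F) ha
    have h2 : cst F s * cst F s = 1 := by rw [← map_mul, hs2, map_one]
    rw [zpow_one, yvar]
    simp only [cst, map_mul, map_neg, map_inv₀, map_pow] at h1 h2 ⊢
    field_simp
    linear_combination -h2
  have n1 : ¬ Van i (s * a⁻¹) (cst F (s * a⁻¹) - cst F (-a⁻¹) * yvar F a i ^ (1 : ℤ)) := by
    refine not_van_cst_sub_single ha hc ?_
    rw [zpow_one]
    have : s * a⁻¹ - -a⁻¹ * (a * (s * a⁻¹)) = 2 * (s * a⁻¹) := by field_simp; ring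
    rw [this]
    exact mul_ne_zero two_ne_zero hc
  have r1 : Reg i (s * a⁻¹) (cst F (s * a⁻¹) - cst F (-a⁻¹) * yvar F a i ^ (1 : ℤ)) := by
    refine reg_of_mem_laurent (a := a) hc ?_
    rw [zpow_one]
    exact sub_mem (cst_mem_laurent _) (mul_mem (cst_mem_laurent _) (yvar_mem_laurent _))
  have n2 : Reg i (s * a⁻¹) (deltaErase b F a i) ∧ ¬ Van i (s * a⁻¹) (deltaErase b F a i) := by
    have key : ∀ t : Finset ι, (∀ β ∈ t, b.IsPos β ∧ β ≠ i) →
        Reg i (s * a⁻¹) (∏ β ∈ t, (1 - ymon F a ((2 : ℤ) • coord b β))) ∧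
        ¬ Van i (s * a⁻¹) (∏ β ∈ t, (1 - ymon F a ((2 : ℤ) • coord b β))) := by
      intro t
      induction t using Finset.induction_on with
      | empty =>
        intro _
        rw [Finset.prod_empty, ← cst_one]
        exact ⟨reg_cst 1, not_van_cst one_ne_zero⟩
      | insert β t hβ ih =>
        intro ht
        obtain ⟨h1, h2⟩ := ih fun γ hγ => ht γ (Finset.mem_insert_of_mem hγ)
        obtain ⟨hp, hne⟩ := ht β (Finset.mem_insert_self β t)
        obtain ⟨j, hji, hj⟩ := exists_coord_ne_zero (b := b) (i := i) (j := β)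
          (fun h => hne (P.root.injective h))
          fun h => not_isPos_of_root_eq_neg h (b.isPos_of_mem_support i.2) hp
        have h3 : ¬ Van i (s * a⁻¹) (cst F 1 - cst F 1 * ymon F a ((2 : ℤ) • coord b β)) :=
          not_van_cst_sub ha hc one_ne_zero hji (by simpa using hj)
        rw [cst_one, one_mul] at h3
        have h4 : Reg i (s * a⁻¹) (1 - ymon F a ((2 : ℤ) • coord b β)) :=
          reg_of_mem_laurent (a := a) hc (sub_mem (one_mem _) (ymon_mem_laurent _))
        rw [Finset.prod_insert hβ]
        exact ⟨h4.mul h1, not_van_mul h4 h1 h3 h2⟩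
    refine key _ fun β hβ => ?_
    rw [Finset.mem_erase, mem_posRoots] at hβ
    exact hβ.symm
  have e2 : (∑ w, K w) / deltaY b F a = (∑ w, K w) / (var F i - cst F (s * a⁻¹)) *
      (cst F (-a ^ 2) * (cst F (s * a⁻¹) - cst F (-a⁻¹) * yvar F a i ^ (1 : ℤ)) *
        deltaErase b F a i)⁻¹ := by
    rw [deltaY_eq i, e1]
    simp only [div_eq_mul_inv, mul_inv, mul_assoc]
  rw [e2]
  exact hv.reg_div.mul ((((reg_cst _).mul r1).mul n2.1).inv
    (not_van_mul ((reg_cst _).mul r1) n2.1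
      (not_van_mul (reg_cst _) r1 (not_van_cst (by simpa using ha)) n1) n2.2))

/-- D f is good because f is invariant and regular along y_i = ±1, and D f Δ = ∑ D K(w) is Laurent;
so Δ can be cancelled. -/
lemma denomY_mul_mem_laurent [Fintype P.weylGroup] :
    denomY b F a * ((∑ w, K w) / deltaY b F a) ∈ laurent b.support F a := by
  have hΔ := deltaY_ne_zero H
  have htw (i : b.support) : twist a σ ε l i ((∑ w, K w) / deltaY b F a) =
      (∑ w, K w) / deltaY b F a := by
    have hy := H.y_ne_zero i
    have hε : ε i (deltaY b F a)⁻¹ = (deltaY b F a)⁻¹ := by rw [map_inv₀, eps_deltaY H]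
    have h1 := sigma_deltaY H hsl i
    rw [div_eq_inv_mul, twist_eq H.ne_zero, sop_mul H l i hε, sop_sum_kernel H hK, map_inv₀,
      ← mul_assoc]
    congr 1
    nth_rewrite 2 [← h1]
    rw [mul_inv, inv_neg]
  have hgood := good_of_twist_eq H (isRootSet_coord hsl) ha1 l htw
    (reg_sum_kernel_div H hsl hK1 hK ha1)
  have hden : denomY b F a ∈ laurent b.support F a := prod_mem fun β _ => sub_mem (one_mem _)
    (mul_mem (cst_mem_laurent _) (ymon_mem_laurent _))
  refine mem_laurent_of_mul_deltaY H hsl ((good_of_mem_laurent H hden).mul hgood) ?_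
  rw [mul_assoc, div_mul_cancel₀ _ hΔ, Finset.mul_sum]
  exact sum_mem fun w _ => denomY_mul_kernel_mem_laurent H hsl hK1 hK w

omit ha1 in
lemma exists_le_val [Fintype P.weylGroup] (n : b.support → ℝ) : ∃ w : P.weylGroup,
    (form b n (theta b l - w • theta b l) : WithTop ℝ) ≤
      val F n (denomY b F a * ((∑ w, K w) / deltaY b F a)) := by
  classical
  obtain ⟨w₀, -, hw₀⟩ := Finset.exists_min_image Finset.univ
    (fun w : P.weylGroup => form b n (theta b l - w • theta b l)) ⟨1, Finset.mem_univ 1⟩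
  refine ⟨w₀, ?_⟩
  have hsum : (form b n (theta b l - w₀ • theta b l) : WithTop ℝ) ≤ val F n (∑ w, K w) := by
    refine AddValuation.map_le_sum _ fun w _ => le_trans ?_ (le_val_kernel H hsl hK1 hK n w)
    exact_mod_cast hw₀ w⁻¹ (Finset.mem_univ _)
  have h1 : val F n (denomY b F a * ((∑ w, K w) / deltaY b F a)) = val F n (∑ w, K w) := by
    rw [AddValuation.map_mul, val_denomY H, ← AddValuation.map_mul,
      mul_div_cancel₀ _ (deltaY_ne_zero H)]
  rwa [h1]

/-- The numerator is a polynomial with support in the permutahedron. -/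
lemma exists_numerator [Fintype P.weylGroup] : ∃ N : MvPolynomial b.support ℂ,
    (deltaY b F a)⁻¹ * ∑ w, K w = algebraMap _ F N / denomY b F a ∧
    ∀ k ∈ N.support, ∑ j : b.support, k j • P.root j ∈ permutahedron b l := by
  classical
  set g := denomY b F a * ((∑ w, K w) / deltaY b F a) with hg
  obtain ⟨m, p, hp⟩ := exists_den_of_mem_laurent (denomY_mul_mem_laurent H hsl hK1 hK ha1)
  rw [← hg] at hp
  have hX : (∏ j, MvPolynomial.X j ^ m j : MvPolynomial b.support ℂ) =
      MvPolynomial.monomial (Finsupp.equivFunOnFinite.symm m) 1 := by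
    rw [MvPolynomial.monomial_eq, Finsupp.prod_fintype]
    · simp
    · simp
  rw [hX] at hp
  -- The polynomial p is the numerator times the clearing monomial x^m, so the bound on its
  -- exponents is shifted by the weight of m.
  have key : ∀ k ∈ p.support, ∀ n : b.support → ℝ, ∃ w : P.weylGroup,
      form b n (theta b l - w • theta b l) + wt n (fun j => m j) ≤ wt n fun j => k j := by
    intro k hk n
    obtain ⟨w, hw⟩ := exists_le_val H hsl hK1 hK n
    refine ⟨w, ?_⟩
    have h1 := val_algebraMap_le (F := F) n hk
    rw [← hp, AddValuation.map_mul] at h1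
    have h2 : val F n (algebraMap _ F (MvPolynomial.monomial (Finsupp.equivFunOnFinite.symm m)
        (1 : ℂ))) = wt n fun j => m j := by
      refine val_of_hahn_eq_single n ?_ ?_ (g := algebraMap _ F
        (MvPolynomial.monomial (Finsupp.equivFunOnFinite.symm m) (1 : ℂ)))
      · rw [Ne, FaithfulSMul.algebraMap_eq_zero_iff]
        simp
      · rw [hahn_algebraMap, hahnPoly_monomial]
        rfl
    rw [h2] at h1
    have h3 := (add_le_add hw le_rfl).trans h1
    exact_mod_cast h3
  have hdvd : MvPolynomial.monomial (Finsupp.equivFunOnFinite.symm m) (1 : ℂ) ∣ p := by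
    rw [MvPolynomial.monomial_one_dvd_iff_modMonomial_eq_zero]
    ext k
    rw [MvPolynomial.coeff_zero]
    by_cases hle : Finsupp.equivFunOnFinite.symm m ≤ k
    · exact MvPolynomial.coeff_modMonomial_of_le _ hle
    · rw [MvPolynomial.coeff_modMonomial_of_not_le _ hle]
      by_contra hk
      refine hle fun j => ?_
      -- The j-th coordinate form reads off the exponent of x_j, and it is nonnegative on θ - wθ;
      -- hence k_j ≥ m_j and x^m divides p.
      obtain ⟨w, hw⟩ := key k (MvPolynomial.mem_support_iff.2 hk) (Pi.single j 1)
      have h0 := form_theta_sub_nonneg hsl (n := Pi.single j 1)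
        (fun i => by by_cases h : i = j <;> simp [h]) l w
      simp only [wt, Pi.single_apply, ite_mul, one_mul, zero_mul, Finset.sum_ite_eq',
        Finset.mem_univ, if_true, Int.cast_natCast] at hw
      have h4 : (m j : ℝ) ≤ k j := by linarith
      exact_mod_cast h4
  obtain ⟨N, rfl⟩ := hdvd
  have hne : algebraMap _ F (MvPolynomial.monomial (Finsupp.equivFunOnFinite.symm m) (1 : ℂ)) ≠
      0 := by
    rw [Ne, FaithfulSMul.algebraMap_eq_zero_iff]
    simp
  have hN : algebraMap _ F N = g := by
    rw [map_mul, mul_comm] at hp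
    exact (mul_left_cancel₀ hne hp).symm
  refine ⟨N, ?_, fun k hk => ?_⟩
  · rw [hN, hg, mul_div_cancel_left₀ _ (denomY_ne_zero H), div_eq_inv_mul]
  · have e : ∑ j : b.support, k j • P.root j = latVec b fun j => k j := by
      simp [latVec, Nat.cast_smul_eq_nsmul]
    rw [e]
    refine mem_permutahedron fun n => ?_
    obtain ⟨w, hw⟩ := key (Finsupp.equivFunOnFinite.symm m + k) (by
      rw [MvPolynomial.mem_support_iff, MvPolynomial.coeff_monomial_mul, one_mul]
      exact MvPolynomial.mem_support_iff.1 hk) n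
    refine ⟨w, ?_⟩
    have h5 : (fun j => (((Finsupp.equivFunOnFinite.symm m + k) j : ℕ) : ℤ)) =
        (fun j => (m j : ℤ)) + fun j => (k j : ℤ) := by
      funext j
      simp
    rw [h5, wt_add] at hw
    rw [form_latVec]
    linarith

end Average

/-! ### Translation between x and y for the given operators and products -/

section Specialization

/-- `√q` as a complex number. -/
def sqrtC (q : ℕ) : ℂ := ((Real.sqrt q : ℝ) : ℂ)

lemma sqrtC_sq (q : ℕ) : sqrtC q ^ 2 = q := by
  rw [sqrtC, ← Complex.ofReal_pow, Real.sq_sqrt (Nat.cast_nonneg q)]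
  simp

lemma sqrtC_sq_ne_one {q : ℕ} (hq : IsPrimePow q) : sqrtC q ^ 2 ≠ 1 := by
  rw [sqrtC_sq]
  exact_mod_cast hq.one_lt.ne'

lemma sqrtC_ne_zero {q : ℕ} (hq : IsPrimePow q) : sqrtC q ≠ 0 := by
  intro h
  have := sqrtC_sq q
  rw [h] at this
  exact hq.ne_zero (by exact_mod_cast (by simpa using this.symm : (q : ℂ) = 0))

variable {τ : Type*}

lemma x_eq_var (j : τ) : x j = var (RatFun τ) j := rfl

lemma sqrtConst_eq (q : ℕ) : sqrtConst τ q = cst (RatFun τ) (sqrtC q) := rfl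

lemma natCast_eq (q : ℕ) : (q : RatFun τ) = cst (RatFun τ) (sqrtC q) ^ 2 := by
  rw [cst, ← map_pow, sqrtC_sq, map_natCast]

variable [Fintype τ] (G : SimpleGraph τ) {q : ℕ} (hq : IsPrimePow q)

lemma isReflData_ratFun : IsReflData (RatFun τ) G (sqrtC q) (sigma G hq) (eps G) where
  ne_zero := sqrtC_ne_zero hq
  sigma_self i := by
    have h1 := cst_ne_zero (F := RatFun τ) (sqrtC_ne_zero hq)
    have h2 := var_ne_zero (F := RatFun τ) i
    rw [yvar, map_mul, AlgHom.commutes, ← x_eq_var, sigma_x, sigmaPt, if_pos rfl, natCast_eq,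
      x_eq_var]
    change cst (RatFun τ) (sqrtC q) * _ = _
    field_simp
  sigma_adj {i j} h := by
    rw [yvar, map_mul, AlgHom.commutes, ← x_eq_var, sigma_x, sigmaPt, if_neg h.ne', if_pos h,
      sqrtConst_eq, yvar, x_eq_var, x_eq_var]
    ring
  sigma_other {i j} hij h := by
    rw [yvar, map_mul, AlgHom.commutes, ← x_eq_var, sigma_x, sigmaPt, if_neg hij.symm, if_neg h]
  eps_adj {i j} h := by
    rw [yvar, map_mul, AlgHom.commutes, ← x_eq_var, eps_x, epsPt, if_pos h, mul_neg]
  eps_other {i j} h := by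
    rw [yvar, map_mul, AlgHom.commutes, ← x_eq_var, eps_x, epsPt, if_neg h]

lemma slash_eq_twist (l : τ → ℕ) (i : τ) (f : RatFun τ) :
    slash G hq l i f = twist (sqrtC q) (sigma G hq) (eps G) l i f := by
  have h1 := cst_ne_zero (F := RatFun τ) (sqrtC_ne_zero hq)
  have h2 := yvar_ne_zero (F := RatFun τ) (sqrtC_ne_zero hq) i
  have h3 := a_sub_ne_zero (F := RatFun τ) (sqrtC_ne_zero hq) i
  have h4 : (2 : RatFun τ) ≠ 0 := two_ne_zero_of_cst
  have e1 : x i * sqrtConst τ q = yvar (RatFun τ) (sqrtC q) i := by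
    rw [x_eq_var, sqrtConst_eq, yvar, mul_comm]
  have e2 : (q : RatFun τ) * x i = cst (RatFun τ) (sqrtC q) * yvar (RatFun τ) (sqrtC q) i := by
    rw [natCast_eq, x_eq_var, yvar]
    ring
  have e3 : x i = yvar (RatFun τ) (sqrtC q) i / cst (RatFun τ) (sqrtC q) := by
    rw [yvar, mul_div_cancel_left₀ _ h1, x_eq_var]
  have e4 : 1 - x i = (cst (RatFun τ) (sqrtC q) - yvar (RatFun τ) (sqrtC q) i) /
      cst (RatFun τ) (sqrtC q) := by
    rw [e3, sub_div, div_self h1]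
  rw [slash, plusPart, minusPart, e1, e2, e4, twist, coefP, coefQ]
  simp only [map_div₀, map_add, map_sub, map_mul, map_pow, map_neg, map_one, map_ofNat]
  generalize sigma G hq i f = u
  generalize sigma G hq i (eps G i f) = v
  generalize yvar (RatFun τ) (sqrtC q) i = y at *
  generalize cst (RatFun τ) (sqrtC q) = s at *
  field_simp
  ring

variable {ι V V' : Type*} [AddCommGroup V] [Module ℝ V] [AddCommGroup V'] [Module ℝ V']
  {P : RootPairing ι ℝ V V'} [P.IsRootSystem] [Finite ι] (b : P.Base)

include hq in
-- The height is the sum of the coordinates, so q^{d(β)} = a^{2d(β)} distributes over the variables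
-- and rescales each x_j to y_j.
lemma natCast_zpow_mul_mono (β : ι) :
    (q : RatFun b.support) ^ b.height β * mono b ((2 : ℤ) • P.rootSpanMem ℤ β) =
      ymon (RatFun b.support) (sqrtC q) ((2 : ℤ) • coord b β) := by
  have h1 := cst_ne_zero (F := RatFun b.support) (sqrtC_ne_zero hq)
  have e (j : b.support) : b.toWeightBasisInt.repr ((2 : ℤ) • P.rootSpanMem ℤ β) j =
      2 * coord b β j := by
    rw [map_smul]
    rfl
  have hp : (q : RatFun b.support) ^ b.height β =
      ∏ j, (q : RatFun b.support) ^ coord b β j := by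
    rw [height_eq_sum_coord]
    have hq0 := natCast_ne_zero (τ := b.support) hq
    induction (Finset.univ : Finset b.support) using Finset.cons_induction with
    | empty => simp
    | cons j s hj ih => rw [Finset.sum_cons, Finset.prod_cons, zpow_add₀ hq0, ih]
  rw [hp, mono, ymon, ← Finset.prod_mul_distrib]
  refine Finset.prod_congr rfl fun j _ => ?_
  rw [e, natCast_eq, x_eq_var, Pi.smul_apply, smul_eq_mul, yvar, mul_zpow, zpow_mul, zpow_mul,
    zpow_ofNat, zpow_ofNat]

include hq in
lemma delta_eq : Delta b q = deltaY b (RatFun b.support) (sqrtC q) :=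
  Finset.prod_congr rfl fun β _ => by rw [natCast_zpow_mul_mono hq]

include hq in
lemma denom_eq : denom b q = denomY b (RatFun b.support) (sqrtC q) :=
  Finset.prod_congr rfl fun β _ => by
    have e : cst (RatFun b.support) (sqrtC q ^ 2)⁻¹ = (q : RatFun b.support)⁻¹ := by
      rw [cst, map_inv₀, map_pow, natCast_eq]
    rw [zpow_sub_one₀ (natCast_ne_zero hq), mul_assoc, mul_left_comm, natCast_zpow_mul_mono hq, e]

end Specialization

end WeylSeries

end

theorem theorem3p2 {ι V V' : Type*} [Finite ι] [AddCommGroup V] [Module ℝ V]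
    [AddCommGroup V'] [Module ℝ V'] (P : RootPairing ι ℝ V V') [P.IsRootSystem]
    [P.IsCrystallographic] [P.IsReduced] (b : P.Base) (hsl : b.cartanMatrix.IsSimplyLaced)
    (q : ℕ) (hq : IsPrimePow q) (l : b.support → ℕ) :
    ∃ subst act : P.weylGroup → WeylSeries.RatFun b.support → WeylSeries.RatFun b.support,
      WeylSeries.IsWeylAction b
        (fun i => WeylSeries.sigma (WeylSeries.dynkinGraph b) hq i) subst ∧
      WeylSeries.IsWeylAction b
        (fun i => WeylSeries.slash (WeylSeries.dynkinGraph b) hq l i) act ∧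
      ∃ N : MvPolynomial b.support ℂ,
        WeylSeries.average b q subst act =
          algebraMap (MvPolynomial b.support ℂ) (WeylSeries.RatFun b.support) N /
            WeylSeries.denom b q ∧
        ∀ k ∈ N.support,
          ∑ j : b.support, k j • P.root j ∈ WeylSeries.permutahedron b l := by
  have H := WeylSeries.isReflData_ratFun (WeylSeries.dynkinGraph b) hq
  obtain ⟨φ, hφ⟩ := WeylSeries.exists_substitutions H hsl
  obtain ⟨ψ, hψ⟩ := WeylSeries.exists_twisted_action H hsl l
  refine ⟨fun w f => (φ w).unop f, fun w f => (ψ w).unop f, ⟨fun f => ?_, fun v w f => ?_,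
    fun i f => ?_⟩, ⟨fun f => ?_, fun v w f => ?_, fun i f => ?_⟩, ?_⟩
  · simp only [map_one]
    rfl
  · simp only [map_mul]
    rfl
  · simp only [hφ]
    rfl
  · simp only [map_one]
    rfl
  · simp only [map_mul]
    rfl
  · simp only [hψ, WeylSeries.slash_eq_twist]
    rfl
  · let _ := Fintype.ofFinite P.weylGroup
    have hΔ := WeylSeries.deltaY_ne_zero H
    -- K(w) is the summand j(w,x) (1|w)(x); it equals 1 at w = 1, and `kernel_mul` gives its
    -- recursion.
    obtain ⟨N, hN, hsupp⟩ := WeylSeries.exists_numerator H hsl (l := l)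
      (K := fun w => WeylSeries.deltaY b (WeylSeries.RatFun b.support) (WeylSeries.sqrtC q) /
        (φ w).unop (WeylSeries.deltaY b (WeylSeries.RatFun b.support) (WeylSeries.sqrtC q)) *
          (ψ w).unop 1)
      (by
        simp only [map_one]
        exact (mul_one _).trans (div_self hΔ))
      (fun w i => WeylSeries.kernel_mul H hsl hφ hψ w i) (WeylSeries.sqrtC_sq_ne_one hq)
    refine ⟨N, ?_, hsupp⟩
    rw [WeylSeries.denom_eq hq, ← hN]
    simp only [WeylSeries.average, WeylSeries.jFactor, WeylSeries.delta_eq hq]
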